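/- A *lattice* is a finitely generated free $\mathbb{Z}_2$-module $L$ with a nondegenerate symmetric $\mathbb{Z}_2$-bilinear form $L\times L\to\mathbb{Q}_2$; an *isometry* is a module isomorphism preserving the forms. A lattice is *unimodular* if its form is $\mathbb{Z}_2$-valued and the natural map $L\to\mathrm{Hom}(L,\mathbb{Z}_2)$ is an isomorphism; a unimodular lattice has *type II* if all norms $x\cdot x$ lie in $2\mathbb{Z}_2$, and *type I* otherwise. Its *sign* is the Legendre symbol $\left(\frac{\det}{2}\right)$ of its determinant, where $\left(\frac{u}{2}\right)=+$ for $u\equiv\pm1$ and $-$ for $u\equiv\pm3$ mod $8$. Its *oddity* in $\mathbb{Z}/8$ is obtained by diagonalizing the inner product matrix over $\mathbb{Q}_2$ and adding up the odd parts mod $8$ of the diagonal entries (the odd part of $2^ku$, $u\in\mathbb{Z}_2^\times$, is $u$), plus $4$ for each diagonal entry $2^ku$ with $k$ odd and $\left(\frac{u}{2}\right)=-$; this does not depend on the diagonalization. A *Jordan decomposition* of $L$ is an orthogonal direct sum decomposition $L=\bigoplus_{i\in\mathbb{Z}}L_i$ in which each *constituent* $L_i$ is a unimodular lattice $U_i$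 with its form multiplied by $2^i$ (the *scale*); constituents may be trivial, i.e. $0$. The sign, dimension and type of the term of scale $2^i$ are those of $U_i$ (so a trivial term has sign $+$, dimension $0$ and type II). A *compartment* is a set of type I constituents whose scales form a sequence of consecutive powers of $2$, maximal with these properties. Its dimension is the sum of the dimensions of its terms, and its oddity is the sum in $\mathbb{Z}/8$ of the oddities of the corresponding $U_i$. The *$2$-adic symbol* of the decomposition consists of the sign, dimension and type of the term of each scale, together with the oddity of each compartment. A *sign walk* may be applied to two nontrivial terms of a $2$-adic symbol that satisfy one of the following conditions: 1. they have adjacent scales (ratio $2$) and different types; 2. they have adjacent scales and both have type I, and their compartment has dimension $>2$ or oddity $\pm2$; 3. they both have type I, their scales differ by a factor of $4$, and the term of the scale between them is trivial. It negates the signs of the two terms and changes by $4$ the oddity of each compartment that contains at least one of them (only once if both lie in the same compartment), leaving everything else unchanged. **Theorem (Equivalence of $2$-adic symbols).** Let two lattices, each with a Jordan decomposition, be given. Then the lattices are isometric if and only if the $2$-adic symbols of these decompositions are related by a finite (possibly empty) sequence of sign walks. -/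

import Mathlib

open scoped Matrix

noncomputable section

namespace TwoAdic

/-! ### Numerical invariants of 2-adic numbers -/

theorem norm_mul_two_zpow_le_one (x : ℚ_[2]) : ‖x * (2 : ℚ_[2]) ^ (-x.valuation)‖ ≤ 1 := by
  by_cases hx : x = 0
  · simp [hx]
  · have h2 : ‖(2 : ℚ_[2])‖ = (2 : ℝ)⁻¹ := by
      simpa using Padic.norm_p (p := 2)
    rw [norm_mul, norm_zpow, Padic.norm_eq_zpow_neg_valuation hx, h2]
    have h : ((2 : ℝ) ^ x.valuation) ≠ 0 := by positivity
    simp [inv_mul_cancel₀ h]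

/-- The odd part modulo `8` of a 2-adic number: if `x = 2 ^ k * u` with `u` a 2-adic unit,
this is the class of `u` in `ℤ/8`. (It is `0` for `x = 0`.) -/
def oddPart (x : ℚ_[2]) : ZMod 8 :=
  (PadicInt.toZModPow 3 : ℤ_[2] →+* ZMod (2 ^ 3))
    (⟨x * (2 : ℚ_[2]) ^ (-x.valuation), norm_mul_two_zpow_le_one x⟩ : ℤ_[2])

/-- The Legendre symbol `(u / 2)` of an odd residue class `u` modulo `8`:
`+` if `u ≡ ±1` and `-` if `u ≡ ±3`. -/
def legendre (u : ZMod 8) : ℤˣ :=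
  if u = 1 ∨ u = -1 then 1 else -1

/-- `x` is an antisquare: `x = 2 ^ k * u` with `k` odd, `u` a unit and `(u / 2) = -`. -/
def IsAntisquare (x : ℚ_[2]) : Prop :=
  x ≠ 0 ∧ Odd x.valuation ∧ legendre (oddPart x) = -1

open Classical in
/-- The oddity of the diagonal form with entries `d`: the sum of the odd parts of the entries,
plus `4` for each antisquare among them. -/
def diagOddity {n : ℕ} (d : Fin n → ℚ_[2]) : ZMod 8 :=
  ∑ i, (oddPart (d i) + if IsAntisquare (d i) then 4 else 0)

/-- `d` is the diagonal of a diagonalization, by a change of basis over `ℚ_2`, of the inner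
product matrix `G`. -/
def IsDiagonalization {n : ℕ} (G : Matrix (Fin n) (Fin n) ℚ_[2]) (d : Fin n → ℚ_[2]) : Prop :=
  ∃ P : Matrix (Fin n) (Fin n) ℚ_[2], IsUnit P.det ∧ Pᵀ * G * P = Matrix.diagonal d

open Classical in
/-- The oddity of a symmetric matrix over `ℚ_2`: diagonalize it over `ℚ_2` and take the oddity
of the diagonal (which does not depend on the diagonalization). Every symmetric matrix can be
diagonalized; the value at other matrices is irrelevant. -/
def matrixOddity {n : ℕ} (G : Matrix (Fin n) (Fin n) ℚ_[2]) : ZMod 8 :=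
  if h : ∃ d, IsDiagonalization G d then diagOddity h.choose else 0

/-! ### Lattices

A 2-adic lattice is a finitely generated free `ℤ_2`-module `L` with a nondegenerate symmetric
`ℤ_2`-bilinear form `B : L × L → ℚ_2`. -/

section Lattice

variable {L : Type*} [AddCommGroup L] [Module ℤ_[2] L]

/-- Two lattices are isometric. -/
def Isometric {L' : Type*} [AddCommGroup L'] [Module ℤ_[2] L']
    (B : L →ₗ[ℤ_[2]] L →ₗ[ℤ_[2]] ℚ_[2]) (B' : L' →ₗ[ℤ_[2]] L' →ₗ[ℤ_[2]] ℚ_[2]) : Prop :=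
  ∃ e : L ≃ₗ[ℤ_[2]] L', ∀ x y, B' (e x) (e y) = B x y

/-- The lattice is unimodular: all inner products are integral, and the natural map to
`Hom(L, ℤ_2)` is an isomorphism. -/
def IsUnimodular (B : L →ₗ[ℤ_[2]] L →ₗ[ℤ_[2]] ℚ_[2]) : Prop :=
  ∃ b : L →ₗ[ℤ_[2]] L →ₗ[ℤ_[2]] ℤ_[2],
    (∀ x y, ((b x y : ℤ_[2]) : ℚ_[2]) = B x y) ∧ Function.Bijective b

/-- All norms `B x x` lie in `2 ℤ_2`. -/
def IsEven (B : L →ₗ[ℤ_[2]] L →ₗ[ℤ_[2]] ℚ_[2]) : Prop :=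
  ∀ x, ∃ z : ℤ_[2], B x x = 2 * (z : ℚ_[2])

/-- The inner product matrix with respect to a basis. -/
def gram [Module.Free ℤ_[2] L] [Module.Finite ℤ_[2] L]
    (B : L →ₗ[ℤ_[2]] L →ₗ[ℤ_[2]] ℚ_[2]) :
    Matrix (Fin (Module.finrank ℤ_[2] L)) (Fin (Module.finrank ℤ_[2] L)) ℚ_[2] :=
  Matrix.of fun i j => B (Module.finBasis ℤ_[2] L i) (Module.finBasis ℤ_[2] L j)

/-- The sign of a unimodular lattice: the Legendre symbol of its determinant (a 2-adic unit). -/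
def latticeSign [Module.Free ℤ_[2] L] [Module.Finite ℤ_[2] L]
    (B : L →ₗ[ℤ_[2]] L →ₗ[ℤ_[2]] ℚ_[2]) : ℤˣ :=
  legendre (oddPart (gram B).det)

/-- The oddity of a lattice, that is, of the quadratic space it spans over `ℚ_2`. -/
def latticeOddity [Module.Free ℤ_[2] L] [Module.Finite ℤ_[2] L]
    (B : L →ₗ[ℤ_[2]] L →ₗ[ℤ_[2]] ℚ_[2]) : ZMod 8 :=
  matrixOddity (gram B)

/-- The sublattice `N` with all inner products divided by `2 ^ i`. -/
def rescale (B : L →ₗ[ℤ_[2]] L →ₗ[ℤ_[2]] ℚ_[2]) (N : Submodule ℤ_[2] L) (i : ℤ) :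
    N →ₗ[ℤ_[2]] N →ₗ[ℤ_[2]] ℚ_[2] :=
  ((2 : ℚ_[2]) ^ (-i)) • B.domRestrict₁₂ N N

/-- A Jordan decomposition: an orthogonal direct sum decomposition whose constituents are
unimodular lattices scaled by different powers of `2`. The constituents are indexed by all
exponents `i : ℤ`, the constituent of scale `2 ^ i` being trivial (zero) where there is none. -/
structure JordanDecomposition (B : L →ₗ[ℤ_[2]] L →ₗ[ℤ_[2]] ℚ_[2]) where
  constituent : ℤ → Submodule ℤ_[2] L
  isInternal : DirectSum.IsInternal constituent
  orthogonal : ∀ i j, i ≠ j → ∀ x ∈ constituent i, ∀ y ∈ constituent j, B x y = 0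
  unimodular : ∀ i, IsUnimodular (rescale B (constituent i) i)

end Lattice

/-! ### 2-adic symbols -/

/-- The compartment containing the term of scale `2 ^ i`, as a set of exponents, where `typeI`
tells which terms have type I: the maximal run of consecutive exponents of type I that
contains `i`. It is empty if the term of scale `2 ^ i` has type II. -/
def compartment (typeI : ℤ → Prop) (i : ℤ) : Set ℤ :=
  {j | ∀ k ∈ Set.uIcc i j, typeI k}

/-- The data displayed by a 2-adic symbol: for each scale `2 ^ i` the sign, the dimension and the
type of the term of that scale (trivial terms are `+`, dimension `0`, type II), and for each
compartment its oddity. -/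
@[ext]
structure Symbol where
  sign : ℤ → ℤˣ
  dim : ℤ → ℕ
  typeI : ℤ → Prop
  /-- `oddity i` is the oddity of the compartment containing the term of scale `2 ^ i`
  (and `0` if this term has type II). -/
  oddity : ℤ → ZMod 8

/-- The 2-adic symbol of a Jordan decomposition. The sign, type and oddity of a constituent are
those of the unimodular lattice it is a scaled copy of, and the oddity of a compartment is the
sum of the oddities of its constituents. -/
def JordanDecomposition.symbol {L : Type*} [AddCommGroup L] [Module ℤ_[2] L]
    [Module.Free ℤ_[2] L] [Module.Finite ℤ_[2] L] {B : L →ₗ[ℤ_[2]] L →ₗ[ℤ_[2]] ℚ_[2]}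
    (J : JordanDecomposition B) : Symbol where
  sign i := latticeSign (rescale B (J.constituent i) i)
  dim i := Module.finrank ℤ_[2] (J.constituent i)
  typeI i := ¬ IsEven (rescale B (J.constituent i) i)
  oddity i :=
    ∑ᶠ j ∈ compartment (fun k => ¬ IsEven (rescale B (J.constituent k) k)) i,
      latticeOddity (rescale B (J.constituent j) j)

namespace Symbol

/-- The total dimension of the compartment containing the term of scale `2 ^ i`. -/
def compartmentDim (S : Symbol) (i : ℤ) : ℕ :=
  ∑ᶠ j ∈ compartment S.typeI i, S.dim j

/-- The conditions on two nontrivial terms, of scales `2 ^ i < 2 ^ j`, for a sign walk between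
them: (1) adjacent scales and different types; (2) adjacent scales, both of type I, and their
compartment has dimension `> 2` or oddity `±2`; (3) both of type I, scales differing by a factor
of `4`, and the term between them is trivial. -/
def CanWalk (S : Symbol) (i j : ℤ) : Prop :=
  S.dim i ≠ 0 ∧ S.dim j ≠ 0 ∧
    ((j = i + 1 ∧ ((S.typeI i ∧ ¬ S.typeI j) ∨ (¬ S.typeI i ∧ S.typeI j))) ∨
     (j = i + 1 ∧ S.typeI i ∧ S.typeI j ∧
        (2 < S.compartmentDim i ∨ S.oddity i = 2 ∨ S.oddity i = -2)) ∨
     (j = i + 2 ∧ S.typeI i ∧ S.typeI j ∧ S.dim (i + 1) = 0))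

open Classical in
/-- Negate the signs of the terms of scales `2 ^ i` and `2 ^ j`, and change by `4` the oddity of
each compartment containing one of them (once, if both lie in the same compartment). -/
def walk (S : Symbol) (i j : ℤ) : Symbol where
  sign k := if k = i ∨ k = j then - S.sign k else S.sign k
  dim := S.dim
  typeI := S.typeI
  oddity k :=
    if k ∈ compartment S.typeI i ∪ compartment S.typeI j then S.oddity k + 4 else S.oddity k

/-- `S'` arises from `S` by one sign walk. -/
def SignWalk (S S' : Symbol) : Prop :=
  ∃ i j, S.CanWalk i j ∧ S' = S.walk i j

end Symbol

end TwoAdic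

end

noncomputable section

namespace TwoAdic

/-! ### Arithmetic of 2-adic integers modulo `8` -/

/-! The invariant behind the theorem is a Gauss sum. Let `psi` be an additive character of ℚ_2 that
is trivial on ℤ_2 and equal to -1 on halves of units. For a lattice and an integer k, the mean of
ψ(2^(-k) B(x,x)/2) over the lattice depends only on the isometry class and is multiplicative for
orthogonal sums. A rank one term of scale exactly 2^k makes it vanish. If the term of scale 2^k has
type II, the mean is a positive multiple of exp(2πip/8), where the phase p is the sum over j < k of
the oddity of the j-th term, plus 4 for each j < k with k - j odd and sign -. To compute this for a
unimodular lattice (`IsUnimodular.formPhase_of_isDiagonalization`), the lattice is embedded in a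
diagonal one, where the mean is a product of classical quadratic Gauss sums. Vectors outside the
image contribute nothing, by unimodularity (`HasMean.restrict`).

Dimensions and types of Jordan terms are invariants for elementary reasons (`finrank_le`,
`isEven_iff`). Hence isometric lattices have symbols with equal dimensions, types and phases at type
II scales, and sign walks preserve exactly these data (`Symbol.Legal.walk_phase_eq`). It remains to
prove two converses.

Symbols: suppose two symbols of lattices share these data, and let i be the least scale at which
their signs differ. If no sign walk from i to a higher scale were available, the phases at i + 1 or
i + 2, or the rigidity of compartments made of two one-dimensional terms, would be contradicted
(`Symbol.SamePhase.exists_canWalk`). Walking corrects the signs from the bottom up. Once all signs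
agree, the phases force the compartment oddities to agree.

Lattices: every Jordan term is a sum of blocks, namely rank one forms 2^k u with u odd modulo 8 and
two kinds of even planes. Explicit vectors give exchange relations between pairs of blocks. For two
sums of blocks with the same shapes and phases, these relations produce a common block of least
scale, and the phases exclude every obstruction (`Blocks.Match.common`). The common block is removed
from both lists and the comparison continues by induction. Cancellation of lattices is never used,
since only the lists and their phases are cancelled. -/

theorem norm_two : ‖(2 : ℚ_[2])‖ = (2 : ℝ)⁻¹ := by
  exact Padic.norm_p (p := 2)

theorem valuation_two_zpow (k : ℤ) : ((2 : ℚ_[2]) ^ k).valuation = k := by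
  simp

@[simp, norm_cast]
theorem coe_ofNat (n : ℕ) [n.AtLeastTwo] :
    ((ofNat(n) : ℤ_[2]) : ℚ_[2]) = ofNat(n) := rfl

/-- The residue class modulo `8` of a 2-adic integer. -/
def mod8 : ℤ_[2] →+* ZMod 8 := (PadicInt.toZModPow 3 : ℤ_[2] →+* ZMod (2 ^ 3))

theorem toZModPow_eq_zero_iff (n : ℕ) (z : ℤ_[2]) :
    PadicInt.toZModPow n z = 0 ↔ (2 : ℤ_[2]) ^ n ∣ z := by
  rw [← RingHom.mem_ker, PadicInt.ker_toZModPow, Ideal.mem_span_singleton]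
  norm_cast

theorem mod8_eq_zero_iff (z : ℤ_[2]) : mod8 z = 0 ↔ 8 ∣ z := by
  have := toZModPow_eq_zero_iff 3 z
  norm_num at this
  exact this

theorem isUnit_iff_not_two_dvd (z : ℤ_[2]) : IsUnit z ↔ ¬ (2 : ℤ_[2]) ∣ z := by
  rw [← not_iff_not, not_not, PadicInt.not_isUnit_iff]
  simpa using PadicInt.norm_lt_one_iff_dvd z

/-- Residue classes modulo `8` that are odd. -/
def IsOdd (u : ZMod 8) : Prop := u = 1 ∨ u = 3 ∨ u = 5 ∨ u = 7

instance : DecidablePred IsOdd := fun u => by unfold IsOdd; infer_instance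

/-- Odd classes modulo 8 are those not annihilated by 4, and 8 divides 4z only if 2 divides z. -/
theorem isOdd_iff_isUnit_mod8 (z : ℤ_[2]) : IsOdd (mod8 z) ↔ IsUnit z := by
  have key : ∀ u : ZMod 8, IsOdd u ↔ 4 * u ≠ 0 := by decide
  have h4 : (4 : ZMod 8) * mod8 z = mod8 (4 * z) := by
    rw [map_mul, map_ofNat]
  rw [key, isUnit_iff_not_two_dvd, h4, ne_eq, not_iff_not, mod8_eq_zero_iff]
  constructor
  · rintro ⟨w, hw⟩
    exact ⟨w, mul_left_cancel₀ (by norm_num : (4 : ℤ_[2]) ≠ 0) (by rw [hw]; ring)⟩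
  · rintro ⟨w, rfl⟩
    exact ⟨w, by ring⟩

theorem two_dvd_or_isUnit (z : ℤ_[2]) : (2 : ℤ_[2]) ∣ z ∨ IsUnit z := by
  rw [isUnit_iff_not_two_dvd]; exact em _

theorem isUnit_iff_two_dvd_sub_one (z : ℤ_[2]) : IsUnit z ↔ (2 : ℤ_[2]) ∣ z - 1 := by
  constructor
  · intro h
    rcases two_dvd_or_isUnit (z - 1) with h' | h'
    · exact h'
    · rw [← isOdd_iff_isUnit_mod8] at h h'
      exfalso
      rw [map_sub, map_one] at h'
      revert h h'
      generalize mod8 z = u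
      revert u
      decide
  · intro h
    rw [isUnit_iff_not_two_dvd]
    intro h'
    have : (2 : ℤ_[2]) ∣ 1 := by simpa using dvd_sub h' h
    have h1 := (isUnit_iff_not_two_dvd 1).1 isUnit_one
    exact h1 this

theorem isUnit_add_of_two_dvd {z w : ℤ_[2]} (hz : IsUnit z) (hw : (2 : ℤ_[2]) ∣ w) :
    IsUnit (z + w) := by
  rw [isUnit_iff_two_dvd_sub_one] at *
  rw [add_sub_right_comm]
  exact dvd_add hz hw

theorem two_dvd_add_of_isUnit {z w : ℤ_[2]} (hz : IsUnit z) (hw : IsUnit w) :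
    (2 : ℤ_[2]) ∣ z + w := by
  rw [isUnit_iff_two_dvd_sub_one] at *
  have := dvd_add (dvd_add hz hw) (dvd_refl 2)
  convert this using 1
  ring

/-- Hensel's lemma for quadratic polynomials with odd linear coefficient. -/
theorem exists_quadratic_root (a b c : ℤ_[2]) (hb : IsUnit b) (hc : (2 : ℤ_[2]) ∣ c) :
    ∃ t : ℤ_[2], (2 : ℤ_[2]) ∣ t ∧ a * t ^ 2 + b * t + c = 0 := by
  let F : Polynomial ℤ_[2] := .C a * .X ^ 2 + .C b * .X + .C c
  have hF : ∀ t, F.aeval t = a * t ^ 2 + b * t + c := fun t => by simp [F]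
  have hF' : F.derivative.aeval (0 : ℤ_[2]) = b := by simp [F]
  have hb1 : ‖b‖ = 1 := PadicInt.isUnit_iff.1 hb
  have hc1 : ‖c‖ < 1 := by
    simpa using (PadicInt.norm_lt_one_iff_dvd c).2 (by simpa using hc)
  obtain ⟨z, hz, hz', -⟩ := hensels_lemma (F := F) (a := (0 : ℤ_[2])) (by
    rw [hF, hF', hb1]; simpa using hc1)
  refine ⟨z, ?_, by rw [← hF, hz]⟩
  rw [hF', hb1, sub_zero] at hz'
  simpa using (PadicInt.norm_lt_one_iff_dvd z).1 hz'

/-- A 2-adic unit that is `1` modulo `8` is a square. -/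
theorem exists_sq_of_mod8_eq_one {z : ℤ_[2]} (h : mod8 z = 1) : ∃ s : ℤ_[2], IsUnit s ∧ z = s ^ 2 := by
  have : mod8 (z - 1) = 0 := by simp [h]
  obtain ⟨w, hw⟩ := (mod8_eq_zero_iff _).1 this
  -- With z = 1 + 8w, the equation z = (1 + 2t)² reads t² + t = 2w, which has odd linear
  -- coefficient.
  obtain ⟨t, ht, hroot⟩ := exists_quadratic_root 1 1 (-2 * w) isUnit_one ⟨-w, by ring⟩
  refine ⟨1 + 2 * t, isUnit_add_of_two_dvd isUnit_one ⟨t, rfl⟩, ?_⟩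
  linear_combination hw - 4 * hroot

theorem exists_sq_mul_of_mod8_eq {z w : ℤ_[2]} (hz : IsUnit z) (h : mod8 z = mod8 w) :
    ∃ s : ℤ_[2], IsUnit s ∧ w = z * s ^ 2 := by
  obtain ⟨y, hy⟩ := hz.exists_right_inv
  obtain ⟨s, hs, h'⟩ := exists_sq_of_mod8_eq_one (z := y * w) (by
    rw [map_mul, ← h, ← map_mul, mul_comm, hy, map_one])
  exact ⟨s, hs, by rw [← h']; linear_combination (-w) * hy⟩

/-! ### Odd parts -/

theorem exists_eq_zpow_mul (x : ℚ_[2]) (hx : x ≠ 0) :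
    ∃ z : ℤ_[2], IsUnit z ∧ x = 2 ^ x.valuation * (z : ℚ_[2]) := by
  have h2 : (2 : ℚ_[2]) ≠ 0 := two_ne_zero
  refine ⟨⟨x * 2 ^ (-x.valuation), norm_mul_two_zpow_le_one x⟩, PadicInt.isUnit_iff.2 ?_, ?_⟩
  · change ‖x * 2 ^ (-x.valuation)‖ = 1
    rw [norm_mul, norm_zpow, Padic.norm_eq_zpow_neg_valuation hx, norm_two]
    have h : ((2 : ℝ) ^ x.valuation) ≠ 0 := by positivity
    simp [inv_mul_cancel₀ h]
  · change x = 2 ^ x.valuation * (x * 2 ^ (-x.valuation))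
    rw [zpow_neg]
    field_simp

theorem valuation_zpow_mul (k : ℤ) {z : ℤ_[2]} (hz : IsUnit z) :
    ((2 : ℚ_[2]) ^ k * (z : ℚ_[2])).valuation = k := by
  have hz0 : (z : ℚ_[2]) ≠ 0 := by simpa using hz.ne_zero
  rw [Padic.valuation_mul (zpow_ne_zero _ two_ne_zero) hz0, valuation_two_zpow,
    PadicInt.valuation_coe]
  have := PadicInt.norm_eq_zpow_neg_valuation hz.ne_zero
  rw [PadicInt.isUnit_iff.1 hz] at this
  have h : (z.valuation : ℤ) = 0 := by
    by_contra hne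
    have h1 : (1 : ℝ) < 2 ^ (z.valuation : ℤ) := by
      apply one_lt_zpow₀ (by norm_num); omega
    rw [zpow_neg] at this
    have h3 : ((2 : ℝ) ^ (z.valuation : ℤ)) = 1 := by
      have := congrArg Inv.inv this
      simpa using this.symm
    exact absurd h3 h1.ne'
  rw [h, add_zero]

theorem oddPart_zpow_mul (k : ℤ) {z : ℤ_[2]} (hz : IsUnit z) :
    oddPart ((2 : ℚ_[2]) ^ k * (z : ℚ_[2])) = mod8 z := by
  unfold oddPart mod8
  congr 1
  apply Subtype.ext
  change (2 : ℚ_[2]) ^ k * (z : ℚ_[2]) * 2 ^ (-((2 : ℚ_[2]) ^ k * (z : ℚ_[2])).valuation) = z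
  rw [valuation_zpow_mul k hz, zpow_neg]
  have : (2 : ℚ_[2]) ^ k ≠ 0 := zpow_ne_zero _ two_ne_zero
  field_simp

theorem isOdd_oddPart {x : ℚ_[2]} (hx : x ≠ 0) : IsOdd (oddPart x) := by
  obtain ⟨z, hz, h⟩ := exists_eq_zpow_mul x hx
  rw [h, oddPart_zpow_mul _ hz, isOdd_iff_isUnit_mod8]
  exact hz

theorem oddPart_mul {x y : ℚ_[2]} (hx : x ≠ 0) (hy : y ≠ 0) :
    oddPart (x * y) = oddPart x * oddPart y := by
  obtain ⟨z, hz, h⟩ := exists_eq_zpow_mul x hx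
  obtain ⟨w, hw, h'⟩ := exists_eq_zpow_mul y hy
  have : x * y = 2 ^ (x.valuation + y.valuation) * ((z * w : ℤ_[2]) : ℚ_[2]) := by
    rw [zpow_add₀ two_ne_zero, PadicInt.coe_mul]
    conv_lhs => rw [h, h']
    ring
  rw [this, oddPart_zpow_mul _ (hz.mul hw), map_mul, h, h', oddPart_zpow_mul _ hz,
    oddPart_zpow_mul _ hw]

theorem oddPart_one : oddPart 1 = 1 := by
  have := oddPart_zpow_mul 0 (z := 1) isUnit_one
  simpa using this

theorem oddPart_sq {x : ℚ_[2]} (hx : x ≠ 0) : oddPart (x ^ 2) = 1 := by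
  rw [sq, oddPart_mul hx hx]
  have := isOdd_oddPart hx
  revert this
  generalize oddPart x = u
  revert u
  decide

theorem oddPart_two_zpow (k : ℤ) : oddPart ((2 : ℚ_[2]) ^ k) = 1 := by
  have := oddPart_zpow_mul k (z := 1) isUnit_one
  simpa using this

theorem oddPart_two_zpow_mul (k : ℤ) {x : ℚ_[2]} (hx : x ≠ 0) :
    oddPart ((2 : ℚ_[2]) ^ k * x) = oddPart x := by
  rw [oddPart_mul (zpow_ne_zero _ two_ne_zero) hx, oddPart_two_zpow, one_mul]

theorem legendre_mul {u v : ZMod 8} (hu : IsOdd u) (hv : IsOdd v) :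
    legendre (u * v) = legendre u * legendre v := by
  revert u v
  unfold legendre
  decide

theorem legendre_oddPart_prod {ι : Type*} (s : Finset ι) (d : ι → ℚ_[2]) (hd : ∀ i ∈ s, d i ≠ 0) :
    legendre (oddPart (∏ i ∈ s, d i)) = ∏ i ∈ s, legendre (oddPart (d i)) := by
  classical
  induction s using Finset.induction_on with
  | empty => simp [oddPart_one, legendre]
  | insert i s hi ih =>
    have hs : ∀ j ∈ s, d j ≠ 0 := fun j hj => hd j (Finset.mem_insert_of_mem hj)
    have h1 := hd i (Finset.mem_insert_self _ _)
    have h2 : ∏ j ∈ s, d j ≠ 0 := Finset.prod_ne_zero_iff.2 hs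
    rw [Finset.prod_insert hi, Finset.prod_insert hi, oddPart_mul h1 h2,
      legendre_mul (isOdd_oddPart h1) (isOdd_oddPart h2), ih hs]

/-! ### An additive character of `ℚ_2` with kernel `ℤ_2` -/

/-- The character `z ↦ exp (2 π i z / 2 ^ N)` of `ℤ_2`. -/
def levelChar (N : ℕ) : AddChar ℤ_[2] ℂ :=
  (ZMod.stdAddChar (N := 2 ^ N)).compAddMonoidHom
    (PadicInt.toZModPow N : ℤ_[2] →+* ZMod (2 ^ N)).toAddMonoidHom

theorem levelChar_apply (N : ℕ) (z : ℤ_[2]) :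
    levelChar N z = ZMod.stdAddChar (PadicInt.toZModPow N z : ZMod (2 ^ N)) := rfl

/-- Both sides are evaluated at one integer approximating z modulo 2^(N+1). This compatibility is
what glues the characters of all levels into a character of ℚ_2. -/
theorem levelChar_succ (N : ℕ) (z : ℤ_[2]) : levelChar (N + 1) (2 * z) = levelChar N z := by
  have h : (2 : ℤ_[2]) ^ (N + 1) ∣ z - (z.appr (N + 1) : ℤ) := by
    have := PadicInt.appr_spec (N + 1) z
    rw [Ideal.mem_span_singleton] at this
    exact_mod_cast this
  have h1 : PadicInt.toZModPow (N + 1) z = ((z.appr (N + 1) : ℤ) : ZMod (2 ^ (N + 1))) := by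
    rw [← sub_eq_zero, ← map_intCast (PadicInt.toZModPow (p := 2) (N + 1)), ← map_sub,
      toZModPow_eq_zero_iff]
    exact h
  have h2 : PadicInt.toZModPow N z = ((z.appr (N + 1) : ℤ) : ZMod (2 ^ N)) := by
    rw [← sub_eq_zero, ← map_intCast (PadicInt.toZModPow (p := 2) N), ← map_sub,
      toZModPow_eq_zero_iff]
    exact (pow_dvd_pow _ (Nat.le_succ N)).trans h
  have h3 : PadicInt.toZModPow (N + 1) (2 * z) =
      ((2 * (z.appr (N + 1) : ℤ) : ℤ) : ZMod (2 ^ (N + 1))) := by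
    rw [map_mul, h1, map_ofNat]; simp
  rw [levelChar_apply, levelChar_apply, h2, h3, ZMod.stdAddChar_coe, ZMod.stdAddChar_coe]
  congr 1
  push_cast
  field_simp
  ring

theorem levelChar_add (N m : ℕ) (z : ℤ_[2]) : levelChar (N + m) (2 ^ m * z) = levelChar N z := by
  induction m with
  | zero => simp
  | succ m ih =>
    rw [← ih, ← add_assoc, pow_succ', mul_assoc, levelChar_succ]

theorem levelChar_eq {N N' : ℕ} {z z' : ℤ_[2]}
    (h : (z : ℚ_[2]) / 2 ^ N = (z' : ℚ_[2]) / 2 ^ N') : levelChar N z = levelChar N' z' := by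
  wlog hle : N ≤ N' generalizing N N' z z'
  · exact (this h.symm (by omega)).symm
  obtain ⟨m, rfl⟩ := Nat.exists_eq_add_of_le hle
  rw [← levelChar_add N m z]
  congr 1
  have : (z' : ℚ_[2]) = 2 ^ m * (z : ℚ_[2]) := by
    field_simp at h
    rw [pow_add] at h
    have h2 : (2 : ℚ_[2]) ^ N ≠ 0 := pow_ne_zero _ two_ne_zero
    apply mul_left_cancel₀ h2
    linear_combination -h
  apply Subtype.coe_injective
  push_cast
  exact this.symm

theorem exists_eq_div_pow (x : ℚ_[2]) : ∃ (N : ℕ) (z : ℤ_[2]), x = (z : ℚ_[2]) / 2 ^ N := by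
  refine ⟨(-x.valuation).toNat, ⟨x * 2 ^ (-x.valuation).toNat, ?_⟩, ?_⟩
  · by_cases hx : x = 0
    · simp [hx]
    have h1 := norm_mul_two_zpow_le_one x
    rw [norm_mul, norm_pow, norm_two]
    rw [norm_mul, norm_zpow, norm_two] at h1
    refine le_trans ?_ h1
    gcongr
    rw [← zpow_natCast]
    apply zpow_le_zpow_right_of_le_one₀ (by norm_num) (by norm_num)
    omega
  · change x = x * 2 ^ (-x.valuation).toNat / 2 ^ (-x.valuation).toNat
    field_simp

/-- An element of ℚ_2 is written as z / 2^N. By `levelChar_eq` the value does not depend on the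
fraction, and additivity is checked over a common denominator. -/
theorem exists_addChar : ∃ ψ : AddChar ℚ_[2] ℂ, ∀ (N : ℕ) (z : ℤ_[2]),
    ψ ((z : ℚ_[2]) / 2 ^ N) = levelChar N z := by
  choose N z h using exists_eq_div_pow
  have key : ∀ (M : ℕ) (w : ℤ_[2]), levelChar (N (w / 2 ^ M)) (z (w / 2 ^ M)) = levelChar M w :=
    fun M w => levelChar_eq (h _).symm
  refine ⟨⟨fun x => levelChar (N x) (z x), ?_, ?_⟩, key⟩
  · have := key 0 0
    simpa using this
  · intro x y
    obtain ⟨M, w, hx⟩ := exists_eq_div_pow x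
    obtain ⟨M', w', hy⟩ := exists_eq_div_pow y
    have hx' : x = ((w * 2 ^ M' : ℤ_[2]) : ℚ_[2]) / 2 ^ (M + M') := by
      rw [hx]; simp only [PadicInt.coe_mul, PadicInt.coe_pow, coe_ofNat]; rw [pow_add]; field_simp
    have hy' : y = ((w' * 2 ^ M : ℤ_[2]) : ℚ_[2]) / 2 ^ (M + M') := by
      rw [hy]; simp only [PadicInt.coe_mul, PadicInt.coe_pow, coe_ofNat]; rw [pow_add]; field_simp
    have hxy : x + y = ((w * 2 ^ M' + w' * 2 ^ M : ℤ_[2]) : ℚ_[2]) / 2 ^ (M + M') := by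
      rw [hx', hy', PadicInt.coe_add, add_div]
    rw [hxy, hx', hy', key, key, key, AddChar.map_add_eq_mul]

/-- The standard additive character of `ℚ_2`, with kernel `ℤ_2`. -/
def psi : AddChar ℚ_[2] ℂ := exists_addChar.choose

theorem psi_div_pow (N : ℕ) (z : ℤ_[2]) : psi ((z : ℚ_[2]) / 2 ^ N) = levelChar N z :=
  exists_addChar.choose_spec N z

theorem psi_intCast (z : ℤ_[2]) : psi (z : ℚ_[2]) = 1 := by
  have := psi_div_pow 0 z
  rw [pow_zero, div_one] at this
  rw [this, levelChar_apply]
  have : PadicInt.toZModPow 0 z = 0 := by rw [toZModPow_eq_zero_iff]; simp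
  rw [this, AddChar.map_zero_eq_one]

/-- The character `u ↦ exp (2 π i u / 8)` of `ℤ/8`. -/
def zeta8 : AddChar (ZMod 8) ℂ := ZMod.stdAddChar

theorem zeta8_injective : Function.Injective zeta8 := ZMod.injective_stdAddChar

theorem norm_zeta8 (u : ZMod 8) : ‖zeta8 u‖ = 1 := by
  exact Circle.norm_coe _

theorem zeta8_four : zeta8 4 = -1 := by
  have h := ZMod.stdAddChar_coe (N := 8) 4
  have : (2 * Real.pi * Complex.I * ((4 : ℤ) : ℂ) / ((8 : ℕ) : ℂ)) = Real.pi * Complex.I := by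
    push_cast; ring
  rw [this, Complex.exp_pi_mul_I] at h
  exact h

theorem psi_div_eight (z : ℤ_[2]) : psi ((z : ℚ_[2]) / 8) = zeta8 (mod8 z) := by
  have := psi_div_pow 3 z
  norm_num at this
  exact this

theorem psi_div_two_of_isUnit {z : ℤ_[2]} (hz : IsUnit z) : psi ((z : ℚ_[2]) / 2) = -1 := by
  have h : (z : ℚ_[2]) / 2 = ((4 * z : ℤ_[2]) : ℚ_[2]) / 8 := by
    rw [PadicInt.coe_mul, coe_ofNat]; ring
  rw [h, psi_div_eight, ← zeta8_four, map_mul]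
  congr 1
  rw [← isOdd_iff_isUnit_mod8] at hz
  rw [show mod8 4 = 4 from map_ofNat mod8 4]
  revert hz
  generalize mod8 z = u
  revert u
  decide

/-- A power of 2 turns a non-integral x into half a unit, where `psi` is -1. This supplies the
oscillation needed for `HasPhase.restrict`. -/
theorem exists_psi_mul_ne_one {x : ℚ_[2]} (hx : ∀ z : ℤ_[2], x ≠ z) :
    ∃ w : ℤ_[2], psi (x * w) ≠ 1 := by
  have hnorm : 1 < ‖x‖ := by
    by_contra h
    exact hx ⟨x, not_lt.1 h⟩ rfl
  have hx0 : x ≠ 0 := by rintro rfl; simp at hnorm; linarith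
  obtain ⟨z, hz, h⟩ := exists_eq_zpow_mul x hx0
  obtain ⟨y, hy⟩ := hz.exists_right_inv
  have hv : x.valuation ≤ -1 := by
    by_contra hv
    have : ‖x‖ ≤ 1 := by
      rw [Padic.norm_eq_zpow_neg_valuation hx0]
      apply zpow_le_one_of_nonpos₀ (by norm_num); omega
    linarith
  obtain ⟨m, hm⟩ := Int.eq_ofNat_of_zero_le (a := -1 - x.valuation) (by omega)
  refine ⟨2 ^ m, ?_⟩
  have : x * ((2 ^ m : ℤ_[2]) : ℚ_[2]) = (z : ℚ_[2]) / 2 := by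
    conv_lhs => rw [h]
    rw [PadicInt.coe_pow, coe_ofNat]
    have e : x.valuation = -1 - m := by omega
    rw [e, zpow_sub₀ two_ne_zero, zpow_natCast, zpow_neg, zpow_one]
    field_simp
  rw [this, psi_div_two_of_isUnit hz]
  norm_num

/-! ### Means of periodic functions -/

/-- The function `f` factors through a finite quotient of `A`, and `c` is its mean. -/
def HasMean {A : Type*} [AddCommGroup A] (f : A → ℂ) (c : ℂ) : Prop :=
  ∃ (F : Type) (_ : AddCommGroup F) (_ : Fintype F) (π : A →+ F) (g : F → ℂ),
    Function.Surjective π ∧ (∀ x, f x = g (π x)) ∧ ∑ t, g t = c * Fintype.card F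

/-- All fibres of a surjective homomorphism of finite groups have the size of its kernel, so means
do not change under pullback. -/
theorem sum_comp_mul_card {F G : Type*} [AddCommGroup F] [Fintype F] [AddCommGroup G] [Fintype G]
    (p : F →+ G) (hp : Function.Surjective p) (g : G → ℂ) :
    (∑ t, g (p t)) * Fintype.card G = (∑ u, g u) * Fintype.card F := by
  classical
  have hfib : ∀ u : G, (Finset.univ.filter fun t => p t = u).card =
      (Finset.univ.filter fun t => p t = 0).card := by
    intro u
    obtain ⟨t₀, rfl⟩ := hp u
    refine Finset.card_bij (fun t _ => t - t₀) ?_ ?_ ?_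
    · intro t ht
      simpa [sub_eq_zero] using ht
    · intro a _ b _ h
      simpa using h
    · intro b hb
      refine ⟨b + t₀, ?_, by simp⟩
      simpa using hb
  have h1 : ∀ h : G → ℂ, ∑ t, h (p t) =
      (∑ u, h u) * (Finset.univ.filter fun t => p t = 0).card := by
    intro h
    rw [← Finset.sum_fiberwise_of_maps_to (s := Finset.univ) (t := Finset.univ) (g := p)
      (fun _ _ => Finset.mem_univ _), Finset.sum_mul]
    refine Finset.sum_congr rfl fun u _ => ?_
    rw [Finset.sum_congr rfl (g := fun _ => h u) (fun t ht => by rw [(Finset.mem_filter.1 ht).2]),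
      Finset.sum_const, hfib, nsmul_eq_mul, mul_comm]
  have h2 := h1 fun _ => 1
  simp only [Finset.sum_const, Finset.card_univ, nsmul_eq_mul, mul_one] at h2
  rw [h1 g, h2]
  ring

/-- Two finite quotients F and F' of A are compared on their common refinement, the image of A in F
× F'. -/
theorem HasMean.unique {A : Type*} [AddCommGroup A] {f : A → ℂ} {c c' : ℂ} (h : HasMean f c)
    (h' : HasMean f c') : c = c' := by
  classical
  obtain ⟨F, _, _, π, g, hπ, hg, hc⟩ := h
  obtain ⟨F', _, _, π', g', hπ', hg', hc'⟩ := h'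
  let R := (π.prod π').range
  let p : R →+ F := (AddMonoidHom.fst F F').comp R.subtype
  let p' : R →+ F' := (AddMonoidHom.snd F F').comp R.subtype
  have hp : Function.Surjective p := fun t => by
    obtain ⟨x, rfl⟩ := hπ t
    exact ⟨⟨(π x, π' x), x, rfl⟩, rfl⟩
  have hp' : Function.Surjective p' := fun t => by
    obtain ⟨x, rfl⟩ := hπ' t
    exact ⟨⟨(π x, π' x), x, rfl⟩, rfl⟩
  have heq : ∀ t : R, g (p t) = g' (p' t) := by
    rintro ⟨_, x, rfl⟩
    exact (hg x).symm.trans (hg' x)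
  have e := sum_comp_mul_card p hp g
  have e' := sum_comp_mul_card p' hp' g'
  rw [hc] at e
  rw [hc', ← Finset.sum_congr rfl fun t _ => heq t] at e'
  have n1 : (Fintype.card F : ℂ) ≠ 0 := by exact_mod_cast Fintype.card_ne_zero
  have n2 : (Fintype.card F' : ℂ) ≠ 0 := by exact_mod_cast Fintype.card_ne_zero
  have n3 : (Fintype.card R : ℂ) ≠ 0 := by exact_mod_cast Fintype.card_ne_zero
  have e1 : ∑ t, g (p t) = c * Fintype.card R := by
    apply mul_right_cancel₀ n1; rw [e]; ring
  have e2 : ∑ t, g (p t) = c' * Fintype.card R := by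
    apply mul_right_cancel₀ n2; rw [e']; ring
  exact mul_right_cancel₀ n3 (e1.symm.trans e2)

theorem HasMean.comp {A A' : Type*} [AddCommGroup A] [AddCommGroup A'] {f : A → ℂ} {c : ℂ}
    (h : HasMean f c) (φ : A' →+ A) (hφ : Function.Surjective φ) : HasMean (fun x => f (φ x)) c := by
  obtain ⟨F, i1, i2, π, g, hπ, hg, hc⟩ := h
  exact ⟨F, i1, i2, π.comp φ, g, hπ.comp hφ, fun x => hg _, hc⟩

theorem hasMean_const {A : Type*} [AddCommGroup A] (c : ℂ) : HasMean (fun _ : A => c) c :=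
  ⟨Unit, inferInstance, inferInstance, 0, fun _ => c, fun _ => ⟨0, rfl⟩, fun _ => rfl, by simp⟩

theorem HasMean.prod {A A' : Type*} [AddCommGroup A] [AddCommGroup A'] {f : A → ℂ} {f' : A' → ℂ}
    {c c' : ℂ} (h : HasMean f c) (h' : HasMean f' c') :
    HasMean (fun x : A × A' => f x.1 * f' x.2) (c * c') := by
  obtain ⟨F, _, _, π, g, hπ, hg, hc⟩ := h
  obtain ⟨F', _, _, π', g', hπ', hg', hc'⟩ := h'
  refine ⟨F × F', inferInstance, inferInstance, π.prodMap π', fun t => g t.1 * g' t.2,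
    hπ.prodMap hπ', fun x => by simp only [hg, hg']; rfl, ?_⟩
  rw [Fintype.sum_prod_type, ← Finset.sum_mul_sum, hc, hc', Fintype.card_prod]
  push_cast
  ring

theorem HasMean.pi {ι : Type} [Fintype ι] {A : ι → Type*} [∀ i, AddCommGroup (A i)]
    {f : ∀ i, A i → ℂ} {c : ι → ℂ} (h : ∀ i, HasMean (f i) (c i)) :
    HasMean (fun x : ∀ i, A i => ∏ i, f i (x i)) (∏ i, c i) := by
  classical
  choose F i1 i2 π g hπ hg hc using h
  refine ⟨∀ i, F i, inferInstance, inferInstance,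
    AddMonoidHom.mk' (fun x i => π i (x i)) (fun x y => by ext i; simp), fun t => ∏ i, g i (t i),
    ?_, fun x => by simp only [hg]; rfl, ?_⟩
  · intro t
    choose x hx using fun i => hπ i (t i)
    exact ⟨x, funext hx⟩
  · rw [← Fintype.prod_sum, Fintype.card_pi]
    simp_rw [hc]
    rw [Finset.prod_mul_distrib]
    push_cast
    rfl

/-- Restriction of a mean to a subgroup off which the function oscillates. -/
theorem HasMean.restrict {K Λ : Type*} [AddCommGroup K] [AddCommGroup Λ] (φ : Λ →+ K)
    (Λ₀ : AddSubgroup K) (hΛ₀ : Λ₀ ≤ φ.range) {f : K → ℂ} {c : ℂ} (h : HasMean f c)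
    (hosc : ∀ y, y ∉ φ.range → ∃ w ∈ Λ₀, ∃ ω : ℂ, ω ≠ 1 ∧ ∀ z ∈ Λ₀, f (y + z + w) = ω * f (y + z)) :
    ∃ r : ℝ, 0 < r ∧ HasMean (fun x => f (φ x)) (r * c) := by
  classical
  obtain ⟨F, _, _, π, g, hπ, hg, hc⟩ := h
  let D : AddSubgroup F := (π.comp φ).range
  let C : AddSubgroup F := Λ₀.map π
  have hCD : C ≤ D := by
    rintro _ ⟨z, hz, rfl⟩
    obtain ⟨x, rfl⟩ := hΛ₀ hz
    exact ⟨x, rfl⟩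
  -- Translation by the image of w multiplies the sum over a coset of C outside D by ω ≠ 1, so this
  -- sum vanishes.
  have hzero : ∀ t, t ∉ D → ∑ s : C, g (t + s) = 0 := by
    intro t ht
    obtain ⟨y, rfl⟩ := hπ t
    have hy : y ∉ φ.range := by
      rintro ⟨x, rfl⟩
      exact ht ⟨x, rfl⟩
    obtain ⟨w, hw, ω, hω, hf⟩ := hosc y hy
    have e : ∑ s : C, g (π y + s) = ω * ∑ s : C, g (π y + s) := by
      conv_lhs => rw [← Equiv.sum_comp (Equiv.addRight (⟨π w, w, hw, rfl⟩ : C))]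
      rw [Finset.mul_sum]
      refine Finset.sum_congr rfl ?_
      rintro ⟨_, z, hz, rfl⟩ -
      have := hf z hz
      rw [hg, hg] at this
      simpa [add_assoc] using this
    have : (1 - ω) * ∑ s : C, g (π y + s) = 0 := by linear_combination e
    exact (mul_eq_zero.1 this).resolve_left (sub_ne_zero.2 hω.symm)
  -- The complement of D is stable under C, so its sum equals the average of its C-translates, which
  -- is zero coset by coset.
  have hout : ∑ t ∈ Finset.univ.filter (· ∉ D), g t = 0 := by
    have e : ∀ s : C, ∑ t ∈ Finset.univ.filter (· ∉ D), g (t + s) =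
        ∑ t ∈ Finset.univ.filter (· ∉ D), g t := by
      intro s
      refine Finset.sum_bij (fun t _ => t + s) ?_ ?_ ?_ ?_
      · intro t ht
        simp only [Finset.mem_filter, Finset.mem_univ, true_and] at ht ⊢
        rwa [D.add_mem_cancel_right (hCD s.2)]
      · intro a _ b _ hab
        simpa using hab
      · intro b hb
        refine ⟨b - s, ?_, by simp⟩
        simp only [Finset.mem_filter, Finset.mem_univ, true_and] at hb ⊢
        rwa [sub_eq_add_neg, D.add_mem_cancel_right (D.neg_mem (hCD s.2))]
      · intros; rfl
    have e2 : ∑ s : C, ∑ t ∈ Finset.univ.filter (· ∉ D), g (t + s) = 0 := by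
      rw [Finset.sum_comm]
      exact Finset.sum_eq_zero fun t ht => hzero t (Finset.mem_filter.1 ht).2
    rw [Finset.sum_congr rfl fun s _ => e s, Finset.sum_const, nsmul_eq_mul] at e2
    refine (mul_eq_zero.1 e2).resolve_left ?_
    rw [Finset.card_univ]
    exact_mod_cast Fintype.card_ne_zero
  have hin : ∑ t : D, g t = c * Fintype.card F := by
    rw [← hc, ← Finset.sum_filter_add_sum_filter_not Finset.univ (· ∈ D), hout, add_zero]
    exact (Finset.sum_subtype _ (by simp) _).symm
  have nF : (0 : ℝ) < Fintype.card F := by exact_mod_cast Fintype.card_pos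
  have nD : (0 : ℝ) < Fintype.card D := by exact_mod_cast Fintype.card_pos
  -- The sums over F and over D coincide, so the means differ by the ratio of the cardinalities.
  refine ⟨Fintype.card F / Fintype.card D, div_pos nF nD, D, inferInstance, inferInstance,
    (π.comp φ).rangeRestrict, fun t => g t, AddMonoidHom.rangeRestrict_surjective _,
    fun x => hg _, ?_⟩
  rw [hin]
  have : (Fintype.card D : ℂ) ≠ 0 := by exact_mod_cast nD.ne'
  push_cast
  field_simp

/-! ### Phases -/

/-- The mean of `f` is a positive multiple of `exp (2 π i p / 8)`. -/
def HasPhase {A : Type*} [AddCommGroup A] (f : A → ℂ) (p : ZMod 8) : Prop :=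
  ∃ r : ℝ, 0 < r ∧ HasMean f (r * zeta8 p)

theorem pos_mul_zeta8_injective {r r' : ℝ} (hr : 0 < r) (hr' : 0 < r') {p p' : ZMod 8}
    (h : (r : ℂ) * zeta8 p = r' * zeta8 p') : p = p' := by
  have hn := congrArg norm h
  rw [norm_mul, norm_mul, norm_zeta8, norm_zeta8, mul_one, mul_one, Complex.norm_of_nonneg hr.le,
    Complex.norm_of_nonneg hr'.le] at hn
  subst hn
  exact zeta8_injective (mul_left_cancel₀ (by exact_mod_cast hr.ne') h)

theorem HasPhase.unique {A : Type*} [AddCommGroup A] {f : A → ℂ} {p p' : ZMod 8}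
    (h : HasPhase f p) (h' : HasPhase f p') : p = p' := by
  obtain ⟨r, hr, hm⟩ := h
  obtain ⟨r', hr', hm'⟩ := h'
  exact pos_mul_zeta8_injective hr hr' (hm.unique hm')

theorem HasPhase.comp {A A' : Type*} [AddCommGroup A] [AddCommGroup A'] {f : A → ℂ} {p : ZMod 8}
    (h : HasPhase f p) (φ : A' →+ A) (hφ : Function.Surjective φ) :
    HasPhase (fun x => f (φ x)) p := by
  obtain ⟨r, hr, hm⟩ := h
  exact ⟨r, hr, hm.comp φ hφ⟩

theorem hasPhase_one {A : Type*} [AddCommGroup A] {f : A → ℂ} (hf : ∀ x, f x = 1) :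
    HasPhase f 0 := by
  refine ⟨1, one_pos, ?_⟩
  rw [funext hf]
  simpa using hasMean_const (A := A) 1

theorem HasPhase.prod {A A' : Type*} [AddCommGroup A] [AddCommGroup A'] {f : A → ℂ} {f' : A' → ℂ}
    {p p' : ZMod 8} (h : HasPhase f p) (h' : HasPhase f' p') :
    HasPhase (fun x : A × A' => f x.1 * f' x.2) (p + p') := by
  obtain ⟨r, hr, hm⟩ := h
  obtain ⟨r', hr', hm'⟩ := h'
  refine ⟨r * r', mul_pos hr hr', ?_⟩
  convert hm.prod hm' using 1
  rw [AddChar.map_add_eq_mul]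
  push_cast
  ring

theorem HasPhase.pi {ι : Type} [Fintype ι] {A : ι → Type*} [∀ i, AddCommGroup (A i)]
    {f : ∀ i, A i → ℂ} {p : ι → ZMod 8} (h : ∀ i, HasPhase (f i) (p i)) :
    HasPhase (fun x : ∀ i, A i => ∏ i, f i (x i)) (∑ i, p i) := by
  choose r hr hm using h
  refine ⟨∏ i, r i, Finset.prod_pos fun i _ => hr i, ?_⟩
  convert HasMean.pi hm using 1
  have : ∀ s : Finset ι, zeta8 (∑ i ∈ s, p i) = ∏ i ∈ s, zeta8 (p i) := fun s => by
    classical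
    induction s using Finset.induction_on with
    | empty => simp
    | insert i s hi ih => rw [Finset.sum_insert hi, Finset.prod_insert hi,
        AddChar.map_add_eq_mul, ih]
  rw [Finset.prod_mul_distrib, this]
  push_cast
  rfl

theorem HasPhase.restrict {K Λ : Type*} [AddCommGroup K] [AddCommGroup Λ] (φ : Λ →+ K)
    (Λ₀ : AddSubgroup K) (hΛ₀ : Λ₀ ≤ φ.range) {f : K → ℂ} {p : ZMod 8} (h : HasPhase f p)
    (hosc : ∀ y, y ∉ φ.range → ∃ w ∈ Λ₀, ∃ ω : ℂ, ω ≠ 1 ∧ ∀ z ∈ Λ₀, f (y + z + w) = ω * f (y + z)) :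
    HasPhase (fun x => f (φ x)) p := by
  obtain ⟨r, hr, hm⟩ := h
  obtain ⟨r', hr', hm'⟩ := hm.restrict φ Λ₀ hΛ₀ hosc
  refine ⟨r' * r, mul_pos hr' hr, ?_⟩
  convert hm' using 1
  push_cast
  ring

/-! ### Forms of rank one -/

theorem exists_hasMean_of_periodic (f : ℤ_[2] → ℂ) (n : ℕ)
    (hf : ∀ x z, f (x + 2 ^ n * z) = f x) : ∃ c, HasMean f c := by
  classical
  have hs : Function.Surjective (PadicInt.toZModPow (p := 2) n) := ZMod.ringHom_surjective _
  let g : ZMod (2 ^ n) → ℂ := fun t => f (Function.surjInv hs t)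
  refine ⟨(∑ t, g t) / Fintype.card (ZMod (2 ^ n)), ZMod (2 ^ n), inferInstance, inferInstance,
    (PadicInt.toZModPow (p := 2) n).toAddMonoidHom, g, hs, fun x => ?_, ?_⟩
  · have : PadicInt.toZModPow n (x - Function.surjInv hs (PadicInt.toZModPow n x)) = 0 := by
      rw [map_sub, Function.surjInv_eq hs, sub_self]
    obtain ⟨z, hz⟩ := (toZModPow_eq_zero_iff _ _).1 this
    have h := hf (Function.surjInv hs (PadicInt.toZModPow n x)) z
    rw [← hz, add_sub_cancel] at h
    exact h
  · rw [div_mul_cancel₀]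
    exact_mod_cast Fintype.card_ne_zero

/-- The phase of the rank one form with entry `d`. -/
def rankOnePhase (d : ℚ_[2]) : ZMod 8 :=
  oddPart d + if Odd d.valuation ∧ legendre (oddPart d) = -1 then 4 else 0

theorem zeta8_sum_eq (u : ZMod 8) (hu : IsOdd u) : ∑ t : ZMod 8, zeta8 (u * t ^ 2) =
    4 * zeta8 u := by
  have h1 : ∀ v : ZMod 8, zeta8 (v + 4) = - zeta8 v := fun v => by
    rw [AddChar.map_add_eq_mul, zeta8_four]; ring
  have h0 : zeta8 0 = 1 := AddChar.map_zero_eq_one _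
  -- The squares modulo 8 are 0, 1, 4, 1, 0, 1, 4, 1, and 4u = 4 for odd u.
  have e : ∑ t : ZMod 8, zeta8 (u * t ^ 2) = zeta8 0 + zeta8 u + zeta8 4 + zeta8 u + zeta8 0 +
      zeta8 u + zeta8 4 + zeta8 u := by
    have : ∀ h : ZMod 8 → ℂ, ∑ t, h t = h 0 + h 1 + h 2 + h 3 + h 4 + h 5 + h 6 + h 7 := fun h =>
      Fin.sum_univ_eight h
    rw [this]
    rcases hu with rfl | rfl | rfl | rfl <;> congr
  rw [e, h0, zeta8_four]
  ring

theorem zeta8_one : zeta8 1 = (√2 / 2 : ℝ) + (√2 / 2 : ℝ) * Complex.I := by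
  have := ZMod.stdAddChar_coe (N := 8) 1
  have h2 : (2 * Real.pi * Complex.I * ((1 : ℤ) : ℂ) / ((8 : ℕ) : ℂ)) =
      (Real.pi / 4 : ℝ) * Complex.I := by
    push_cast; ring
  rw [h2, Complex.exp_mul_I, ← Complex.ofReal_cos, ← Complex.ofReal_sin, Real.cos_pi_div_four,
    Real.sin_pi_div_four] at this
  exact_mod_cast this

theorem sqrt_two_mul_self_complex : ((√2 : ℝ) : ℂ) * (√2 : ℝ) = 2 := by
  exact_mod_cast Real.mul_self_sqrt (by norm_num : (0 : ℝ) ≤ 2)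

theorem zeta8_two : zeta8 2 = Complex.I := by
  have : (2 : ZMod 8) = 1 + 1 := rfl
  rw [this, AddChar.map_add_eq_mul, zeta8_one]
  push_cast
  linear_combination ((1 + Complex.I) ^ 2 / 4) * sqrt_two_mul_self_complex +
    (1 / 2 : ℂ) * Complex.I_sq

/-- This is the source of the antisquare correction. The sum depends only on u modulo 4, and 1 ± i
is √2 times the primitive eighth root of unity with exponent ±1. The classes 3 and 5 must be moved
by 4 to become -1 and 1, while 1 and 7 stay. -/
theorem zeta8_two_mul_sum_eq (u : ZMod 8) (hu : IsOdd u) : ∑ t : ZMod 8, zeta8 (2 * u * t ^ 2) =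
    (4 * √2 : ℝ) * zeta8 (u + if legendre u = -1 then 4 else 0) := by
  have h0 : zeta8 0 = 1 := AddChar.map_zero_eq_one _
  have h6 : zeta8 6 = -Complex.I := by
    rw [show (6 : ZMod 8) = 2 + 4 from rfl, AddChar.map_add_eq_mul, zeta8_four, zeta8_two]; ring
  have h7 : zeta8 7 = -(zeta8 1 * Complex.I) := by
    rw [show (7 : ZMod 8) = 1 + 2 + 4 from rfl, AddChar.map_add_eq_mul, AddChar.map_add_eq_mul,
      zeta8_four, zeta8_two]
    ring
  have e : ∑ t : ZMod 8, zeta8 (2 * u * t ^ 2) = 4 * (1 + zeta8 (2 * u)) := by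
    have e1 : ∑ t : ZMod 8, zeta8 (2 * u * t ^ 2) = zeta8 0 + zeta8 (2 * u) + zeta8 0 +
        zeta8 (2 * u) + zeta8 0 + zeta8 (2 * u) + zeta8 0 + zeta8 (2 * u) := by
      have : ∀ h : ZMod 8 → ℂ, ∑ t, h t = h 0 + h 1 + h 2 + h 3 + h 4 + h 5 + h 6 + h 7 := fun h =>
        Fin.sum_univ_eight h
      rw [this]
      rcases hu with rfl | rfl | rfl | rfl <;> congr
    rw [e1, h0]
    ring
  rw [e]
  have hs := sqrt_two_mul_self_complex
  have hI := Complex.I_sq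
  have c1 : 4 * (1 + zeta8 2) = (4 * √2 : ℝ) * zeta8 1 := by
    rw [zeta8_two, zeta8_one]
    push_cast
    linear_combination (-2 - 2 * Complex.I) * hs
  have c7 : 4 * (1 + zeta8 6) = (4 * √2 : ℝ) * zeta8 7 := by
    rw [h6, h7, zeta8_one]
    push_cast
    linear_combination (2 * Complex.I + 2 * Complex.I ^ 2) * hs + 4 * hI
  have l1 : legendre 1 = 1 := by decide +kernel
  have l3 : legendre 3 = -1 := by decide +kernel
  have l5 : legendre 5 = -1 := by decide +kernel
  have l7 : legendre 7 = 1 := by decide +kernel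
  rcases hu with rfl | rfl | rfl | rfl
  · rw [l1]; exact c1
  · rw [l3]; exact c7
  · rw [l5]; exact c1
  · rw [l7]; exact c7

theorem hasMean_psi_div_eight (w : ℤ_[2]) :
    HasMean (fun x : ℤ_[2] => psi ((w * x ^ 2 : ℤ_[2]) / 8))
      ((∑ t : ZMod 8, zeta8 (mod8 w * t ^ 2)) / 8) := by
  refine ⟨ZMod 8, inferInstance, inferInstance, mod8.toAddMonoidHom,
    fun t => zeta8 (mod8 w * t ^ 2), ZMod.ringHom_surjective _, fun x => ?_, ?_⟩
  · exact (psi_div_eight _).trans (by rw [map_mul, map_pow]; rfl)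
  · rw [ZMod.card]; push_cast; field_simp

/-- The odd x contribute zero when the denominator is 2^(m+4), and x = 2y reduces it to 2^(m+2). The
phase therefore has period 2 in m and is determined by the denominators 4 and 8. -/
theorem hasPhase_rankOne_aux (z : ℤ_[2]) (hz : IsUnit z) (m : ℕ) :
    HasPhase (fun x : ℤ_[2] => psi ((z * x ^ 2 : ℤ_[2]) / 2 ^ (m + 2)))
      (mod8 z + if Even m ∧ legendre (mod8 z) = -1 then 4 else 0) := by
  have hodd := (isOdd_iff_isUnit_mod8 z).2 hz
  induction m using Nat.twoStepInduction with
  | zero =>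
    refine ⟨4 * √2 / 8, by positivity, ?_⟩
    convert hasMean_psi_div_eight (2 * z) using 1
    · ext x
      congr 1
      simp only [PadicInt.coe_mul, PadicInt.coe_pow, coe_ofNat]
      ring
    · rw [map_mul, map_ofNat, zeta8_two_mul_sum_eq _ hodd]
      simp only [Even.zero, true_and]
      push_cast
      ring
  | one =>
    refine ⟨1 / 2, by norm_num, ?_⟩
    convert hasMean_psi_div_eight z using 1
    · ext x
      norm_num
    · rw [zeta8_sum_eq _ hodd]
      simp
      ring
  | more m ih _ =>
    have hper : ∀ x y : ℤ_[2], psi ((z * (x + 2 ^ (m + 4) * y) ^ 2 : ℤ_[2]) / 2 ^ (m + 2 + 2)) =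
        psi ((z * x ^ 2 : ℤ_[2]) / 2 ^ (m + 2 + 2)) := by
      intro x y
      have : ((z * (x + 2 ^ (m + 4) * y) ^ 2 : ℤ_[2]) : ℚ_[2]) / 2 ^ (m + 2 + 2) =
          (z * x ^ 2 : ℤ_[2]) / 2 ^ (m + 2 + 2) +
            (z * (2 * x * y + 2 ^ (m + 4) * y ^ 2) : ℤ_[2]) := by
        simp only [PadicInt.coe_mul, PadicInt.coe_pow, PadicInt.coe_add, coe_ofNat]
        field_simp
        ring
      rw [this, AddChar.map_add_eq_mul, psi_intCast, mul_one]
    obtain ⟨c, hc⟩ := exists_hasMean_of_periodic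
      (fun x => psi ((z * x ^ 2 : ℤ_[2]) / 2 ^ (m + 2 + 2))) (m + 4) hper
    have hodd_iff : ∀ y : ℤ_[2], y ∉ (AddMonoidHom.mulLeft (2 : ℤ_[2])).range ↔ IsUnit y := by
      intro y
      rw [isUnit_iff_not_two_dvd, not_iff_not]
      exact ⟨fun ⟨x, hx⟩ => ⟨x, hx.symm⟩, fun ⟨x, hx⟩ => ⟨x, hx.symm⟩⟩
    obtain ⟨r, hr, hm⟩ := hc.restrict (AddMonoidHom.mulLeft (2 : ℤ_[2]))
      (AddMonoidHom.mulLeft (2 ^ (m + 2) : ℤ_[2])).range (by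
        rintro _ ⟨x, rfl⟩
        exact ⟨2 ^ (m + 1) * x, by simp; ring⟩) (by
      intro y hy
      rw [hodd_iff] at hy
      -- Shifting an odd x by 2^(m+2) changes the argument by zx/2 modulo ℤ_2, which flips the sign.
      refine ⟨2 ^ (m + 2), ⟨1, by simp⟩, -1, by norm_num, ?_⟩
      rintro _ ⟨x, rfl⟩
      simp only [AddMonoidHom.coe_mulLeft]
      have hu : IsUnit (z * (y + 2 ^ (m + 2) * x)) :=
        hz.mul (isUnit_add_of_two_dvd hy ⟨2 ^ (m + 1) * x, by ring⟩)
      rw [← psi_div_two_of_isUnit hu]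
      have : ((z * (y + 2 ^ (m + 2) * x + 2 ^ (m + 2)) ^ 2 : ℤ_[2]) : ℚ_[2]) / 2 ^ (m + 2 + 2) =
          (z * (y + 2 ^ (m + 2) * x) : ℤ_[2]) / 2 + (z * (y + 2 ^ (m + 2) * x) ^ 2 : ℤ_[2]) /
            2 ^ (m + 2 + 2) + (z * 2 ^ m : ℤ_[2]) := by
        simp only [PadicInt.coe_mul, PadicInt.coe_pow, PadicInt.coe_add, coe_ofNat]
        field_simp
        ring
      rw [this, AddChar.map_add_eq_mul, AddChar.map_add_eq_mul, psi_intCast, mul_one])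
    obtain ⟨r', hr', hm'⟩ := ih
    have hcr : r * c = r' * zeta8 (mod8 z + if Even m ∧ legendre (mod8 z) = -1 then 4 else 0) := by
      refine hm.unique ?_
      convert hm' using 1
      ext x
      simp only [AddMonoidHom.coe_mulLeft]
      congr 1
      simp only [PadicInt.coe_mul, PadicInt.coe_pow, coe_ofNat]
      field_simp
      ring
    refine ⟨r' / r, div_pos hr' hr, ?_⟩
    convert hc using 1
    have : (r : ℂ) ≠ 0 := by exact_mod_cast hr.ne'
    have hev : Even (m + 2) ↔ Even m := by simp [Nat.even_add]
    simp only [hev]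
    push_cast
    rw [div_mul_eq_mul_div, div_eq_iff this, ← hcr]
    ring

/-- Negative valuation is the range in which the entry is visible: at valuation 0 the mean vanishes,
and at positive valuation it is 1. -/
theorem hasPhase_rankOne {d : ℚ_[2]} (hd : d ≠ 0) (hv : d.valuation ≤ -1) :
    HasPhase (fun x : ℤ_[2] => psi (d * x * x / 2)) (rankOnePhase d) := by
  obtain ⟨z, hz, h⟩ := exists_eq_zpow_mul d hd
  obtain ⟨m, hm⟩ := Int.eq_ofNat_of_zero_le (a := -1 - d.valuation) (by omega)
  have e : d.valuation = -1 - m := by omega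
  have ho : oddPart d = mod8 z := by rw [h, oddPart_zpow_mul _ hz]
  have hpar : Odd d.valuation ↔ Even m := by
    rw [e, Int.odd_sub, iff_comm, ← Int.even_coe_nat]
    exact (iff_true_left (by decide)).symm
  have := hasPhase_rankOne_aux z hz m
  unfold rankOnePhase
  simp only [ho, hpar]
  convert this using 3 with x
  rw [h, e, zpow_sub₀ two_ne_zero, zpow_natCast, zpow_neg, zpow_one]
  simp only [PadicInt.coe_mul, PadicInt.coe_pow]
  field_simp
  ring

/-! ### Isometry classes of lattices -/

section Isometric

variable {L : Type*} [AddCommGroup L] [Module ℤ_[2] L]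
  {L' : Type*} [AddCommGroup L'] [Module ℤ_[2] L']
  {L'' : Type*} [AddCommGroup L''] [Module ℤ_[2] L'']
  {B : L →ₗ[ℤ_[2]] L →ₗ[ℤ_[2]] ℚ_[2]} {B' : L' →ₗ[ℤ_[2]] L' →ₗ[ℤ_[2]] ℚ_[2]}
  {B'' : L'' →ₗ[ℤ_[2]] L'' →ₗ[ℤ_[2]] ℚ_[2]}

theorem Isometric.refl (B : L →ₗ[ℤ_[2]] L →ₗ[ℤ_[2]] ℚ_[2]) : Isometric B B :=
  ⟨LinearEquiv.refl _ _, fun _ _ => rfl⟩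

theorem Isometric.symm (h : Isometric B B') : Isometric B' B := by
  obtain ⟨e, he⟩ := h
  exact ⟨e.symm, fun x y => by rw [← he, e.apply_symm_apply, e.apply_symm_apply]⟩

theorem Isometric.trans (h : Isometric B B') (h' : Isometric B' B'') : Isometric B B'' := by
  obtain ⟨e, he⟩ := h
  obtain ⟨e', he'⟩ := h'
  exact ⟨e.trans e', fun x y => by rw [← he, ← he']; rfl⟩

/-- The orthogonal direct sum of two forms. -/
def prodForm (B : L →ₗ[ℤ_[2]] L →ₗ[ℤ_[2]] ℚ_[2]) (B' : L' →ₗ[ℤ_[2]] L' →ₗ[ℤ_[2]] ℚ_[2]) :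
    (L × L') →ₗ[ℤ_[2]] (L × L') →ₗ[ℤ_[2]] ℚ_[2] :=
  B.compl₁₂ (LinearMap.fst ℤ_[2] L L') (LinearMap.fst ℤ_[2] L L') +
    B'.compl₁₂ (LinearMap.snd ℤ_[2] L L') (LinearMap.snd ℤ_[2] L L')

@[simp]
theorem prodForm_apply (x y : L × L') : prodForm B B' x y = B x.1 y.1 + B' x.2 y.2 := rfl

/-- The Gauss mean of the form divided by `2 ^ k` has phase `p`. -/
def FormPhase (B : L →ₗ[ℤ_[2]] L →ₗ[ℤ_[2]] ℚ_[2]) (k : ℤ) (p : ZMod 8) : Prop :=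
  HasPhase (fun x => psi (2 ^ (-k) * B x x / 2)) p

theorem FormPhase.of_isometric {k : ℤ} {p : ZMod 8} (h : FormPhase B' k p)
    (hB : Isometric B B') : FormPhase B k p := by
  obtain ⟨e, he⟩ := hB
  have := HasPhase.comp h e.toLinearMap.toAddMonoidHom e.surjective
  unfold FormPhase
  convert this using 3 with x
  rw [← he]
  rfl

theorem FormPhase.prod {k : ℤ} {p p' : ZMod 8} (h : FormPhase B k p) (h' : FormPhase B' k p') :
    FormPhase (prodForm B B') k (p + p') := by
  have := HasPhase.prod h h'
  unfold FormPhase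
  convert this using 2 with x
  rw [prodForm_apply, ← AddChar.map_add_eq_mul]
  congr 1
  ring

end Isometric

/-- A module with a bilinear form. -/
structure Lat where
  carrier : Type
  [grp : AddCommGroup carrier]
  [mod : Module ℤ_[2] carrier]
  form : carrier →ₗ[ℤ_[2]] carrier →ₗ[ℤ_[2]] ℚ_[2]

attribute [instance] Lat.grp Lat.mod

instance latSetoid : Setoid Lat where
  r A A' := Isometric A.form A'.form
  iseqv := ⟨fun A => Isometric.refl A.form, Isometric.symm, Isometric.trans⟩

/-- The type of isometry classes. -/
def LatClass : Type 1 := Quotient latSetoid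

/-- The isometry class of a module with a bilinear form. -/
def Lat.cls (A : Lat) : LatClass := Quotient.mk latSetoid A

theorem Lat.cls_eq_iff {A A' : Lat} : A.cls = A'.cls ↔ Isometric A.form A'.form :=
  Quotient.eq (r := latSetoid)

/-- The orthogonal direct sum. -/
def Lat.add (A A' : Lat) : Lat := ⟨A.carrier × A'.carrier, prodForm A.form A'.form⟩

/-- The zero lattice. -/
def Lat.zero : Lat := ⟨Unit, 0⟩

instance : Unique Lat.zero.carrier := inferInstanceAs (Unique Unit)

instance : Add LatClass where
  add := Quotient.map₂ Lat.add (by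
    rintro A A' ⟨e, he⟩ C C' ⟨f, hf⟩
    exact ⟨e.prodCongr f, fun x y => congrArg₂ (· + ·) (he x.1 y.1) (hf x.2 y.2)⟩)

instance : Zero LatClass := ⟨Lat.zero.cls⟩

theorem LatClass.ind {p : LatClass → Prop} (h : ∀ A : Lat, p A.cls) (c : LatClass) : p c :=
  Quotient.ind h c

/-- In a commutative monoid of isometry classes, the exchange relations between orthogonal summands
become equations that can be used for rewriting. -/
instance : AddCommMonoid LatClass where
  add_assoc a b c := by
    induction a using LatClass.ind with | _ A
    induction b using LatClass.ind with | _ A'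
    induction c using LatClass.ind with | _ A''
    exact Lat.cls_eq_iff.2 ⟨LinearEquiv.prodAssoc ℤ_[2] _ _ _, fun x y => (add_assoc _ _ _).symm⟩
  zero_add a := by
    induction a using LatClass.ind with | _ A
    exact Lat.cls_eq_iff.2 ⟨LinearEquiv.uniqueProd, fun x y => (zero_add _).symm⟩
  add_zero a := by
    induction a using LatClass.ind with | _ A
    exact Lat.cls_eq_iff.2 ⟨LinearEquiv.prodUnique, fun x y => (add_zero _).symm⟩
  add_comm a b := by
    induction a using LatClass.ind with | _ A
    induction b using LatClass.ind with | _ A'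
    exact Lat.cls_eq_iff.2 ⟨LinearEquiv.prodComm ℤ_[2] _ _, fun x y => add_comm _ _⟩
  nsmul := nsmulRec

/-- The class `c` has phase `p` at the scale `2 ^ k`. -/
def LatClass.Phase (c : LatClass) (k : ℤ) (p : ZMod 8) : Prop :=
  ∃ A : Lat, A.cls = c ∧ FormPhase A.form k p

theorem LatClass.phase_cls_iff {A : Lat} {k : ℤ} {p : ZMod 8} :
    A.cls.Phase k p ↔ FormPhase A.form k p := by
  refine ⟨?_, fun h => ⟨A, rfl, h⟩⟩
  rintro ⟨A', h, hA'⟩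
  exact hA'.of_isometric (Lat.cls_eq_iff.1 h).symm

theorem LatClass.Phase.unique {c : LatClass} {k : ℤ} {p p' : ZMod 8} (h : c.Phase k p)
    (h' : c.Phase k p') : p = p' := by
  obtain ⟨A, rfl, hA⟩ := h
  exact HasPhase.unique hA (LatClass.phase_cls_iff.1 h')

theorem LatClass.Phase.add {c c' : LatClass} {k : ℤ} {p p' : ZMod 8} (h : c.Phase k p)
    (h' : c'.Phase k p') : (c + c').Phase k (p + p') := by
  obtain ⟨A, rfl, hA⟩ := h
  obtain ⟨A', rfl, hA'⟩ := h'
  exact ⟨A.add A', rfl, hA.prod hA'⟩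

theorem LatClass.Phase.zero (k : ℤ) : (0 : LatClass).Phase k 0 :=
  ⟨Lat.zero, rfl, hasPhase_one fun x => by
    have : Lat.zero.form x x = 0 := rfl
    simp [this]⟩

theorem LatClass.Phase.sum {ι : Type*} (s : Finset ι) (c : ι → LatClass) (k : ℤ)
    (p : ι → ZMod 8) (h : ∀ i ∈ s, (c i).Phase k (p i)) :
    (∑ i ∈ s, c i).Phase k (∑ i ∈ s, p i) := by
  classical
  induction s using Finset.induction_on with
  | empty => exact .zero k
  | insert i s hi ih =>
    rw [Finset.sum_insert hi, Finset.sum_insert hi]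
    exact (h i (Finset.mem_insert_self _ _)).add
      (ih fun j hj => h j (Finset.mem_insert_of_mem hj))

/-! ### Lattices in arbitrary universes and their classes -/

section Rep

variable {L : Type*} [AddCommGroup L] [Module ℤ_[2] L]
  {L' : Type*} [AddCommGroup L'] [Module ℤ_[2] L']
  {L'' : Type*} [AddCommGroup L''] [Module ℤ_[2] L'']
  {B : L →ₗ[ℤ_[2]] L →ₗ[ℤ_[2]] ℚ_[2]} {B' : L' →ₗ[ℤ_[2]] L' →ₗ[ℤ_[2]] ℚ_[2]}
  {B'' : L'' →ₗ[ℤ_[2]] L'' →ₗ[ℤ_[2]] ℚ_[2]}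

/-- The form `B` belongs to the isometry class `c`. -/
def Rep (B : L →ₗ[ℤ_[2]] L →ₗ[ℤ_[2]] ℚ_[2]) (c : LatClass) : Prop :=
  ∃ A : Lat, A.cls = c ∧ Isometric B A.form

theorem Rep.of_isometric {c : LatClass} (h : Rep B' c) (hB : Isometric B B') : Rep B c := by
  obtain ⟨A, hA, h⟩ := h
  exact ⟨A, hA, hB.trans h⟩

theorem Rep.isometric {c : LatClass} (h : Rep B c) (h' : Rep B' c) : Isometric B B' := by
  obtain ⟨A, rfl, hA⟩ := h
  obtain ⟨A', h, hA'⟩ := h'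
  exact hA.trans ((Lat.cls_eq_iff.1 h).symm.trans hA'.symm)

theorem Rep.formPhase {c : LatClass} (h : Rep B c) {k : ℤ} {p : ZMod 8} (hc : c.Phase k p) :
    FormPhase B k p := by
  obtain ⟨A, rfl, hA⟩ := h
  exact (LatClass.phase_cls_iff.1 hc).of_isometric hA

theorem Rep.phase {c : LatClass} (h : Rep B c) {k : ℤ} {p : ZMod 8} (hB : FormPhase B k p) :
    c.Phase k p := by
  obtain ⟨A, rfl, hA⟩ := h
  exact LatClass.phase_cls_iff.2 (hB.of_isometric hA.symm)

/-- A basis transports the form to the coordinate module, which lives in the fixed universe of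
`Lat`. -/
theorem exists_rep [Module.Free ℤ_[2] L] [Module.Finite ℤ_[2] L]
    (B : L →ₗ[ℤ_[2]] L →ₗ[ℤ_[2]] ℚ_[2]) : ∃ c, Rep B c := by
  let e := (Module.finBasis ℤ_[2] L).equivFun
  refine ⟨_, ⟨_, B.compl₁₂ e.symm.toLinearMap e.symm.toLinearMap⟩, rfl, e, fun x y => ?_⟩
  simp

theorem rep_zero [Subsingleton L] : Rep B 0 :=
  ⟨Lat.zero, rfl, ⟨0, 0, fun _ => Subsingleton.elim _ _, fun _ => rfl⟩, fun x y => by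
    rw [Subsingleton.elim x 0]; simp⟩

theorem Rep.add {c' c'' : LatClass} (h' : Rep B' c') (h'' : Rep B'' c'')
    (f' : L' →ₗ[ℤ_[2]] L) (f'' : L'' →ₗ[ℤ_[2]] L)
    (hbij : Function.Bijective fun x : L' × L'' => f' x.1 + f'' x.2)
    (hf' : ∀ x y, B (f' x) (f' y) = B' x y) (hf'' : ∀ x y, B (f'' x) (f'' y) = B'' x y)
    (horth : ∀ x y, B (f' x) (f'' y) = 0) (horth' : ∀ x y, B (f'' x) (f' y) = 0) :
    Rep B (c' + c'') := by
  obtain ⟨A, rfl, e, he⟩ := h'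
  obtain ⟨A', rfl, e', he'⟩ := h''
  let f : (L' × L'') ≃ₗ[ℤ_[2]] L := LinearEquiv.ofBijective (f'.coprod f'') hbij
  refine ⟨A.add A', rfl, Isometric.trans (B' := prodForm B' B'') ?_
    ⟨e.prodCongr e', fun x y => congrArg₂ (· + ·) (he x.1 y.1) (he' x.2 y.2)⟩⟩
  refine Isometric.symm ⟨f, fun x y => ?_⟩
  change B (f' x.1 + f'' x.2) (f' y.1 + f'' y.2) = _
  simp [hf', hf'', horth, horth']

theorem Rep.sup {c c' : LatClass} {N N' : Submodule ℤ_[2] L}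
    (h : Rep (B.domRestrict₁₂ N N) c) (h' : Rep (B.domRestrict₁₂ N' N') c') (hN : Disjoint N N')
    (horth : ∀ x ∈ N, ∀ y ∈ N', B x y = 0) (horth' : ∀ x ∈ N', ∀ y ∈ N, B x y = 0) :
    Rep (B.domRestrict₁₂ (N ⊔ N' : Submodule ℤ_[2] L) (N ⊔ N' : Submodule ℤ_[2] L)) (c + c') := by
  refine h.add h' (Submodule.inclusion le_sup_left) (Submodule.inclusion le_sup_right)
    ⟨?_, ?_⟩ (fun _ _ => rfl) (fun _ _ => rfl) (fun x y => horth _ x.2 _ y.2)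
    (fun x y => horth' _ x.2 _ y.2)
  · rintro ⟨x, y⟩ ⟨x', y'⟩ hxy
    have e : (x : L) + y = x' + y' := congrArg Subtype.val hxy
    have e' : (x - x' : L) = y' - y := by
      rw [sub_eq_sub_iff_add_eq_add, e, add_comm]
    have h0 : (x - x' : L) = 0 := Submodule.disjoint_def.1 hN _ (N.sub_mem x.2 x'.2)
      (e' ▸ N'.sub_mem y'.2 y.2)
    rw [h0] at e'
    exact Prod.ext (Subtype.ext (sub_eq_zero.1 h0)) (Subtype.ext (sub_eq_zero.1 e'.symm).symm)
  · rintro ⟨z, hz⟩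
    obtain ⟨x, hx, y, hy, rfl⟩ := Submodule.mem_sup.1 hz
    exact ⟨(⟨x, hx⟩, ⟨y, hy⟩), rfl⟩

theorem Rep.of_domRestrict_top {c : LatClass}
    (h : Rep (B.domRestrict₁₂ (⊤ : Submodule ℤ_[2] L) (⊤ : Submodule ℤ_[2] L)) c) : Rep B c :=
  h.of_isometric (Isometric.symm ⟨Submodule.topEquiv, fun _ _ => rfl⟩)

theorem JordanDecomposition.rep_sum (J : JordanDecomposition B) (c : ℤ → LatClass)
    (hc : ∀ i, Rep (B.domRestrict₁₂ (J.constituent i) (J.constituent i)) (c i)) (s : Finset ℤ)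
    (hs : ∀ i ∉ s, J.constituent i = ⊥) : Rep B (∑ i ∈ s, c i) := by
  classical
  have hind := J.isInternal.submodule_iSupIndep
  have key : ∀ t : Finset ℤ, Rep (B.domRestrict₁₂ (t.sup J.constituent : Submodule ℤ_[2] L)
      (t.sup J.constituent : Submodule ℤ_[2] L)) (∑ i ∈ t, c i) := by
    intro t
    induction t using Finset.induction_on with
    | empty =>
      rw [Finset.sup_empty, Finset.sum_empty]
      exact rep_zero
    | insert i t hi ih =>
      rw [Finset.sup_insert, Finset.sum_insert hi]
      have hle : ∀ x ∈ J.constituent i, ∀ y ∈ t.sup J.constituent, B x y = 0 := by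
        intro x hx y hy
        have : t.sup J.constituent ≤ LinearMap.ker (B x) := Finset.sup_le fun j hj y hy =>
          J.orthogonal i j (by rintro rfl; exact hi hj) x hx y hy
        exact this hy
      have hle' : ∀ x ∈ t.sup J.constituent, ∀ y ∈ J.constituent i, B x y = 0 := by
        intro x hx y hy
        have : t.sup J.constituent ≤ LinearMap.ker (B.flip y) := Finset.sup_le fun j hj x hx =>
          J.orthogonal j i (by rintro rfl; exact hi hj) x hx y hy
        exact this hx
      refine (hc i).sup ih ?_ hle hle'
      exact Finset.supIndep_iff_disjoint_erase.1 (hind.supIndep' (insert i t)) i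
        (Finset.mem_insert_self _ _) |>.mono_right (by rw [Finset.erase_insert hi])
  have htop : s.sup J.constituent = ⊤ := by
    rw [eq_top_iff, ← J.isInternal.submodule_iSup_eq_top]
    refine iSup_le fun i => ?_
    by_cases hi : i ∈ s
    · exact Finset.le_sup hi
    · rw [hs i hi]; exact bot_le
  have := key s
  rw [htop] at this
  exact this.of_domRestrict_top

theorem JordanDecomposition.exists_support [Module.Finite ℤ_[2] L] (J : JordanDecomposition B) :
    ∃ a b : ℤ, ∀ i, i ∉ Finset.Ico a b → J.constituent i = ⊥ := by
  have hfin : {i | J.constituent i ≠ ⊥}.Finite :=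
    WellFoundedGT.finite_ne_bot_of_iSupIndep J.isInternal.submodule_iSupIndep
  obtain ⟨a, ha⟩ := hfin.bddBelow
  obtain ⟨b, hb⟩ := hfin.bddAbove
  refine ⟨a, b + 1, fun i hi => ?_⟩
  by_contra h
  have h1 := ha h
  have h2 := hb h
  exact hi (Finset.mem_Ico.2 ⟨h1, by omega⟩)

end Rep

/-! ### The phase of a scaled unimodular lattice -/

theorem sum_four_eq_prod_sign {ι : Type*} (s : Finset ι) (ε : ι → ℤˣ) :
    ∑ i ∈ s, (if ε i = -1 then 4 else 0 : ZMod 8) = if ∏ i ∈ s, ε i = -1 then 4 else 0 := by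
  classical
  induction s using Finset.induction_on with
  | empty => simp
  | insert i s hi ih =>
    rw [Finset.sum_insert hi, Finset.prod_insert hi, ih]
    generalize ∏ j ∈ s, ε j = x
    generalize ε i = y
    revert x y
    decide

theorem rankOnePhase_two_zpow_mul (k : ℤ) {d : ℚ_[2]} (hd : d ≠ 0) :
    rankOnePhase (2 ^ k * d) = rankOnePhase d +
      if Odd k ∧ legendre (oddPart d) = -1 then 4 else 0 := by
  unfold rankOnePhase
  rw [oddPart_two_zpow_mul k hd, Padic.valuation_mul (zpow_ne_zero _ two_ne_zero) hd,
    valuation_two_zpow, add_assoc]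
  congr 1
  by_cases h : legendre (oddPart d) = -1 <;> simp only [h, and_true, and_false]
  · by_cases h1 : Odd k <;> by_cases h2 : Odd d.valuation <;>
      simp only [Int.odd_add, ← Int.not_odd_iff_even, h1, h2, not_true_eq_false,
        not_false_eq_true, if_true, if_false] <;> rfl
  · simp

open Classical in
theorem diagOddity_eq_sum {n : ℕ} {d : Fin n → ℚ_[2]} (hd : ∀ i, d i ≠ 0) :
    diagOddity d = ∑ i, rankOnePhase (d i) := by
  unfold diagOddity
  refine Finset.sum_congr rfl fun i _ => ?_
  unfold rankOnePhase IsAntisquare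
  simp only [hd i, ne_eq, not_false_eq_true, true_and]

theorem IsDiagonalization.prod_eq {n : ℕ} {G : Matrix (Fin n) (Fin n) ℚ_[2]} {d : Fin n → ℚ_[2]}
    (h : IsDiagonalization G d) : ∃ q : ℚ_[2], q ≠ 0 ∧ ∏ i, d i = q ^ 2 * G.det := by
  obtain ⟨P, hP, h⟩ := h
  refine ⟨P.det, hP.ne_zero, ?_⟩
  rw [← Matrix.det_diagonal, ← h, Matrix.det_mul, Matrix.det_mul, Matrix.det_transpose]
  ring

theorem exists_isDiagonalization {n : ℕ} (G : Matrix (Fin n) (Fin n) ℚ_[2]) (hG : Gᵀ = G) :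
    ∃ d, IsDiagonalization G d := by
  have : Invertible (2 : ℚ_[2]) := invertibleOfNonzero two_ne_zero
  have hsymm : LinearMap.IsSymm (Matrix.toBilin' G) := ⟨fun x y => by
    simp only [Matrix.toBilin'_apply', RingHom.id_apply]
    rw [Matrix.dotProduct_mulVec, dotProduct_comm, ← Matrix.mulVec_transpose, hG]⟩
  obtain ⟨v, hv⟩ := LinearMap.BilinForm.exists_orthogonal_basis hsymm
  have hn : Module.finrank ℚ_[2] (Fin n → ℚ_[2]) = n := by simp
  let w := v.reindex (finCongr hn)
  let P : Matrix (Fin n) (Fin n) ℚ_[2] := Matrix.of fun i j => w j i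
  have hPw : P = (Pi.basisFun ℚ_[2] (Fin n)).toMatrix w := by
    ext i j
    simp [P, Module.Basis.toMatrix_apply]
  refine ⟨fun i => Matrix.toBilin' G (w i) (w i), P, ?_, ?_⟩
  · rw [hPw, ← Module.Basis.det_apply]
    exact (Pi.basisFun ℚ_[2] (Fin n)).isUnit_det w
  · have hent : ∀ i j, (Pᵀ * G * P) i j = Matrix.toBilin' G (w i) (w j) := by
      intro i j
      rw [Matrix.toBilin'_apply', Matrix.mul_assoc, Matrix.mul_apply]
      rfl
    ext i j
    rw [hent, Matrix.diagonal_apply]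
    split_ifs with hij
    · rw [hij]
    · have := hv (i := (finCongr hn).symm i) (j := (finCongr hn).symm j) (by simpa using hij)
      simpa [w, LinearMap.IsOrthoᵢ] using this

theorem exists_integral_multiple {ι : Type*} [Finite ι] (q : ι → ℚ_[2]) :
    ∃ N₀ : ℕ, ∀ N ≥ N₀, ∃ z : ι → ℤ_[2], ∀ i, (z i : ℚ_[2]) = 2 ^ N * q i := by
  cases nonempty_fintype ι
  choose N z h using fun i => exists_eq_div_pow (q i)
  refine ⟨∑ i, N i, fun M hM => ⟨fun i => 2 ^ (M - N i) * z i, fun i => ?_⟩⟩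
  have h1 : N i ≤ M :=
    (Finset.single_le_sum (f := N) (fun _ _ => Nat.zero_le _) (Finset.mem_univ i)).trans hM
  simp only [PadicInt.coe_mul, PadicInt.coe_pow, coe_ofNat]
  conv_rhs => rw [h i, ← Nat.sub_add_cancel h1, pow_add]
  field_simp

section Lattice

variable {L : Type*} [AddCommGroup L] [Module ℤ_[2] L] [Module.Free ℤ_[2] L]
  [Module.Finite ℤ_[2] L] {B : L →ₗ[ℤ_[2]] L →ₗ[ℤ_[2]] ℚ_[2]}

/-- The coordinates of a lattice vector, as elements of `ℚ_2`. -/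
def coords (x : L) (i : Fin (Module.finrank ℤ_[2] L)) : ℚ_[2] :=
  (Module.finBasis ℤ_[2] L).repr x i

theorem smul_eq_coe_mul (z : ℤ_[2]) (q : ℚ_[2]) : z • q = (z : ℚ_[2]) * q :=
  Algebra.smul_def z q

theorem form_eq_gram (x y : L) : B x y = coords x ⬝ᵥ (gram B *ᵥ coords y) := by
  let e := Module.finBasis ℤ_[2] L
  conv_lhs => rw [← e.sum_repr x, ← e.sum_repr y]
  simp only [map_sum, LinearMap.sum_apply, map_smul, LinearMap.smul_apply, smul_eq_coe_mul,
    dotProduct, Matrix.mulVec, Finset.mul_sum]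
  rw [Finset.sum_comm]
  refine Finset.sum_congr rfl fun i _ => Finset.sum_congr rfl fun j _ => ?_
  simp only [coords, gram, Matrix.of_apply, e]
  ring

/-- A kernel vector of the Gram matrix, scaled to be integral, would be a nonzero lattice vector
orthogonal to the whole lattice. Every coordinate functional is an inner product, so such a vector
is zero. -/
theorem IsUnimodular.det_gram_ne_zero (h : IsUnimodular B) : (gram B).det ≠ 0 := by
  intro h0
  obtain ⟨v, hv0, hv⟩ := Matrix.exists_mulVec_eq_zero_iff.2 h0
  obtain ⟨N, hN⟩ := exists_integral_multiple v
  obtain ⟨z, hz⟩ := hN N le_rfl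
  let e := Module.finBasis ℤ_[2] L
  let x := e.equivFun.symm z
  have hx : coords x = (2 : ℚ_[2]) ^ N • v := by
    ext i
    have : e.equivFun x i = z i := by rw [LinearEquiv.apply_symm_apply]
    change ((e.equivFun x i : ℤ_[2]) : ℚ_[2]) = _
    rw [this, hz]
    rfl
  have hB : ∀ y, B y x = 0 := fun y => by
    rw [form_eq_gram, hx, Matrix.mulVec_smul, hv, smul_zero, dotProduct_zero]
  obtain ⟨b, hb, hbij⟩ := h
  have hx0 : x = 0 := by
    rw [← e.forall_coord_eq_zero_iff]
    intro i
    obtain ⟨y, hy⟩ := hbij.2 (e.coord i)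
    rw [← hy]
    apply Subtype.coe_injective
    exact (hb y x).trans (hB y)
  apply hv0
  have h2 : (2 : ℚ_[2]) ^ N • v = 0 := by
    rw [← hx, hx0]
    ext i
    simp [coords]
  exact (smul_eq_zero.1 h2).resolve_left (pow_ne_zero _ two_ne_zero)

theorem gram_transpose (hB : ∀ x y, B x y = B y x) : (gram B)ᵀ = gram B := by
  ext i j
  exact hB _ _

/-- The lattice is embedded isometrically by `φ` into ℤ_2^n with the diagonal form `D`, where the
mean is a product of rank one means. The passage back to the lattice keeps the phase because, by
unimodularity, a vector outside the image has a non-integral product with some vector of the image.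
-/
theorem IsUnimodular.formPhase_of_isDiagonalization (h : IsUnimodular B)
    {m : ℕ} (hm : 1 ≤ m)
    {d : Fin (Module.finrank ℤ_[2] L) → ℚ_[2]} (hd : IsDiagonalization (gram B) d) :
    FormPhase B m (diagOddity d + if Odd m ∧ latticeSign B = -1 then 4 else 0) := by
  obtain ⟨q, hq, hprod⟩ := hd.prod_eq
  have hdet := h.det_gram_ne_zero
  have hd0 : ∀ i, d i ≠ 0 := fun i => by
    have : ∏ i, d i ≠ 0 := by
      rw [hprod]; exact mul_ne_zero (pow_ne_zero _ hq) hdet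
    exact Finset.prod_ne_zero_iff.1 this i (Finset.mem_univ i)
  have hsign : latticeSign B = ∏ i, legendre (oddPart (d i)) := by
    rw [← legendre_oddPart_prod _ _ fun i _ => hd0 i, hprod, oddPart_mul (pow_ne_zero _ hq) hdet,
      oddPart_sq hq, one_mul]
    rfl
  obtain ⟨P, hP, hPG⟩ := hd
  obtain ⟨N₀, hN₀⟩ := exists_integral_multiple fun ij : _ × _ => P⁻¹ ij.1 ij.2
  -- N is so large that 2^N P⁻¹ is integral and all diagonal entries, divided by 2^(2N+m), have
  -- negative valuation as `hasPhase_rankOne` demands.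
  obtain ⟨N, hNN₀, hNv⟩ : ∃ N : ℕ, N₀ ≤ N ∧ ∀ i, (d i).valuation - 2 * N - m ≤ -1 := by
    refine ⟨N₀ + ∑ i, (d i).valuation.natAbs, Nat.le_add_right _ _, fun i => ?_⟩
    have := Finset.single_le_sum (f := fun i => (d i).valuation.natAbs)
      (fun _ _ => Nat.zero_le _) (Finset.mem_univ i)
    push_cast
    have h2 : ((d i).valuation.natAbs : ℤ) ≤ ((∑ i, (d i).valuation.natAbs : ℕ) : ℤ) := by
      exact_mod_cast this
    push_cast at h2
    rw [Int.abs_eq_natAbs] at *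
    omega
  obtain ⟨R, hR⟩ := hN₀ N hNN₀
  let e := Module.finBasis ℤ_[2] L
  let φ : L →ₗ[ℤ_[2]] (Fin (Module.finrank ℤ_[2] L) → ℤ_[2]) :=
    (Matrix.of fun i j => R (i, j)).mulVecLin ∘ₗ e.equivFun.toLinearMap
  have hφ : ∀ x, (fun i => ((φ x i : ℤ_[2]) : ℚ_[2])) = (2 : ℚ_[2]) ^ N • (P⁻¹ *ᵥ coords x) := by
    intro x
    ext i
    have : φ x i = ∑ j, R (i, j) * e.repr x j := rfl
    rw [this, PadicInt.coe_sum, Pi.smul_apply, Matrix.mulVec, dotProduct, Finset.smul_sum]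
    refine Finset.sum_congr rfl fun j _ => ?_
    rw [PadicInt.coe_mul, hR]
    simp [coords, e, mul_assoc]
  -- The factor 2^(-2N) compensates for the 2^N in `φ`, which makes `φ` an isometric embedding.
  let δ : Fin (Module.finrank ℤ_[2] L) → ℚ_[2] := fun i => (2 : ℚ_[2]) ^ (-(2 * N : ℤ)) * d i
  have hδ0 : ∀ i, δ i ≠ 0 := fun i => mul_ne_zero (zpow_ne_zero _ two_ne_zero) (hd0 i)
  let D : (Fin (Module.finrank ℤ_[2] L) → ℤ_[2]) → (Fin (Module.finrank ℤ_[2] L) → ℤ_[2]) → ℚ_[2] :=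
    fun y y' => ∑ i, δ i * (y i * y' i)
  have hDadd : ∀ x y z, D (x + y) z = D x z + D y z := fun x y z => by
    simp only [D, ← Finset.sum_add_distrib, Pi.add_apply, PadicInt.coe_add]
    exact Finset.sum_congr rfl fun i _ => by ring
  have hDcomm : ∀ x y, D x y = D y x := fun x y => by
    simp only [D]
    exact Finset.sum_congr rfl fun i _ => by ring
  have hDadd' : ∀ x y z, D x (y + z) = D x y + D x z := fun x y z => by
    rw [hDcomm, hDadd, hDcomm y, hDcomm z]
  have hDsmul : ∀ (c : ℤ_[2]) x y, D x (c • y) = c * D x y := fun c x y => by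
    simp only [D, Finset.mul_sum, Pi.smul_apply, smul_eq_mul, PadicInt.coe_mul]
    exact Finset.sum_congr rfl fun i _ => by ring
  have hDvec : ∀ y x, D y (φ x) =
      (2 : ℚ_[2]) ^ (-(N : ℤ)) * ((fun i => (y i : ℚ_[2])) ⬝ᵥ ((Matrix.diagonal d * P⁻¹) *ᵥ coords x)) := by
    intro y x
    have e1 : ∀ i, ((φ x i : ℤ_[2]) : ℚ_[2]) = 2 ^ N * (P⁻¹ *ᵥ coords x) i := fun i =>
      congrFun (hφ x) i
    simp only [D, δ, e1]
    rw [← Matrix.mulVec_mulVec, dotProduct, Finset.mul_sum]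
    refine Finset.sum_congr rfl fun i _ => ?_
    rw [Matrix.mulVec_diagonal]
    have : (2 : ℚ_[2]) ^ (-(2 * N : ℤ)) * 2 ^ N = 2 ^ (-(N : ℤ)) := by
      rw [← zpow_natCast, ← zpow_add₀ two_ne_zero]; congr 1; ring
    rw [← this]
    ring
  have hPinv : P * P⁻¹ = 1 := Matrix.mul_nonsing_inv _ hP
  have hPinv' : P⁻¹ * P = 1 := Matrix.nonsing_inv_mul _ hP
  have hPT : (P⁻¹)ᵀ * Pᵀ = 1 := by rw [← Matrix.transpose_mul, hPinv, Matrix.transpose_one]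
  have hDB : ∀ x y, D (φ x) (φ y) = B x y := by
    intro x y
    have e1 : (fun i => ((φ x i : ℤ_[2]) : ℚ_[2])) = (2 : ℚ_[2]) ^ N • (P⁻¹ *ᵥ coords x) := hφ x
    rw [hDvec, e1, form_eq_gram, smul_dotProduct, smul_eq_mul, ← mul_assoc]
    have : (2 : ℚ_[2]) ^ (-(N : ℤ)) * 2 ^ N = 1 := by
      rw [← zpow_natCast, ← zpow_add₀ two_ne_zero]; simp
    rw [this, one_mul, ← Matrix.vecMul_transpose, ← Matrix.dotProduct_mulVec, Matrix.mulVec_mulVec]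
    congr 2
    rw [← hPG]
    calc (P⁻¹)ᵀ * (Pᵀ * gram B * P * P⁻¹) = ((P⁻¹)ᵀ * Pᵀ) * gram B * (P * P⁻¹) := by
          simp only [Matrix.mul_assoc]
      _ = gram B := by rw [hPT, hPinv, one_mul, mul_one]
  obtain ⟨b, hb, hbij⟩ := h
  -- If y has integral products with the image, unimodularity represents x ↦ D(y, φ x) by some x₀.
  -- Then φ x₀ - y is orthogonal to the image, which spans the nondegenerate space over ℚ_2, so y =
  -- φ x₀.
  have hrange : ∀ y, (∀ x, ∃ z : ℤ_[2], D y (φ x) = z) → y ∈ LinearMap.range φ := by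
    intro y hy
    choose l hl using hy
    let lin : L →ₗ[ℤ_[2]] ℤ_[2] :=
      { toFun := l
        map_add' := fun x x' => by
          apply Subtype.coe_injective
          change (l (x + x') : ℚ_[2]) = l x + l x'
          rw [← hl, ← hl, ← hl, map_add, hDadd']
        map_smul' := fun c x => by
          apply Subtype.coe_injective
          change (l (c • x) : ℚ_[2]) = c * l x
          rw [← hl, ← hl, map_smul, hDsmul] }
    obtain ⟨x₀, hx₀⟩ := hbij.2 lin
    refine ⟨x₀, ?_⟩
    have h0 : ∀ x, D (φ x₀ - y) (φ x) = 0 := fun x => by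
      have h1 : D y (φ x) = B x₀ x := by
        rw [← hb, hx₀]; exact hl x
      have h2 := hDadd (φ x₀ - y) y (φ x)
      rw [sub_add_cancel, hDB, h1] at h2
      linear_combination -h2
    have h3 : (fun i => ((φ x₀ i - y i : ℤ_[2]) : ℚ_[2])) ᵥ* (Matrix.diagonal d * P⁻¹) = 0 := by
      ext j
      have := h0 (e j)
      rw [hDvec] at this
      have h4 := (mul_eq_zero.1 this).resolve_left (zpow_ne_zero _ two_ne_zero)
      rw [Matrix.dotProduct_mulVec] at h4
      have h5 : coords (e j) = Pi.single j (1 : ℚ_[2]) := by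
        ext i
        simp only [coords, e, Module.Basis.repr_self, Finsupp.single_apply, Pi.single_apply]
        split_ifs with h1 h2 h2
        · simp
        · exact absurd h1.symm h2
        · exact absurd h2.symm h1
        · simp
      rw [h5, dotProduct_single_one] at h4
      exact h4
    have h4 : (fun i => ((φ x₀ i - y i : ℤ_[2]) : ℚ_[2])) ᵥ* Matrix.diagonal d = 0 := by
      have := congrArg (· ᵥ* P) h3
      simpa [Matrix.vecMul_vecMul, Matrix.mul_assoc, hPinv'] using this
    ext i
    have h5 := congrFun h4 i
    rw [Matrix.vecMul_diagonal] at h5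
    have h6 := (mul_eq_zero.1 h5).resolve_right (hd0 i)
    have h7 : φ x₀ i - y i = 0 := Subtype.coe_injective h6
    rw [sub_eq_zero.1 h7]
  have hK : HasPhase (fun y => psi (2 ^ (-m : ℤ) * D y y / 2))
      (∑ i, rankOnePhase ((2 : ℚ_[2]) ^ (-m : ℤ) * δ i)) := by
    have := HasPhase.pi fun i => hasPhase_rankOne (d := (2 : ℚ_[2]) ^ (-m : ℤ) * δ i)
      (mul_ne_zero (zpow_ne_zero _ two_ne_zero) (hδ0 i)) (by
        rw [Padic.valuation_mul (zpow_ne_zero _ two_ne_zero) (hδ0 i),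
          Padic.valuation_mul (zpow_ne_zero _ two_ne_zero) (hd0 i), valuation_two_zpow,
          valuation_two_zpow]
        have := hNv i
        omega)
    convert this using 2 with y
    have hs : ∀ (s : Finset (Fin (Module.finrank ℤ_[2] L))) (t : _ → ℚ_[2]),
        psi (∑ i ∈ s, t i) = ∏ i ∈ s, psi (t i) := fun s t => by
      classical
      induction s using Finset.induction_on with
      | empty => simp
      | insert i s hi ih => rw [Finset.sum_insert hi, Finset.prod_insert hi,
          AddChar.map_add_eq_mul, ih]
    rw [← hs]
    congr 1
    simp only [D, Finset.mul_sum, Finset.sum_div]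
    exact Finset.sum_congr rfl fun i _ => by ring
  have hmpow : (2 : ℚ_[2]) ^ (-m : ℤ) * 2 ^ m = 1 := by
    rw [← zpow_natCast, ← zpow_add₀ two_ne_zero]; simp
  have hL := hK.restrict φ.toAddMonoidHom
    (φ.toAddMonoidHom.comp (LinearMap.lsmul ℤ_[2] L (2 ^ m)).toAddMonoidHom).range (by
      rintro _ ⟨x, rfl⟩
      exact ⟨_, rfl⟩) (by
    intro y hy
    have hex : ∃ x, ∀ z : ℤ_[2], D y (φ x) ≠ z := by
      by_contra hcon
      push Not at hcon
      exact hy (hrange y hcon)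
    obtain ⟨x, hx⟩ := hex
    obtain ⟨c, hc⟩ := exists_psi_mul_ne_one hx
    -- After division by 2^m, the cross term of this shift with y is D(y, φ x) c, on which `psi` is
    -- not 1. All other new terms are integral.
    refine ⟨φ ((2 : ℤ_[2]) ^ m • (c • x)), ⟨c • x, rfl⟩, _, hc, ?_⟩
    rintro _ ⟨x', rfl⟩
    change psi (2 ^ (-m : ℤ) * D (y + φ ((2 : ℤ_[2]) ^ m • x') + φ ((2 : ℤ_[2]) ^ m • (c • x)))
      (y + φ ((2 : ℤ_[2]) ^ m • x') + φ ((2 : ℤ_[2]) ^ m • (c • x))) / 2) = _ *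
      psi (2 ^ (-m : ℤ) * D (y + φ ((2 : ℤ_[2]) ^ m • x')) (y + φ ((2 : ℤ_[2]) ^ m • x')) / 2)
    -- Positivity of m is needed for the norm of the shift, which contributes 2^(m-1) c² b(x,x).
    obtain ⟨m', rfl⟩ := Nat.exists_eq_add_of_le hm
    set y' := y + φ ((2 : ℤ_[2]) ^ (1 + m') • x')
    set w := φ ((2 : ℤ_[2]) ^ (1 + m') • (c • x))
    have e1 : D y' w = 2 ^ (1 + m') * (D y (φ x) * c) +
        2 ^ (1 + m') * (2 ^ (1 + m') * (c * b x' x : ℤ_[2])) := by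
      rw [hDadd]
      congr 1
      · simp only [w, map_smul, hDsmul, PadicInt.coe_pow, coe_ofNat]
        ring
      · simp only [w, map_smul, hDsmul, PadicInt.coe_pow, coe_ofNat]
        rw [hDcomm, hDsmul, hDcomm, hDB, ← hb]
        simp only [PadicInt.coe_pow, coe_ofNat, PadicInt.coe_mul]
        ring
    have e2 : D w w = 2 ^ (1 + m') * (2 * (2 ^ m' * c ^ 2 * b x x : ℤ_[2])) := by
      rw [show D w w = B _ _ from hDB _ _]
      simp only [map_smul, LinearMap.smul_apply, smul_eq_coe_mul, ← hb]
      simp only [PadicInt.coe_pow, coe_ofNat, PadicInt.coe_mul]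
      ring
    have e3 : (2 : ℚ_[2]) ^ (-(1 + m' : ℕ) : ℤ) * D (y' + w) (y' + w) / 2 =
        D y (φ x) * c + 2 ^ (-(1 + m' : ℕ) : ℤ) * D y' y' / 2 +
        (2 ^ (1 + m') * (c * b x' x) + 2 ^ m' * c ^ 2 * b x x : ℤ_[2]) := by
      rw [hDadd y' w, hDadd' y' y' w, hDadd' w y' w, hDcomm w y', e1, e2]
      simp only [PadicInt.coe_pow, coe_ofNat, PadicInt.coe_mul, PadicInt.coe_add]
      linear_combination (D y (φ x) * c + 2 ^ (1 + m') * (c * b x' x) + 2 ^ m' * c ^ 2 * b x x) *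
        hmpow
    rw [e3, AddChar.map_add_eq_mul, AddChar.map_add_eq_mul, psi_intCast, mul_one])
  unfold FormPhase
  convert hL using 1
  · ext x
    change _ = psi (2 ^ (-m : ℤ) * D (φ x) (φ x) / 2)
    rw [hDB]
  · rw [diagOddity_eq_sum hd0, hsign]
    have : ∀ i, rankOnePhase ((2 : ℚ_[2]) ^ (-m : ℤ) * δ i) = rankOnePhase (d i) +
        if Odd m then (if legendre (oddPart (d i)) = -1 then 4 else 0) else 0 := by
      intro i
      -- The rescaling by 2^(-2N) is by an even power of 2, so it creates no antisquares.
      have hodd : Odd (-m + -(2 * N : ℤ)) ↔ Odd m := by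
        rw [← Int.odd_coe_nat m]
        constructor
        · rintro ⟨t, ht⟩; exact ⟨-t - N - 1, by omega⟩
        · rintro ⟨t, ht⟩; exact ⟨-t - N - 1, by omega⟩
      simp only [δ]
      rw [← mul_assoc, ← zpow_add₀ two_ne_zero, rankOnePhase_two_zpow_mul _ (hd0 i)]
      simp only [hodd]
      by_cases ho : Odd m <;> simp [ho]
    rw [Finset.sum_congr rfl fun i _ => this i, Finset.sum_add_distrib]
    congr 1
    by_cases ho : Odd m
    · simp only [ho, true_and, if_true]
      rw [sum_four_eq_prod_sign]
    · simp [ho]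

theorem IsUnimodular.formPhase (h : IsUnimodular B) (hB : ∀ x y, B x y = B y x) {m : ℕ}
    (hm : 1 ≤ m) :
    FormPhase B m (latticeOddity B + if Odd m ∧ latticeSign B = -1 then 4 else 0) := by
  have hex := exists_isDiagonalization _ (gram_transpose hB)
  have : latticeOddity B = diagOddity hex.choose := by
    unfold latticeOddity matrixOddity
    rw [dif_pos hex]
  rw [this]
  exact h.formPhase_of_isDiagonalization hm hex.choose_spec

end Lattice

/-! ### Invariance of dimensions and types -/

/-- `q` is divisible by `2 ^ n`. -/
def DvdPow (n : ℤ) (q : ℚ_[2]) : Prop := ∃ z : ℤ_[2], q = 2 ^ n * (z : ℚ_[2])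

theorem DvdPow.add {n : ℤ} {q r : ℚ_[2]} (hq : DvdPow n q) (hr : DvdPow n r) :
    DvdPow n (q + r) := by
  obtain ⟨z, rfl⟩ := hq
  obtain ⟨w, rfl⟩ := hr
  exact ⟨z + w, by rw [PadicInt.coe_add, mul_add]⟩

theorem dvdPow_zero (n : ℤ) : DvdPow n 0 := ⟨0, by simp⟩

theorem DvdPow.mono {n m : ℤ} {q : ℚ_[2]} (hq : DvdPow n q) (h : m ≤ n) : DvdPow m q := by
  obtain ⟨z, rfl⟩ := hq
  obtain ⟨t, rfl⟩ := Int.le.dest h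
  refine ⟨2 ^ t * z, ?_⟩
  rw [PadicInt.coe_mul, PadicInt.coe_pow, coe_ofNat, zpow_add₀ two_ne_zero, zpow_natCast, mul_assoc]

theorem DvdPow.mul {n m : ℤ} {q : ℚ_[2]} (hq : DvdPow n q) : DvdPow (m + n) (2 ^ m * q) := by
  obtain ⟨z, rfl⟩ := hq
  exact ⟨z, by rw [zpow_add₀ two_ne_zero, mul_assoc]⟩

theorem DvdPow.sum {ι : Type*} {n : ℤ} {s : Finset ι} {q : ι → ℚ_[2]}
    (h : ∀ i ∈ s, DvdPow n (q i)) : DvdPow n (∑ i ∈ s, q i) := by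
  classical
  induction s using Finset.induction_on with
  | empty => exact dvdPow_zero n
  | insert i s hi ih =>
    rw [Finset.sum_insert hi]
    exact (h i (Finset.mem_insert_self _ _)).add (ih fun j hj => h j (Finset.mem_insert_of_mem hj))

section Lattice

variable {L : Type*} [AddCommGroup L] [Module ℤ_[2] L] {B : L →ₗ[ℤ_[2]] L →ₗ[ℤ_[2]] ℚ_[2]}
  {L' : Type*} [AddCommGroup L'] [Module ℤ_[2] L'] [Module.Free ℤ_[2] L']
  [Module.Finite ℤ_[2] L'] {B' : L' →ₗ[ℤ_[2]] L' →ₗ[ℤ_[2]] ℚ_[2]}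

theorem rescale_apply (N : Submodule ℤ_[2] L) (i : ℤ) (x y : N) :
    rescale B N i x y = 2 ^ (-i) * B x y := rfl

theorem form_eq_rescale (N : Submodule ℤ_[2] L) (i : ℤ) (x y : N) :
    B x y = 2 ^ i * rescale B N i x y := by
  rw [rescale_apply, ← mul_assoc, ← zpow_add₀ two_ne_zero]
  simp

/-! ### Intrinsic description of dimensions and types -/

namespace JordanDecomposition

variable (J : JordanDecomposition B) (J' : JordanDecomposition B')

theorem dvdPow {k : ℤ} {x y : L} (hx : x ∈ J.constituent k) (hy : y ∈ J.constituent k) :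
    DvdPow k (B x y) := by
  obtain ⟨b, hb, -⟩ := J.unimodular k
  refine ⟨b ⟨x, hx⟩ ⟨y, hy⟩, ?_⟩
  rw [hb]
  exact form_eq_rescale _ _ ⟨x, hx⟩ ⟨y, hy⟩

/-- The functional w ↦ B(x,w) / 2^(k+m) is integral on the constituent, so unimodularity represents
it by a vector, and injectivity identifies x with 2^m times that vector. -/
theorem exists_eq_pow_smul {k : ℤ} {x : L} (hx : x ∈ J.constituent k) (m : ℕ)
    (h : ∀ w ∈ J.constituent k, DvdPow (k + m) (B x w)) :
    ∃ w ∈ J.constituent k, x = (2 : ℤ_[2]) ^ m • w := by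
  obtain ⟨b, hb, hbij⟩ := J.unimodular k
  have h' : ∀ w : J.constituent k, ∃ z : ℤ_[2], b ⟨x, hx⟩ w = 2 ^ m * z := by
    intro w
    obtain ⟨z, hz⟩ := h w w.2
    refine ⟨z, ?_⟩
    apply Subtype.coe_injective
    change ((b ⟨x, hx⟩ w : ℤ_[2]) : ℚ_[2]) = ((2 ^ m * z : ℤ_[2]) : ℚ_[2])
    rw [hb, rescale_apply, hz, PadicInt.coe_mul, PadicInt.coe_pow, coe_ofNat, ← mul_assoc,
      ← zpow_add₀ two_ne_zero, ← zpow_natCast]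
    congr 2
    ring
  choose l hl using h'
  have h2 : (2 : ℤ_[2]) ^ m ≠ 0 := pow_ne_zero _ two_ne_zero
  let lin : J.constituent k →ₗ[ℤ_[2]] ℤ_[2] :=
    { toFun := l
      map_add' := fun v w => mul_left_cancel₀ h2 (by rw [← hl, map_add, hl, hl, mul_add])
      map_smul' := fun c w => mul_left_cancel₀ h2 (by
        rw [← hl, map_smul, hl, smul_eq_mul, smul_eq_mul, RingHom.id_apply]; ring) }
  obtain ⟨w, hw⟩ := hbij.2 lin
  refine ⟨w, w.2, ?_⟩
  have : (⟨x, hx⟩ : J.constituent k) = (2 : ℤ_[2]) ^ m • w := by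
    apply hbij.1
    rw [map_smul, hw]
    exact LinearMap.ext hl
  exact congrArg Subtype.val this

/-- The projection to a constituent. -/
def proj (k : ℤ) : L →ₗ[ℤ_[2]] J.constituent k :=
  DirectSum.component ℤ_[2] ℤ (fun i => J.constituent i) k ∘ₗ
    (LinearEquiv.ofBijective (DirectSum.coeLinearMap J.constituent) J.isInternal).symm.toLinearMap

variable [Module.Finite ℤ_[2] L]

theorem exists_sum_proj : ∃ s : Finset ℤ, ∀ x, x = ∑ i ∈ s, (J.proj i x : L) := by
  classical
  obtain ⟨a, b, hab⟩ := J.exists_support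
  refine ⟨Finset.Ico a b, fun x => ?_⟩
  let e := LinearEquiv.ofBijective (DirectSum.coeLinearMap J.constituent) J.isInternal
  have h1 : x = DirectSum.coeLinearMap J.constituent (e.symm x) := (e.apply_symm_apply x).symm
  conv_lhs => rw [h1]
  rw [DirectSum.coeLinearMap_eq_dfinsuppSum, DFinsupp.sum]
  refine Finset.sum_subset ?_ ?_
  · intro i hi
    by_contra hni
    have h0 : (e.symm x i : L) = 0 :=
      (Submodule.mem_bot _).1 ((hab i hni).le (e.symm x i).2)
    exact (DFinsupp.mem_support_iff.1 hi) (Subtype.ext h0)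
  · intro i _ hi
    have := DFinsupp.notMem_support_iff.1 hi
    rw [this]
    rfl

theorem form_proj_right {k : ℤ} {x : L} (hx : x ∈ J.constituent k) (y : L) :
    B x (J.proj k y) = B x y := by
  classical
  obtain ⟨s, hs⟩ := J.exists_sum_proj
  by_cases hk : k ∈ s
  · conv_rhs => rw [hs y]
    rw [map_sum, Finset.sum_eq_single k]
    · exact fun i _ hi => J.orthogonal k i hi.symm x hx _ (J.proj i y).2
    · exact fun h => absurd hk h
  · have h0 : ∀ z, B x z = 0 := fun z => by
      rw [hs z, map_sum]
      exact Finset.sum_eq_zero fun i hi =>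
        J.orthogonal k i (by rintro rfl; exact hk hi) x hx _ (J.proj i z).2
    rw [h0, h0]

theorem exists_form_eq_sum : ∃ s : Finset ℤ, ∀ x y,
    B x y = ∑ i ∈ s, B (J.proj i x) (J.proj i y) := by
  obtain ⟨s, hs⟩ := J.exists_sum_proj
  refine ⟨s, fun x y => ?_⟩
  conv_lhs => rw [hs x]
  rw [map_sum, LinearMap.sum_apply]
  exact Finset.sum_congr rfl fun i _ => (J.form_proj_right (J.proj i x).2 y).symm

/-- Pairing with the i-th constituent sees only the i-th component. Thus in the sublattice of
vectors whose products all lie in 2^k ℤ_2, which is defined without the decomposition, components of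
lower scale are highly divisible. -/
theorem proj_eq_pow_smul (hB : ∀ x y, B x y = B y x) {k : ℤ} {x : L}
    (hx : ∀ y, DvdPow k (B x y)) {i : ℤ} (hi : i ≤ k) :
    ∃ w ∈ J.constituent i, (J.proj i x : L) = (2 : ℤ_[2]) ^ (k - i).toNat • w := by
  refine J.exists_eq_pow_smul (J.proj i x).2 _ fun w hw => ?_
  rw [hB, J.form_proj_right hw, hB]
  have : i + (k - i).toNat = k := by omega
  rw [this]
  exact hx w

/-- The right-hand side does not mention the decomposition. On that sublattice a component of scale
2^i with i < k has norm divisible by 2^(2k-i), and one with i > k has norm divisible by 2^i. Modulo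
2^(k+1) only the k-th component matters. -/
theorem isEven_iff (hB : ∀ x y, B x y = B y x) (k : ℤ) :
    IsEven (rescale B (J.constituent k) k) ↔
      ∀ x, (∀ y, DvdPow k (B x y)) → DvdPow (k + 1) (B x x) := by
  constructor
  · intro h x hx
    obtain ⟨s, hs⟩ := J.exists_form_eq_sum
    rw [hs]
    refine DvdPow.sum fun i _ => ?_
    rcases lt_trichotomy i k with hik | rfl | hik
    · obtain ⟨w, hw, he⟩ := J.proj_eq_pow_smul hB hx hik.le
      rw [he, map_smul, LinearMap.map_smul, LinearMap.smul_apply, smul_eq_coe_mul, smul_eq_coe_mul,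
        PadicInt.coe_pow, coe_ofNat, ← zpow_natCast]
      refine ((J.dvdPow hw hw).mul.mul).mono ?_
      omega
    · obtain ⟨z, hz⟩ := h (J.proj i x)
      refine ⟨z, ?_⟩
      rw [form_eq_rescale _ i (J.proj i x) (J.proj i x), hz, zpow_add_one₀ two_ne_zero]
      ring
    · exact (J.dvdPow (J.proj i x).2 (J.proj i x).2).mono (by omega)
  · rintro h ⟨x, hx⟩
    obtain ⟨z, hz⟩ := h x fun y => by
      rw [← J.form_proj_right hx y]
      exact J.dvdPow hx (J.proj k y).2
    refine ⟨z, ?_⟩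
    rw [rescale_apply]
    change 2 ^ (-k) * B x x = _
    rw [hz, ← mul_assoc, ← zpow_add₀ two_ne_zero]
    simp

/-- The map `T` carries a vector of the k-th constituent into the other lattice and projects it to
the k-th constituent there. If T x = 0, the remaining components contribute only multiples of
2^(k+1) to products of x with its constituent, so x is divisible by 2. The kernel is thus contained
in its double and vanishes by Nakayama. -/
theorem finrank_le (hB' : ∀ x y, B' x y = B' y x)
    (hiso : Isometric B B') (k : ℤ) :
    Module.finrank ℤ_[2] (J.constituent k) ≤ Module.finrank ℤ_[2] (J'.constituent k) := by
  obtain ⟨e, he⟩ := hiso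
  let T : J.constituent k →ₗ[ℤ_[2]] J'.constituent k :=
    J'.proj k ∘ₗ e.toLinearMap ∘ₗ (J.constituent k).subtype
  have hdiv : ∀ x : J.constituent k, ∀ y, DvdPow k (B' (e x) y) := fun x y => by
    rw [← e.apply_symm_apply y, he, ← J.form_proj_right x.2]
    exact J.dvdPow x.2 (J.proj k _).2
  have key : ∀ x : J.constituent k, T x = 0 → ∃ w ∈ J.constituent k, (x : L) = (2 : ℤ_[2]) ^ 1 • w := by
    intro x hx
    refine J.exists_eq_pow_smul x.2 1 fun y hy => ?_
    obtain ⟨s, hs⟩ := J'.exists_form_eq_sum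
    rw [← he, hs]
    refine DvdPow.sum fun i _ => ?_
    rcases lt_trichotomy i k with hik | rfl | hik
    · obtain ⟨w, hw, h1⟩ := J'.proj_eq_pow_smul hB' (hdiv x) hik.le
      obtain ⟨w', hw', h2⟩ := J'.proj_eq_pow_smul hB' (hdiv ⟨y, hy⟩) hik.le
      rw [h1, h2, map_smul, LinearMap.map_smul, LinearMap.smul_apply, smul_eq_coe_mul,
        smul_eq_coe_mul, PadicInt.coe_pow, coe_ofNat, ← zpow_natCast]
      refine ((J'.dvdPow hw hw').mul.mul).mono ?_
      push_cast
      omega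
    · have : J'.proj i (e x) = 0 := hx
      rw [this]
      simpa using dvdPow_zero _
    · exact (J'.dvdPow (J'.proj i _).2 (J'.proj i _).2).mono (by push_cast; omega)
  refine LinearMap.finrank_le_finrank_of_injective (f := T) (LinearMap.ker_eq_bot.1 ?_)
  refine Submodule.eq_bot_of_le_smul_of_le_jacobson_bot (IsLocalRing.maximalIdeal ℤ_[2]) _
    (IsNoetherian.noetherian _) ?_ (IsLocalRing.maximalIdeal_le_jacobson _)
  intro x hx
  obtain ⟨w, hw, h⟩ := key x hx
  have hxw : x = (2 : ℤ_[2]) • (⟨w, hw⟩ : J.constituent k) := Subtype.ext (by simpa using h)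
  rw [hxw]
  refine Submodule.smul_mem_smul ?_ ?_
  · rw [IsLocalRing.mem_maximalIdeal, mem_nonunits_iff, isUnit_iff_not_two_dvd]
    simp
  · have h2 : (2 : ℤ_[2]) • T ⟨w, hw⟩ = 0 := by
      rw [← map_smul, ← hxw]; exact hx
    exact (smul_eq_zero.1 h2).resolve_left two_ne_zero

variable [Module.Free ℤ_[2] L]

theorem symbol_dim_eq (hB : ∀ x y, B x y = B y x) (hB' : ∀ x y, B' x y = B' y x)
    (hiso : Isometric B B') : J.symbol.dim = J'.symbol.dim :=
  funext fun k => le_antisymm (J.finrank_le J' hB' hiso k)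
    (J'.finrank_le J hB hiso.symm k)

theorem symbol_typeI_eq (hB : ∀ x y, B x y = B y x) (hB' : ∀ x y, B' x y = B' y x)
    (hiso : Isometric B B') : J.symbol.typeI = J'.symbol.typeI := by
  funext k
  refine congrArg Not (propext ?_)
  rw [J.isEven_iff hB, J'.isEven_iff hB']
  obtain ⟨e, he⟩ := hiso
  constructor
  · intro h x hx
    obtain ⟨x, rfl⟩ := e.surjective x
    rw [he]
    exact h x fun y => by rw [← he]; exact hx _
  · intro h x hx
    rw [← he]
    refine h _ fun y => ?_
    obtain ⟨y, rfl⟩ := e.surjective y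
    rw [he]
    exact hx y

end JordanDecomposition

end Lattice

/-! ### Lattices of rank one and two -/

/-- The isometry class of a form. -/
def formCls {M : Type} [AddCommGroup M] [Module ℤ_[2] M] (Q : M →ₗ[ℤ_[2]] M →ₗ[ℤ_[2]] ℚ_[2]) :
    LatClass := (Lat.mk M Q).cls

section

variable {M M' : Type} [AddCommGroup M] [Module ℤ_[2] M] [AddCommGroup M'] [Module ℤ_[2] M']

theorem formCls_eq {Q : M →ₗ[ℤ_[2]] M →ₗ[ℤ_[2]] ℚ_[2]} {Q' : M' →ₗ[ℤ_[2]] M' →ₗ[ℤ_[2]] ℚ_[2]}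
    (e : M ≃ₗ[ℤ_[2]] M') (he : ∀ x y, Q' (e x) (e y) = Q x y) : formCls Q = formCls Q' :=
  Lat.cls_eq_iff.2 ⟨e, he⟩

theorem formCls_add (Q : M →ₗ[ℤ_[2]] M →ₗ[ℤ_[2]] ℚ_[2]) (Q' : M' →ₗ[ℤ_[2]] M' →ₗ[ℤ_[2]] ℚ_[2]) :
    formCls Q + formCls Q' = formCls (prodForm Q Q') := rfl

end

/-- The rank one form with entry `q`. -/
def rankOneForm (q : ℚ_[2]) : ℤ_[2] →ₗ[ℤ_[2]] ℤ_[2] →ₗ[ℤ_[2]] ℚ_[2] :=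
  LinearMap.mk₂ ℤ_[2] (fun x y => q * ((x : ℚ_[2]) * (y : ℚ_[2])))
    (fun x x' y => by simp only [PadicInt.coe_add]; ring)
    (fun c x y => by simp only [smul_eq_mul, smul_eq_coe_mul, PadicInt.coe_mul]; ring)
    (fun x y y' => by simp only [PadicInt.coe_add]; ring)
    (fun c x y => by simp only [smul_eq_mul, smul_eq_coe_mul, PadicInt.coe_mul]; ring)

/-- The form on the plane with inner product matrix `2 ^ k * [[2 a, h], [h, 2 c]]`. -/
def planeForm (k : ℤ) (a h c : ℤ_[2]) : (ℤ_[2] × ℤ_[2]) →ₗ[ℤ_[2]] (ℤ_[2] × ℤ_[2]) →ₗ[ℤ_[2]] ℚ_[2] :=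
  LinearMap.mk₂ ℤ_[2] (fun x y => 2 ^ k * (2 * (a : ℚ_[2]) * ((x.1 : ℚ_[2]) * (y.1 : ℚ_[2])) +
      (h : ℚ_[2]) * ((x.1 : ℚ_[2]) * (y.2 : ℚ_[2]) + (x.2 : ℚ_[2]) * (y.1 : ℚ_[2])) +
      2 * (c : ℚ_[2]) * ((x.2 : ℚ_[2]) * (y.2 : ℚ_[2]))))
    (fun x x' y => by simp only [Prod.fst_add, Prod.snd_add, PadicInt.coe_add]; ring)
    (fun c x y => by
      simp only [Prod.smul_fst, Prod.smul_snd, smul_eq_mul, smul_eq_coe_mul, PadicInt.coe_mul]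
      ring)
    (fun x y y' => by simp only [Prod.fst_add, Prod.snd_add, PadicInt.coe_add]; ring)
    (fun c x y => by
      simp only [Prod.smul_fst, Prod.smul_snd, smul_eq_mul, smul_eq_coe_mul, PadicInt.coe_mul]
      ring)

theorem rankOneForm_apply (q : ℚ_[2]) (x y : ℤ_[2]) :
    rankOneForm q x y = q * ((x : ℚ_[2]) * (y : ℚ_[2])) := rfl

theorem planeForm_apply (k : ℤ) (a h c : ℤ_[2]) (x y : ℤ_[2] × ℤ_[2]) :
    planeForm k a h c x y = 2 ^ k * (2 * (a : ℚ_[2]) * ((x.1 : ℚ_[2]) * (y.1 : ℚ_[2])) +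
      (h : ℚ_[2]) * ((x.1 : ℚ_[2]) * (y.2 : ℚ_[2]) + (x.2 : ℚ_[2]) * (y.1 : ℚ_[2])) +
      2 * (c : ℚ_[2]) * ((x.2 : ℚ_[2]) * (y.2 : ℚ_[2]))) := rfl

theorem exists_left_inv_of_isUnit {z : ℤ_[2]} (hz : IsUnit z) : ∃ w : ℤ_[2], IsUnit w ∧ w * z = 1 := by
  obtain ⟨w, hw⟩ := hz.exists_left_inv
  exact ⟨w, IsUnit.of_mul_eq_one _ hw, hw⟩

theorem mod8_eq_of_mul_eq_one {z w : ℤ_[2]} (h : w * z = 1) : mod8 w = mod8 z := by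
  have := congrArg mod8 h
  rw [map_mul, map_one] at this
  revert this
  generalize mod8 w = u
  generalize mod8 z = v
  revert u v
  decide

theorem rankOne_mul_sq (q : ℚ_[2]) {s : ℤ_[2]} (hs : IsUnit s) :
    formCls (rankOneForm (q * (s : ℚ_[2]) ^ 2)) = formCls (rankOneForm q) := by
  refine formCls_eq (LinearEquiv.smulOfUnit hs.unit) fun x y => ?_
  have h : ∀ x : ℤ_[2], (LinearEquiv.smulOfUnit hs.unit : ℤ_[2] ≃ₗ[ℤ_[2]] ℤ_[2]) x = s * x :=
    fun x => rfl
  rw [h, h, rankOneForm_apply, rankOneForm_apply, PadicInt.coe_mul, PadicInt.coe_mul]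
  ring

/-- The rank one lattice of scale `2 ^ k` whose entry has odd part `u`. -/
def oneCls (k : ℤ) (u : ZMod 8) : LatClass :=
  formCls (rankOneForm (2 ^ k * ((u.val : ℤ_[2]) : ℚ_[2])))

theorem mod8_natCast_val (u : ZMod 8) : mod8 (u.val : ℤ_[2]) = u := by
  rw [map_natCast, ZMod.natCast_zmod_val]

theorem rankOne_cls_eq (k : ℤ) {z : ℤ_[2]} (hz : IsUnit z) :
    formCls (rankOneForm (2 ^ k * (z : ℚ_[2]))) = oneCls k (mod8 z) := by
  obtain ⟨s, hs, h⟩ := exists_sq_mul_of_mod8_eq hz (mod8_natCast_val (mod8 z)).symm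
  unfold oneCls
  rw [h, PadicInt.coe_mul, PadicInt.coe_pow, ← mul_assoc, rankOne_mul_sq _ hs]

/-- Splitting off the vector `(1, p)` from the orthogonal sum of a rank one lattice and `M`. -/
theorem rankOne_add_cls {M : Type} [AddCommGroup M] [Module ℤ_[2] M]
    (Q Q' : M →ₗ[ℤ_[2]] M →ₗ[ℤ_[2]] ℚ_[2]) (k : ℤ) (a : ℤ_[2]) (p : M) (l : M →ₗ[ℤ_[2]] ℤ_[2])
    (r : ℤ_[2]) (hr : r * (a + l p) = 1) (hp : ∀ y, Q p y = 2 ^ k * (l y : ℚ_[2]))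
    (hp' : ∀ y, Q y p = 2 ^ k * (l y : ℚ_[2]))
    (hQ' : ∀ y z, Q' y z = Q y z - 2 ^ k * ((r * l y * l z : ℤ_[2]) : ℚ_[2])) :
    formCls (rankOneForm (2 ^ k * (a : ℚ_[2]))) + formCls Q =
      formCls (rankOneForm (2 ^ k * ((a + l p : ℤ_[2]) : ℚ_[2]))) + formCls Q' := by
  rw [formCls_add, formCls_add]
  -- The generator goes to (1, p), and y in M goes to (0, y) - r l(y) (1, p), its projection
  -- orthogonal to (1, p).
  let e : (ℤ_[2] × M) ≃ₗ[ℤ_[2]] (ℤ_[2] × M) :=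
    { toFun := fun x => (x.1 - r * l x.2, x.2 + (x.1 - r * l x.2) • p)
      invFun := fun x => (x.1 + r * l (x.2 - x.1 • p), x.2 - x.1 • p)
      map_add' := fun x y => by
        ext
        · simp; ring
        · simp only [Prod.fst_add, Prod.snd_add, map_add]; module
      map_smul' := fun c x => by
        ext
        · simp; ring
        · simp only [Prod.smul_fst, Prod.smul_snd, map_smul, RingHom.id_apply, smul_eq_mul]; module
      left_inv := fun x => by ext <;> simp
      right_inv := fun x => by ext <;> simp }
  refine (formCls_eq e fun x y => ?_).symm
  have hr' : (r : ℚ_[2]) * (a + l p) = 1 := by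
    rw [← PadicInt.coe_add, ← PadicInt.coe_mul, hr]; rfl
  have he : e x = (x.1 - r * l x.2, x.2 + (x.1 - r * l x.2) • p) := rfl
  have he' : e y = (y.1 - r * l y.2, y.2 + (y.1 - r * l y.2) • p) := rfl
  rw [he, he', prodForm_apply, prodForm_apply, rankOneForm_apply, rankOneForm_apply, hQ']
  simp only [map_add, map_smul, LinearMap.add_apply, LinearMap.smul_apply, hp, hp',
    smul_eq_coe_mul, PadicInt.coe_add, PadicInt.coe_sub, PadicInt.coe_mul]
  linear_combination (2 ^ k * ((r : ℚ_[2]) * l x.2 * l y.2 - x.1 * l y.2 - y.1 * l x.2)) * hr'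

/-- The vector (1, s) has norm 2^k (u + 2^j v s²). The determinant then fixes the other entry up to
squares. Division may be replaced by multiplication because odd classes modulo 8 are their own
inverses. -/
theorem oneCls_add_oneCls (k : ℤ) (j : ℕ) {u v s : ZMod 8} (hu : IsOdd u) (hv : IsOdd v)
    (huv : IsOdd (u + 2 ^ j * v * s ^ 2)) :
    oneCls k u + oneCls (k + j) v = oneCls k (u + 2 ^ j * v * s ^ 2) +
      oneCls (k + j) (v * u * (u + 2 ^ j * v * s ^ 2)) := by
  obtain ⟨a, rfl⟩ : ∃ a, mod8 a = u := ⟨_, mod8_natCast_val u⟩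
  obtain ⟨b, rfl⟩ : ∃ a, mod8 a = v := ⟨_, mod8_natCast_val v⟩
  obtain ⟨t, rfl⟩ : ∃ a, mod8 a = s := ⟨_, mod8_natCast_val s⟩
  have e : mod8 a + 2 ^ j * mod8 b * mod8 t ^ 2 = mod8 (a + 2 ^ j * b * t ^ 2) := by
    simp only [map_add, map_mul, map_pow, map_ofNat]
  rw [e] at huv ⊢
  rw [isOdd_iff_isUnit_mod8] at hu hv huv
  obtain ⟨r, hru, hr⟩ := exists_left_inv_of_isUnit huv
  have hr' := congrArg ((↑) : ℤ_[2] → ℚ_[2]) hr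
  simp only [PadicInt.coe_mul, PadicInt.coe_pow, PadicInt.coe_add, PadicInt.coe_one,
    coe_ofNat] at hr'
  have hl : ∀ y, LinearMap.mulLeft ℤ_[2] (2 ^ j * b * t) y = 2 ^ j * b * t * y := fun y => rfl
  have e2 : a + LinearMap.mulLeft ℤ_[2] (2 ^ j * b * t) t = a + 2 ^ j * b * t ^ 2 := by
    rw [hl]; ring
  have key := rankOne_add_cls (rankOneForm (2 ^ (k + j) * (b : ℚ_[2])))
    (rankOneForm (2 ^ (k + j) * ((b * a * r : ℤ_[2]) : ℚ_[2]))) k a t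
    (LinearMap.mulLeft ℤ_[2] (2 ^ j * b * t)) r (by rw [e2, hr]) (fun y => by
      rw [rankOneForm_apply, hl, zpow_add₀ two_ne_zero, zpow_natCast]
      simp only [PadicInt.coe_mul, PadicInt.coe_pow, coe_ofNat]; ring) (fun y => by
      rw [rankOneForm_apply, hl, zpow_add₀ two_ne_zero, zpow_natCast]
      simp only [PadicInt.coe_mul, PadicInt.coe_pow, coe_ofNat]; ring) (fun y z => by
      rw [rankOneForm_apply, rankOneForm_apply, hl, hl, zpow_add₀ two_ne_zero, zpow_natCast]
      simp only [PadicInt.coe_mul, PadicInt.coe_pow, coe_ofNat]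
      linear_combination (2 ^ k * 2 ^ j * b * y * z) * hr')
  rw [e2, rankOne_cls_eq _ hu, rankOne_cls_eq _ hv, rankOne_cls_eq _ huv,
    rankOne_cls_eq _ ((hv.mul hu).mul hru)] at key
  rw [key, map_mul, map_mul, mod8_eq_of_mul_eq_one hr]

theorem plane_change (k : ℤ) (a h c p q r s d : ℤ_[2]) (hd : d * (p * s - q * r) = 1) :
    formCls (planeForm k a h c) = formCls (planeForm k (a * p ^ 2 + h * p * q + c * q ^ 2)
      (2 * a * p * r + h * (p * s + q * r) + 2 * c * q * s)
      (a * r ^ 2 + h * r * s + c * s ^ 2)) := by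
  let e : (ℤ_[2] × ℤ_[2]) ≃ₗ[ℤ_[2]] (ℤ_[2] × ℤ_[2]) :=
    { toFun := fun x => (p * x.1 + r * x.2, q * x.1 + s * x.2)
      invFun := fun x => (d * (s * x.1 - r * x.2), d * (p * x.2 - q * x.1))
      map_add' := fun x y => by ext <;> simp <;> ring
      map_smul' := fun t x => by ext <;> simp <;> ring
      left_inv := fun x => by
        ext
        · simp only; linear_combination x.1 * hd
        · simp only; linear_combination x.2 * hd
      right_inv := fun x => by
        ext
        · simp only; linear_combination x.1 * hd
        · simp only; linear_combination x.2 * hd }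
  refine (formCls_eq e fun x y => ?_).symm
  have he : ∀ x, e x = (p * x.1 + r * x.2, q * x.1 + s * x.2) := fun x => rfl
  rw [he, he, planeForm_apply, planeForm_apply]
  simp only [PadicInt.coe_mul, PadicInt.coe_pow, PadicInt.coe_add, coe_ofNat]
  ring

/-- The even unimodular plane scaled by `2 ^ k`, of sign `-` if `ε` is true and `+` otherwise. -/
def planeCls (k : ℤ) (ε : Bool) : LatClass :=
  if ε then formCls (planeForm k 1 1 1) else formCls (planeForm k 0 1 0)

theorem plane_normalize (k : ℤ) (a c : ℤ_[2]) {h : ℤ_[2]} (hh : IsUnit h) :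
    ∃ s : ℤ_[2], IsUnit s ∧ formCls (planeForm k a h c) = formCls (planeForm k a 1 (c * s ^ 2)) := by
  obtain ⟨s, hs, hsh⟩ := exists_left_inv_of_isUnit hh
  refine ⟨s, hs, ?_⟩
  rw [plane_change k a h c 1 0 0 s h (by linear_combination hsh)]
  congr 2
  · ring
  · linear_combination hsh
  · ring

/-- Hensel's lemma gives an isotropic vector (1, t). Subtracting a multiple of it from the second
basis vector makes that one isotropic too. -/
theorem plane_cls_of_two_dvd_left (k : ℤ) {a h : ℤ_[2]} (c : ℤ_[2]) (hh : IsUnit h)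
    (ha : (2 : ℤ_[2]) ∣ a) : formCls (planeForm k a h c) = planeCls k false := by
  obtain ⟨t, -, ht⟩ := exists_quadratic_root c h a hh ha
  have h1 : formCls (planeForm k a h c) = formCls (planeForm k 0 (h + 2 * c * t) c) := by
    rw [plane_change k a h c 1 t 0 1 1 (by ring)]
    congr 2
    · linear_combination ht
    · ring
    · ring
  obtain ⟨s, hs, h2⟩ := plane_normalize k 0 c (h := h + 2 * c * t)
    (isUnit_add_of_two_dvd hh ⟨c * t, by ring⟩)
  rw [h1, h2, plane_change k 0 1 (c * s ^ 2) 1 0 (-(c * s ^ 2)) 1 1 (by ring)]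
  unfold planeCls
  rw [if_neg (by simp)]
  congr 2 <;> ring

theorem plane_cls_of_two_dvd_right (k : ℤ) (a : ℤ_[2]) {h c : ℤ_[2]} (hh : IsUnit h)
    (hc : (2 : ℤ_[2]) ∣ c) : formCls (planeForm k a h c) = planeCls k false := by
  rw [← plane_cls_of_two_dvd_left k a hh hc,
    plane_change k a h c 0 1 1 0 (-1) (by ring)]
  congr 2 <;> ring

theorem plane_cls_of_isUnit (k : ℤ) {a h c : ℤ_[2]} (ha : IsUnit a) (hh : IsUnit h)
    (hc : IsUnit c) : formCls (planeForm k a h c) = planeCls k true := by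
  obtain ⟨s₀, hs₀, h₀⟩ := plane_normalize k a c hh
  rw [h₀]
  have hc₀ : IsUnit (c * s₀ ^ 2) := hc.mul (hs₀.pow 2)
  generalize c * s₀ ^ 2 = c₀ at hc₀
  -- The vector (t, 1) has norm 2 · 2^k and becomes the first basis vector.
  obtain ⟨t, -, ht⟩ := exists_quadratic_root a 1 (c₀ - 1) isUnit_one
    ((isUnit_iff_two_dvd_sub_one _).1 hc₀)
  have h1 : formCls (planeForm k a 1 c₀) = formCls (planeForm k 1 (1 + 2 * a * t) a) := by
    rw [plane_change k a 1 c₀ t 1 1 0 (-1) (by ring)]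
    congr 2
    · linear_combination ht
    · ring
    · ring
  obtain ⟨s, hs, h2⟩ := plane_normalize k 1 a (h := 1 + 2 * a * t)
    (isUnit_add_of_two_dvd isUnit_one ⟨a * t, by ring⟩)
  have ha' : IsUnit (a * s ^ 2) := ha.mul (hs.pow 2)
  rw [h1, h2]
  generalize a * s ^ 2 = c' at ha'
  have h3 : IsUnit (3 : ℤ_[2]) := by
    have := isUnit_add_of_two_dvd (isUnit_one (M := ℤ_[2])) (dvd_refl 2)
    norm_num at this
    exact this
  -- The root gives 4c' - 1 = 3 (1 + 2t')², so the determinant is 3 up to a unit square. Scaling by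
  -- w = (1 + 2t')⁻¹ removes that square.
  obtain ⟨t', -, ht'⟩ := exists_quadratic_root 3 3 (1 - c') h3 (by
    rw [← dvd_neg, neg_sub]; exact (isUnit_iff_two_dvd_sub_one _).1 ha')
  obtain ⟨w, -, hw⟩ := exists_left_inv_of_isUnit
    (isUnit_add_of_two_dvd (isUnit_one (M := ℤ_[2])) ⟨t', rfl⟩)
  rw [plane_change k 1 1 c' 1 0 (w * t') w (1 + 2 * t') (by linear_combination hw)]
  unfold planeCls
  rw [if_pos rfl]
  congr 2
  · ring
  · linear_combination hw
  · linear_combination (w * (1 + 2 * t') + 1) * hw - w ^ 2 * ht'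

/-- Changing the first vector of an even plane by a vector of an orthogonal summand. -/
theorem plane_add_cls {M : Type} [AddCommGroup M] [Module ℤ_[2] M]
    (Q Q' : M →ₗ[ℤ_[2]] M →ₗ[ℤ_[2]] ℚ_[2]) (k : ℤ) (a c n : ℤ_[2]) (p : M) (l : M →ₗ[ℤ_[2]] ℤ_[2])
    (hn : l p = 2 * n) (r : ℤ_[2]) (hr : r * (4 * (a + n) * c - 1) = 1)
    (hp : ∀ y, Q p y = 2 ^ k * (l y : ℚ_[2])) (hp' : ∀ y, Q y p = 2 ^ k * (l y : ℚ_[2]))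
    (hQ' : ∀ y z, Q' y z = Q y z - 2 ^ k * ((2 * c * r * l y * l z : ℤ_[2]) : ℚ_[2])) :
    formCls (planeForm k a 1 c) + formCls Q =
      formCls (planeForm k (a + n) 1 c) + formCls Q' := by
  rw [formCls_add, formCls_add]
  -- The first basis vector of the plane is shifted by p, the second is kept, and M is projected
  -- orthogonally to the new plane. The new plane has determinant 4 (a + n) c - 1, with inverse r,
  -- up to the scale.
  let e : ((ℤ_[2] × ℤ_[2]) × M) ≃ₗ[ℤ_[2]] ((ℤ_[2] × ℤ_[2]) × M) :=
    { toFun := fun x => ((x.1.1 - 2 * c * r * l x.2, x.1.2 + r * l x.2),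
        x.2 + (x.1.1 - 2 * c * r * l x.2) • p)
      invFun := fun x => ((x.1.1 + 2 * c * r * l (x.2 - x.1.1 • p), x.1.2 - r * l (x.2 - x.1.1 • p)),
        x.2 - x.1.1 • p)
      map_add' := fun x y => by
        ext
        · simp; ring
        · simp; ring
        · simp only [Prod.fst_add, Prod.snd_add, map_add]; module
      map_smul' := fun c x => by
        ext
        · simp; ring
        · simp; ring
        · simp only [Prod.smul_fst, Prod.smul_snd, map_smul, RingHom.id_apply, smul_eq_mul]; module
      left_inv := fun x => by ext <;> simp
      right_inv := fun x => by ext <;> simp }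
  refine (formCls_eq e fun x y => ?_).symm
  have hr' : (r : ℚ_[2]) * (4 * (a + n) * c - 1) = 1 := congrArg ((↑) : ℤ_[2] → ℚ_[2]) hr
  have he : ∀ x, e x = ((x.1.1 - 2 * c * r * l x.2, x.1.2 + r * l x.2),
        x.2 + (x.1.1 - 2 * c * r * l x.2) • p) := fun x => rfl
  rw [he, he, prodForm_apply, prodForm_apply, planeForm_apply, planeForm_apply, hQ']
  simp only [map_add, map_smul, LinearMap.add_apply, LinearMap.smul_apply, hp, hp', hn,
    smul_eq_coe_mul, PadicInt.coe_add, PadicInt.coe_sub, PadicInt.coe_mul, coe_ofNat,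
    PadicInt.coe_one]
  linear_combination (2 ^ k * (2 * c * r * l x.2 * l y.2 - x.1.1 * l y.2 - y.1.1 * l x.2)) * hr'

/-! ### Relations between sums of lattices of rank one and two -/

theorem exists_mod8_eq {u : ZMod 8} (hu : IsOdd u) : ∃ a : ℤ_[2], IsUnit a ∧ mod8 a = u := by
  refine ⟨(u.val : ℤ_[2]), ?_, mod8_natCast_val u⟩
  rw [← isOdd_iff_isUnit_mod8, mod8_natCast_val]
  exact hu

/-- A linear functional on the plane. -/
def planeFunctional (u v : ℤ_[2]) : (ℤ_[2] × ℤ_[2]) →ₗ[ℤ_[2]] ℤ_[2] :=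
  LinearMap.coprod (LinearMap.mulLeft ℤ_[2] u) (LinearMap.mulLeft ℤ_[2] v)

theorem planeFunctional_apply (u v : ℤ_[2]) (y : ℤ_[2] × ℤ_[2]) :
    planeFunctional u v y = u * y.1 + v * y.2 := rfl

/-- The vector (1, 2) has norm a + 4b, and 4b = 4a modulo 8 for odd a and b. -/
theorem oneCls_add_same (k : ℤ) {a b : ZMod 8} (ha : IsOdd a) (hb : IsOdd b) :
    oneCls k a + oneCls k b = oneCls k (5 * a) + oneCls k (5 * b) := by
  have h : a + 2 ^ 0 * b * 2 ^ 2 = 5 * a ∧ b * a * (5 * a) = 5 * b ∧ IsOdd (5 * a) := by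
    revert a b; decide
  have := oneCls_add_oneCls k 0 (s := 2) ha hb (by rw [h.1]; exact h.2.2)
  rw [h.1, h.2.1, Nat.cast_zero, add_zero] at this
  exact this

theorem oneCls_add_succ (k : ℤ) {a b : ZMod 8} (ha : IsOdd a) (hb : IsOdd b) :
    oneCls k a + oneCls (k + 1) b =
      oneCls k (a + 2 * b) + oneCls (k + 1) (b * a * (a + 2 * b)) := by
  have h : a + 2 ^ 1 * b * 1 ^ 2 = a + 2 * b ∧ IsOdd (a + 2 * b) := by
    revert a b; decide
  have := oneCls_add_oneCls k 1 (s := 1) ha hb (by rw [h.1]; exact h.2)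
  rw [h.1, Nat.cast_one] at this
  exact this

/-- This realizes a walk across a trivial term: both signs change and both oddities change by 4. -/
theorem oneCls_add_two (k : ℤ) {a b : ZMod 8} (ha : IsOdd a) (hb : IsOdd b) :
    oneCls k a + oneCls (k + 2) b = oneCls k (5 * a) + oneCls (k + 2) (5 * b) := by
  have h : a + 2 ^ 2 * b * 1 ^ 2 = 5 * a ∧ b * a * (5 * a) = 5 * b ∧ IsOdd (5 * a) := by
    revert a b; decide
  have := oneCls_add_oneCls k 2 (s := 1) ha hb (by rw [h.1]; exact h.2.2)
  rw [h.1, h.2.1, Nat.cast_two] at this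
  exact this

/-- In the sum of three copies of the rank one form with unit a, the vector (1,1,1) has norm 3a up
to the scale. Its orthogonal complement is an even plane all of whose parameters are units. -/
theorem oneCls_add_planeCls_true (k : ℤ) {u : ZMod 8} (hu : IsOdd u) :
    oneCls k (3 * u) + planeCls k true = oneCls k u + (oneCls k u + oneCls k u) := by
  obtain ⟨a, ha, rfl⟩ := exists_mod8_eq hu
  have h3 : IsUnit (a + (a + a)) := isUnit_add_of_two_dvd ha ⟨a, by ring⟩
  obtain ⟨r, hru, hr⟩ := exists_left_inv_of_isUnit h3
  have hr' := congrArg ((↑) : ℤ_[2] → ℚ_[2]) hr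
  simp only [PadicInt.coe_mul, PadicInt.coe_add, PadicInt.coe_one] at hr'
  have hl : planeFunctional a a (1, 1) = a + a := by rw [planeFunctional_apply]; ring
  have key := rankOne_add_cls
    (prodForm (rankOneForm (2 ^ k * (a : ℚ_[2]))) (rankOneForm (2 ^ k * (a : ℚ_[2]))))
    (planeForm k (r * a ^ 2) (-(r * a ^ 2)) (r * a ^ 2)) k a (1, 1) (planeFunctional a a) r
    (by rw [hl, hr])
    (fun y => by
      simp only [prodForm_apply, rankOneForm_apply, planeFunctional_apply, PadicInt.coe_mul,
        PadicInt.coe_add, PadicInt.coe_one]; ring)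
    (fun y => by
      simp only [prodForm_apply, rankOneForm_apply, planeFunctional_apply, PadicInt.coe_mul,
        PadicInt.coe_add, PadicInt.coe_one]; ring)
    (fun y z => by
      simp only [prodForm_apply, rankOneForm_apply, planeForm_apply, planeFunctional_apply,
        PadicInt.coe_mul, PadicInt.coe_add, PadicInt.coe_neg, PadicInt.coe_pow]
      linear_combination (2 ^ k * a * (y.1 * z.1 + y.2 * z.2)) * hr')
  rw [hl, ← formCls_add, rankOne_cls_eq k ha, rankOne_cls_eq k h3,
    plane_cls_of_isUnit k (hru.mul (ha.pow 2)) (hru.mul (ha.pow 2)).neg (hru.mul (ha.pow 2))] at key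
  rw [key]
  congr 2
  rw [map_add, map_add]; ring

/-- With entries a, a, -a, the vector (1,1,1) has norm a up to the scale, and its complement is an
even plane containing an isotropic basis vector. -/
theorem oneCls_add_planeCls_false (k : ℤ) {u : ZMod 8} (hu : IsOdd u) :
    oneCls k u + planeCls k false = oneCls k u + (oneCls k u + oneCls k (-u)) := by
  obtain ⟨a, ha, rfl⟩ := exists_mod8_eq hu
  obtain ⟨r, hru, hr⟩ := exists_left_inv_of_isUnit ha
  have hr' := congrArg ((↑) : ℤ_[2] → ℚ_[2]) hr
  simp only [PadicInt.coe_mul, PadicInt.coe_one] at hr'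
  have hl : a + planeFunctional a (-a) (1, 1) = a := by rw [planeFunctional_apply]; ring
  have key := rankOne_add_cls
    (prodForm (rankOneForm (2 ^ k * (a : ℚ_[2]))) (rankOneForm (2 ^ k * ((-a : ℤ_[2]) : ℚ_[2]))))
    (planeForm k 0 a (-a)) k a (1, 1) (planeFunctional a (-a)) r
    (by rw [hl, hr])
    (fun y => by
      simp only [prodForm_apply, rankOneForm_apply, planeFunctional_apply, PadicInt.coe_mul,
        PadicInt.coe_add, PadicInt.coe_one]; ring)
    (fun y => by
      simp only [prodForm_apply, rankOneForm_apply, planeFunctional_apply, PadicInt.coe_mul,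
        PadicInt.coe_add, PadicInt.coe_one]; ring)
    (fun y z => by
      simp only [prodForm_apply, rankOneForm_apply, planeForm_apply, planeFunctional_apply,
        PadicInt.coe_mul, PadicInt.coe_add, PadicInt.coe_neg, PadicInt.coe_zero]
      linear_combination (2 ^ k * a * (y.1 - y.2) * (z.1 - z.2)) * hr')
  rw [hl, ← formCls_add, rankOne_cls_eq k ha, rankOne_cls_eq k ha.neg,
    plane_cls_of_two_dvd_left k (-a) ha (dvd_zero 2), map_neg] at key
  exact key.symm

/-- Adding to the first basis vector of one plane a vector of norm 2 from the other doubles its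
norm, which makes the plane hyperbolic. The complement is hyperbolic as well because 1 - r is even.
-/
theorem planeCls_true_add_true (k : ℤ) :
    planeCls k true + planeCls k true = planeCls k false + planeCls k false := by
  have h7 : IsUnit (4 * (1 + 1) * 1 - 1 : ℤ_[2]) := by
    rw [isUnit_iff_two_dvd_sub_one]; exact ⟨3, by norm_num⟩
  obtain ⟨r, hru, hr⟩ := exists_left_inv_of_isUnit h7
  have hr4 : IsUnit (1 - 4 * r) := by
    rw [isUnit_iff_two_dvd_sub_one]; exact ⟨-2 * r, by ring⟩
  have hr1 : (2 : ℤ_[2]) ∣ 1 - r := by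
    rw [← dvd_neg, neg_sub, ← isUnit_iff_two_dvd_sub_one]; exact hru
  have key := plane_add_cls (planeForm k 1 1 1) (planeForm k (1 - 4 * r) (1 - 4 * r) (1 - r))
    k 1 1 1 (1, 0) (planeFunctional 2 1) (by rw [planeFunctional_apply]; ring) r hr
    (fun y => by
      simp only [planeForm_apply, planeFunctional_apply, PadicInt.coe_mul,
        PadicInt.coe_add, PadicInt.coe_one, PadicInt.coe_zero, coe_ofNat]; ring)
    (fun y => by
      simp only [planeForm_apply, planeFunctional_apply, PadicInt.coe_mul,
        PadicInt.coe_add, PadicInt.coe_one, PadicInt.coe_zero, coe_ofNat]; ring)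
    (fun y z => by
      simp only [planeForm_apply, planeFunctional_apply, PadicInt.coe_mul, PadicInt.coe_sub,
        PadicInt.coe_add, PadicInt.coe_one, coe_ofNat]; ring)
  rw [plane_cls_of_isUnit k isUnit_one isUnit_one isUnit_one,
    plane_cls_of_two_dvd_left k _ isUnit_one ⟨1, by norm_num⟩,
    plane_cls_of_two_dvd_right k _ hr4 hr1] at key
  exact key

/-- The generator of the rank one form has norm 2 · 2^k a, so adding it to a plane vector changes
the parameter 1 into the even number 1 + a. The new entry a - 4ra² is 5a modulo 8. This realizes a
walk between a type II and a type I term. -/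
theorem planeCls_true_add_oneCls (k : ℤ) {u : ZMod 8} (hu : IsOdd u) :
    planeCls k true + oneCls (k + 1) u = planeCls k false + oneCls (k + 1) (5 * u) := by
  obtain ⟨a, ha, rfl⟩ := exists_mod8_eq hu
  have h7 : IsUnit (4 * (1 + a) * 1 - 1 : ℤ_[2]) := by
    rw [isUnit_iff_two_dvd_sub_one]; exact ⟨2 * a + 1, by ring⟩
  obtain ⟨r, hru, hr⟩ := exists_left_inv_of_isUnit h7
  have key := plane_add_cls (rankOneForm (2 ^ (k + 1) * (a : ℚ_[2])))
    (rankOneForm (2 ^ (k + 1) * ((a - 4 * r * a ^ 2 : ℤ_[2]) : ℚ_[2])))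
    k 1 1 a 1 (LinearMap.mulLeft ℤ_[2] (2 * a)) (by rw [LinearMap.mulLeft_apply]; ring) r hr
    (fun y => by
      simp only [rankOneForm_apply, LinearMap.mulLeft_apply, PadicInt.coe_mul,
        zpow_add_one₀ (two_ne_zero' ℚ_[2]), PadicInt.coe_one, coe_ofNat]; ring)
    (fun y => by
      simp only [rankOneForm_apply, LinearMap.mulLeft_apply, PadicInt.coe_mul,
        zpow_add_one₀ (two_ne_zero' ℚ_[2]), PadicInt.coe_one, coe_ofNat]; ring)
    (fun y z => by
      simp only [rankOneForm_apply, LinearMap.mulLeft_apply, PadicInt.coe_mul, PadicInt.coe_sub,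
        zpow_add_one₀ (two_ne_zero' ℚ_[2]), PadicInt.coe_one, PadicInt.coe_pow, coe_ofNat]; ring)
  have h5 : mod8 (a - 4 * r * a ^ 2) = 5 * mod8 a := by
    have h1 := (isOdd_iff_isUnit_mod8 a).2 ha
    have h2 := (isOdd_iff_isUnit_mod8 r).2 hru
    rw [map_sub, map_mul, map_mul, map_pow, map_ofNat]
    revert h1 h2
    generalize mod8 a = u
    generalize mod8 r = v
    revert u v
    decide
  have hu5 : IsUnit (a - 4 * r * a ^ 2) := by
    rw [sub_eq_add_neg]
    exact isUnit_add_of_two_dvd ha ⟨-(2 * r * a ^ 2), by ring⟩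
  rw [plane_cls_of_isUnit k isUnit_one isUnit_one isUnit_one,
    plane_cls_of_two_dvd_left k _ isUnit_one (two_dvd_add_of_isUnit isUnit_one ha),
    rankOne_cls_eq _ ha, rankOne_cls_eq _ hu5, h5] at key
  exact key

/-- A plane vector of norm 2 · 2^(k+1) = 4 · 2^k is added to the generator, changing a into a + 4 =
5a modulo 8. This is the other walk between different types. -/
theorem oneCls_add_planeCls_succ (k : ℤ) {u : ZMod 8} (hu : IsOdd u) :
    oneCls k u + planeCls (k + 1) true = oneCls k (5 * u) + planeCls (k + 1) false := by
  obtain ⟨a, ha, rfl⟩ := exists_mod8_eq hu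
  have h4 : IsUnit (a + 4) := isUnit_add_of_two_dvd ha ⟨2, by norm_num⟩
  obtain ⟨r, hru, hr⟩ := exists_left_inv_of_isUnit h4
  have hr4 : IsUnit (1 - 4 * r) := by
    rw [isUnit_iff_two_dvd_sub_one]; exact ⟨-2 * r, by ring⟩
  have hr1 : (2 : ℤ_[2]) ∣ 1 - r := by
    rw [← dvd_neg, neg_sub, ← isUnit_iff_two_dvd_sub_one]; exact hru
  have hl : planeFunctional 4 2 (1, 0) = 4 := by rw [planeFunctional_apply]; ring
  have key := rankOne_add_cls (planeForm (k + 1) 1 1 1)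
    (planeForm (k + 1) (1 - 4 * r) (1 - 4 * r) (1 - r)) k a (1, 0) (planeFunctional 4 2) r
    (by rw [hl, hr])
    (fun y => by
      simp only [planeForm_apply, planeFunctional_apply, PadicInt.coe_mul, PadicInt.coe_zero,
        zpow_add_one₀ (two_ne_zero' ℚ_[2]), PadicInt.coe_add, PadicInt.coe_one, coe_ofNat]; ring)
    (fun y => by
      simp only [planeForm_apply, planeFunctional_apply, PadicInt.coe_mul, PadicInt.coe_zero,
        zpow_add_one₀ (two_ne_zero' ℚ_[2]), PadicInt.coe_add, PadicInt.coe_one, coe_ofNat]; ring)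
    (fun y z => by
      simp only [planeForm_apply, planeFunctional_apply, PadicInt.coe_mul, PadicInt.coe_sub,
        zpow_add_one₀ (two_ne_zero' ℚ_[2]), PadicInt.coe_add, PadicInt.coe_one, coe_ofNat]; ring)
  rw [hl, rankOne_cls_eq _ ha, rankOne_cls_eq _ h4,
    plane_cls_of_isUnit _ isUnit_one isUnit_one isUnit_one,
    plane_cls_of_two_dvd_right _ _ hr4 hr1] at key
  rw [key]
  congr 2
  have h1 := (isOdd_iff_isUnit_mod8 a).2 ha
  rw [map_add, map_ofNat]
  revert h1
  generalize mod8 a = u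
  revert u
  decide

/-! ### Blocks: the indecomposable lattices -/

/-- A block is a rank one lattice `2 ^ k * u` or an even plane of scale `2 ^ k`. -/
inductive Block
  | one (k : ℤ) (u : ZMod 8)
  | plane (k : ℤ) (ε : Bool)

/-- The isometry class of a block. -/
def Block.cls : Block → LatClass
  | .one k u => oneCls k u
  | .plane k ε => planeCls k ε

/-- The entry of a rank one block is odd. -/
def Block.Proper : Block → Prop
  | .one _ u => IsOdd u
  | .plane _ _ => True

open Classical in
/-- The phase of the Gauss mean of a block at the scale `2 ^ k`. -/
def Block.phase (k : ℤ) : Block → ZMod 8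
  | .one j u => if j < k then u + (if Odd (k - j) ∧ legendre u = -1 then 4 else 0) else 0
  | .plane j ε => if j < k ∧ Odd (k - j) ∧ ε = true then 4 else 0

open Classical in
theorem Block.phase_one (j k : ℤ) (u : ZMod 8) : (Block.one j u).phase k =
    if j < k then u + (if Odd (k - j) ∧ legendre u = -1 then 4 else 0) else 0 := rfl

open Classical in
theorem Block.phase_plane (j k : ℤ) (ε : Bool) : (Block.plane j ε).phase k =
    if j < k ∧ Odd (k - j) ∧ ε = true then 4 else 0 := rfl

theorem oneCls_phase {j k : ℤ} (hjk : j ≠ k) {u : ZMod 8} (hu : IsOdd u) :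
    (oneCls j u).Phase k ((Block.one j u).phase k) := by
  obtain ⟨z, hz, rfl⟩ := exists_mod8_eq hu
  rw [← rankOne_cls_eq j hz]
  refine LatClass.phase_cls_iff.2 ?_
  change HasPhase (fun x : ℤ_[2] => psi (2 ^ (-k) * (2 ^ j * (z : ℚ_[2]) * (x * x)) / 2)) _
  rw [Block.phase_one]
  have h2 : (2 : ℚ_[2]) ≠ 0 := two_ne_zero
  rcases lt_or_gt_of_ne hjk with h | h
  · rw [if_pos h]
    have hz0 : (z : ℚ_[2]) ≠ 0 := by simpa using hz.ne_zero
    have hv := valuation_zpow_mul (j - k) hz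
    have := hasPhase_rankOne (d := 2 ^ (j - k) * z) (mul_ne_zero (zpow_ne_zero _ h2) hz0)
      (by rw [hv]; omega)
    unfold rankOnePhase at this
    rw [hv, oddPart_zpow_mul _ hz] at this
    have ho : Odd (j - k) ↔ Odd (k - j) := by rw [← neg_sub, odd_neg]
    simp only [ho] at this
    convert this using 2 with x
    · rw [zpow_sub₀ h2, zpow_neg]
      congr 1
      field_simp
  · rw [if_neg (by omega)]
    refine hasPhase_one fun x => ?_
    obtain ⟨m, hm⟩ := Int.eq_ofNat_of_zero_le (a := j - k - 1) (by omega)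
    have e : (2 ^ (-k) * (2 ^ j * (z : ℚ_[2]) * (x * x)) / 2) =
        ((2 ^ m * z * (x * x) : ℤ_[2]) : ℚ_[2]) := by
      simp only [PadicInt.coe_mul, PadicInt.coe_pow, coe_ofNat]
      have : j = m + k + 1 := by omega
      rw [this, zpow_add_one₀ h2, zpow_add₀ h2, zpow_neg, zpow_natCast]
      field_simp
    rw [e, psi_intCast]

theorem planeForm_isUnimodular (a h c : ℤ_[2]) (hh : IsUnit h) :
    IsUnimodular (planeForm 0 a h c) := by
  have hu : IsUnit (h ^ 2 + 2 * (-2 * a * c)) := isUnit_add_of_two_dvd (hh.pow 2) ⟨_, rfl⟩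
  obtain ⟨d, -, hd⟩ := exists_left_inv_of_isUnit hu
  let b : (ℤ_[2] × ℤ_[2]) →ₗ[ℤ_[2]] (ℤ_[2] × ℤ_[2]) →ₗ[ℤ_[2]] ℤ_[2] :=
    LinearMap.mk₂ ℤ_[2] (fun x y => 2 * a * (x.1 * y.1) + h * (x.1 * y.2 + x.2 * y.1) +
        2 * c * (x.2 * y.2))
      (fun x x' y => by simp only [Prod.fst_add, Prod.snd_add]; ring)
      (fun c x y => by simp only [Prod.smul_fst, Prod.smul_snd, smul_eq_mul]; ring)
      (fun x y y' => by simp only [Prod.fst_add, Prod.snd_add]; ring)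
      (fun c x y => by simp only [Prod.smul_fst, Prod.smul_snd, smul_eq_mul]; ring)
  have hb : ∀ x y, b x y = 2 * a * (x.1 * y.1) + h * (x.1 * y.2 + x.2 * y.1) +
        2 * c * (x.2 * y.2) := fun _ _ => rfl
  refine ⟨b, fun x y => ?_, ?_, fun f => ?_⟩
  · rw [hb, planeForm_apply]
    simp only [PadicInt.coe_mul, PadicInt.coe_add, coe_ofNat]
    ring
  · rw [injective_iff_map_eq_zero]
    intro x hx
    have h1 := LinearMap.congr_fun hx (1, 0)
    have h2 := LinearMap.congr_fun hx (0, 1)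
    rw [hb, LinearMap.zero_apply] at h1 h2
    simp only [mul_one, mul_zero, add_zero, zero_add] at h1 h2
    ext
    · change x.1 = 0
      linear_combination d * (h * h2 - 2 * c * h1) - x.1 * hd
    · change x.2 = 0
      linear_combination d * (h * h1 - 2 * a * h2) - x.2 * hd
  · refine ⟨(d * (h * f (0, 1) - 2 * c * f (1, 0)), d * (h * f (1, 0) - 2 * a * f (0, 1))), ?_⟩
    ext
    · simp only [LinearMap.coe_comp, Function.comp_apply, LinearMap.inl_apply, hb]
      linear_combination f (1, 0) * hd
    · simp only [LinearMap.coe_comp, Function.comp_apply, LinearMap.inr_apply, hb]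
      linear_combination f (0, 1) * hd

theorem planeForm_symm (k : ℤ) (a h c : ℤ_[2]) (x y : ℤ_[2] × ℤ_[2]) :
    planeForm k a h c x y = planeForm k a h c y x := by
  rw [planeForm_apply, planeForm_apply]; ring

theorem exists_planeForm_phase {j k : ℤ} (hjk : j < k) (a c : ℤ_[2]) :
    ∃ p, (formCls (planeForm j a 1 c)).Phase k p := by
  obtain ⟨m, hm⟩ := Int.eq_ofNat_of_zero_le (a := k - j) (by omega)
  obtain ⟨p, hp⟩ : ∃ p, FormPhase (planeForm 0 a 1 c) m p :=
    ⟨_, (planeForm_isUnimodular a 1 c isUnit_one).formPhase (planeForm_symm 0 a 1 c) (by omega)⟩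
  refine ⟨p, (LatClass.phase_cls_iff (A := ⟨_, planeForm j a 1 c⟩)).2
    (?_ : HasPhase (fun x => psi (2 ^ (-k) * planeForm j a 1 c x x / 2)) p)⟩
  unfold FormPhase at hp
  convert hp using 3 with x
  simp only [planeForm_apply]
  have : k = m + j := by omega
  rw [this, neg_add, zpow_add₀ two_ne_zero, zpow_neg 2 j, zpow_zero]
  field_simp

/-- For j < k a phase exists by unimodularity. Its value follows by additivity from the relations
that express a plane plus a rank one form by rank one forms, so no Gauss sum of a plane is
evaluated. -/
theorem planeCls_phase (j k : ℤ) (ε : Bool) :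
    (planeCls j ε).Phase k ((Block.plane j ε).phase k) := by
  rcases le_or_gt k j with h | h
  · have key : ∀ a c : ℤ_[2], (formCls (planeForm j a 1 c)).Phase k 0 := fun a c => by
      refine LatClass.phase_cls_iff.2 (hasPhase_one fun x => ?_)
      change psi (2 ^ (-k) * planeForm j a 1 c x x / 2) = 1
      obtain ⟨m, hm⟩ := Int.eq_ofNat_of_zero_le (a := j - k) (by omega)
      have e : 2 ^ (-k) * planeForm j a 1 c x x / 2 =
          ((2 ^ m * (a * (x.1 * x.1) + x.1 * x.2 + c * (x.2 * x.2)) : ℤ_[2]) : ℚ_[2]) := by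
        simp only [PadicInt.coe_mul, PadicInt.coe_pow, PadicInt.coe_add, coe_ofNat,
          planeForm_apply, PadicInt.coe_one]
        have : j = m + k := by omega
        rw [this, zpow_add₀ two_ne_zero, zpow_neg, zpow_natCast]
        field_simp
        ring
      rw [e, psi_intCast]
    rw [Block.phase_plane, if_neg (by omega)]
    unfold planeCls
    split_ifs
    · exact key 1 1
    · exact key 0 0
  · have hone : ∀ {u : ZMod 8} (_ : IsOdd u),
        (oneCls j u).Phase k (u + (if Odd (k - j) ∧ legendre u = -1 then 4 else 0)) :=
      fun {u} hu => by
        have := oneCls_phase h.ne hu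
        rw [Block.phase_one] at this
        rwa [if_pos h] at this
    have hex : ∃ p, (planeCls j ε).Phase k p := by
      unfold planeCls
      split_ifs
      · exact exists_planeForm_phase h 1 1
      · exact exists_planeForm_phase h 0 0
    obtain ⟨p, hp⟩ := hex
    have h1 : IsOdd 1 := by decide
    have h3 : IsOdd 3 := by decide
    have h7 : IsOdd (-1) := by decide
    have e1 : legendre 1 = 1 := by unfold legendre; decide
    have e3 : legendre 3 = -1 := by unfold legendre; decide
    have e7 : legendre (-1) = 1 := by unfold legendre; decide
    have e11 : ((1 : ℤˣ) = -1) = False := by simp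
    suffices hs : p = (Block.plane j ε).phase k from hs ▸ hp
    rw [Block.phase_plane]
    cases ε with
    | false =>
      have := (oneCls_add_planeCls_false j h1 ▸ (hone h1).add hp).unique
        ((hone h1).add ((hone h1).add (hone h7)))
      simp only [e1, e7, e11, and_false, if_false, add_zero] at this
      simpa using this
    | true =>
      have h31 : (3 * 3 : ZMod 8) = 1 := by decide
      have := (oneCls_add_planeCls_true j h3 ▸ (hone (u := 3 * 3) (by decide)).add hp).unique
        ((hone h3).add ((hone h3).add (hone h3)))
      rw [h31] at this
      simp only [e1, e3, e11, and_false, if_false, add_zero, and_true] at this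
      simp only [h, true_and, and_true]
      by_cases ho : Odd (k - j)
      · simp only [ho, if_true] at this ⊢
        clear hp
        revert this p
        decide
      · simp only [ho, if_false] at this ⊢
        clear hp
        revert this p
        decide

theorem Block.cls_phase {b : Block} (hb : b.Proper) {k : ℤ} (h : ∀ u, b ≠ .one k u) :
    b.cls.Phase k (b.phase k) := by
  cases b with
  | one j u => exact oneCls_phase (by rintro rfl; exact h u rfl) hb
  | plane j ε => exact planeCls_phase j k ε

/-! ### Unimodular lattices are sums of blocks -/

section Fine

variable {M : Type*} [AddCommGroup M] [Module ℤ_[2] M] {P : Type*} [AddCommGroup P]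
  [Module ℤ_[2] P]

/-- The form `b` multiplied by `2 ^ j`. -/
def scaledForm (j : ℤ) (b : M →ₗ[ℤ_[2]] M →ₗ[ℤ_[2]] ℤ_[2]) : M →ₗ[ℤ_[2]] M →ₗ[ℤ_[2]] ℚ_[2] :=
  LinearMap.mk₂ ℤ_[2] (fun x y => 2 ^ j * (b x y : ℚ_[2]))
    (fun x x' y => by simp only [map_add, LinearMap.add_apply, PadicInt.coe_add]; ring)
    (fun c x y => by
      simp only [map_smul, LinearMap.smul_apply, smul_eq_mul, smul_eq_coe_mul, PadicInt.coe_mul]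
      ring)
    (fun x y y' => by simp only [map_add, PadicInt.coe_add]; ring)
    (fun c x y => by
      simp only [map_smul, smul_eq_mul, smul_eq_coe_mul, PadicInt.coe_mul]
      ring)

theorem scaledForm_apply (j : ℤ) (b : M →ₗ[ℤ_[2]] M →ₗ[ℤ_[2]] ℤ_[2]) (x y : M) :
    scaledForm j b x y = 2 ^ j * (b x y : ℚ_[2]) := rfl

/-- The orthogonal complement of the image of `φ`. -/
def orthCompl (b : M →ₗ[ℤ_[2]] M →ₗ[ℤ_[2]] ℤ_[2]) (φ : P →ₗ[ℤ_[2]] M) : Submodule ℤ_[2] M :=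
  LinearMap.ker (b.comp φ).flip

theorem mem_orthCompl {b : M →ₗ[ℤ_[2]] M →ₗ[ℤ_[2]] ℤ_[2]} {φ : P →ₗ[ℤ_[2]] M} {m : M} :
    m ∈ orthCompl b φ ↔ ∀ p, b (φ p) m = 0 := by
  unfold orthCompl
  rw [LinearMap.mem_ker, LinearMap.ext_iff]
  rfl

/-! ### Splitting off a nondegenerate sublattice -/

section Split

variable {b : M →ₗ[ℤ_[2]] M →ₗ[ℤ_[2]] ℤ_[2]} {φ : P →ₗ[ℤ_[2]] M} {π : M →ₗ[ℤ_[2]] P}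

/-- The hypothesis `h` says that `φ ∘ π` is the orthogonal projection to the image of `φ`, and `h'`
that the form is nondegenerate there. -/
theorem bijective_add_orthCompl (h : ∀ p m, b (φ p) (m - φ (π m)) = 0)
    (h' : ∀ p, (∀ q, b (φ q) (φ p) = 0) → p = 0) :
    Function.Bijective fun x : P × orthCompl b φ => φ x.1 + (x.2 : M) := by
  constructor
  · rintro ⟨p, n⟩ ⟨p', n'⟩ hp
    simp only at hp
    have e : p - p' = 0 := h' _ fun q => by
      have : φ (p - p') = n' - n := by
        rw [map_sub, sub_eq_sub_iff_add_eq_add, hp, add_comm]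
      rw [this, map_sub, mem_orthCompl.1 n.2, mem_orthCompl.1 n'.2, sub_zero]
    rw [sub_eq_zero] at e
    subst e
    exact Prod.ext rfl (Subtype.ext (add_left_cancel hp))
  · intro m
    exact ⟨(π m, ⟨m - φ (π m), mem_orthCompl.2 fun p => h p m⟩), add_sub_cancel _ _⟩

theorem bijective_orthCompl (hb : ∀ x y, b x y = b y x) (hbij : Function.Bijective b)
    (h : ∀ p m, b (φ p) (m - φ (π m)) = 0) (h' : ∀ p, (∀ q, b (φ q) (φ p) = 0) → p = 0) :
    Function.Bijective (b.domRestrict₁₂ (orthCompl b φ) (orthCompl b φ)) := by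
  have hsurj := (bijective_add_orthCompl h h').2
  constructor
  · rw [injective_iff_map_eq_zero]
    intro n hn
    have : b (n : M) = 0 := by
      ext m
      obtain ⟨⟨p, n'⟩, rfl⟩ := hsurj m
      have := LinearMap.congr_fun hn n'
      rw [LinearMap.domRestrict₁₂_apply] at this
      simp only [map_add]
      rw [this, hb, mem_orthCompl.1 n.2]
      simp
    exact Subtype.ext ((injective_iff_map_eq_zero b).1 hbij.1 _ this)
  · intro f
    let ρ : M →ₗ[ℤ_[2]] orthCompl b φ :=
      (LinearMap.id - φ.comp π).codRestrict _ fun m => mem_orthCompl.2 fun p => h p m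
    have hρ : ∀ m, (ρ m : M) = m - φ (π m) := fun _ => rfl
    obtain ⟨m, hm⟩ := hbij.2 (f.comp ρ)
    have hρφ : ∀ p, ρ (φ p) = 0 := fun p => by
      have hq : π (φ p) = p := by
        refine (sub_eq_zero.1 (h' _ fun q => ?_)).symm
        rw [map_sub]
        exact h q (φ p)
      apply Subtype.ext
      rw [hρ, hq, sub_self]; rfl
    have hmem : m ∈ orthCompl b φ := mem_orthCompl.2 fun p => by
      rw [hb, hm, LinearMap.comp_apply, hρφ, map_zero]
    refine ⟨⟨m, hmem⟩, ?_⟩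
    ext n
    rw [LinearMap.domRestrict₁₂_apply]
    simp only
    rw [hm, LinearMap.comp_apply]
    congr 1
    apply Subtype.ext
    rw [hρ]
    have hq : π (n : M) = 0 := h' _ fun q => by
      have := h q n
      rw [map_sub, mem_orthCompl.1 n.2, zero_sub, neg_eq_zero] at this
      exact this
    rw [hq, map_zero, sub_zero]

theorem rep_add_orthCompl (hb : ∀ x y, b x y = b y x)
    (h : ∀ p m, b (φ p) (m - φ (π m)) = 0) (h' : ∀ p, (∀ q, b (φ q) (φ p) = 0) → p = 0)
    (j : ℤ) {B' : P →ₗ[ℤ_[2]] P →ₗ[ℤ_[2]] ℚ_[2]} {c c' : LatClass} (hc : Rep B' c)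
    (hB' : ∀ x y, B' x y = 2 ^ j * (b (φ x) (φ y) : ℚ_[2]))
    (hc' : Rep (scaledForm j (b.domRestrict₁₂ (orthCompl b φ) (orthCompl b φ))) c') :
    Rep (scaledForm j b) (c + c') := by
  refine hc.add hc' φ (orthCompl b φ).subtype (bijective_add_orthCompl h h')
    (fun x y => ?_) (fun x y => rfl) (fun x y => ?_) (fun x y => ?_)
  · rw [hB']; rfl
  · rw [scaledForm_apply, Submodule.subtype_apply, mem_orthCompl.1 y.2]; simp
  · rw [scaledForm_apply, hb, Submodule.subtype_apply, mem_orthCompl.1 x.2]; simp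

theorem finrank_add_orthCompl [Module.Free ℤ_[2] M] [Module.Finite ℤ_[2] M] [Module.Free ℤ_[2] P]
    [Module.Finite ℤ_[2] P]
    (h : ∀ p m, b (φ p) (m - φ (π m)) = 0) (h' : ∀ p, (∀ q, b (φ q) (φ p) = 0) → p = 0) :
    Module.finrank ℤ_[2] P + Module.finrank ℤ_[2] (orthCompl b φ) = Module.finrank ℤ_[2] M := by
  rw [← Module.finrank_prod]
  exact (LinearEquiv.ofBijective (φ.coprod (orthCompl b φ).subtype)
    (bijective_add_orthCompl h h')).finrank_eq

end Split

theorem rep_formCls {N : Type} [AddCommGroup N] [Module ℤ_[2] N]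
    (Q : N →ₗ[ℤ_[2]] N →ₗ[ℤ_[2]] ℚ_[2]) : Rep Q (formCls Q) := ⟨_, rfl, Isometric.refl Q⟩

/-- The sum of the classes of rank one forms and even planes of the same scale. -/
def blockSum (j : ℤ) (us : Multiset (ZMod 8)) (es : Multiset Bool) : LatClass :=
  (us.map (oneCls j)).sum + (es.map (planeCls j)).sum

/-- A vector of odd norm spans a unimodular line, which splits off. If all norms are even, a basis
vector x has, by unimodularity, a partner y with b(x,y) = 1. These two span an even plane of unit
determinant, which splits off. -/
theorem exists_rep_blockSum (j : ℤ) (n : ℕ) :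
    ∀ (M : Type*) [AddCommGroup M] [Module ℤ_[2] M] [Module.Free ℤ_[2] M] [Module.Finite ℤ_[2] M]
      (b : M →ₗ[ℤ_[2]] M →ₗ[ℤ_[2]] ℤ_[2]), (∀ x y, b x y = b y x) → Function.Bijective b →
      Module.finrank ℤ_[2] M = n →
      ∃ us es, Rep (scaledForm j b) (blockSum j us es) ∧ (∀ u ∈ us, IsOdd u) ∧
        us.card + 2 * es.card = n ∧ (us = 0 ↔ ∀ x, 2 ∣ b x x) := by
  induction n using Nat.strong_induction_on with
  | _ n ih =>
  intro M _ _ _ _ b hb hbij hn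
  by_cases heven : ∀ x, 2 ∣ b x x
  · rcases Nat.eq_zero_or_pos n with rfl | hpos
    · have : Subsingleton M := Module.finrank_zero_iff.1 hn
      refine ⟨0, 0, ?_, by simp, by simp, by simp [heven]⟩
      unfold blockSum
      simpa using rep_zero
    · let v := Module.finBasis ℤ_[2] M
      let i : Fin (Module.finrank ℤ_[2] M) := ⟨0, by omega⟩
      obtain ⟨y, hy⟩ := hbij.2 (v.coord i)
      have hyx : b y (v i) = 1 := by rw [hy]; simp
      generalize v i = x at hyx
      have hxy : b x y = 1 := by rw [hb, hyx]
      obtain ⟨a, ha⟩ := heven x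
      obtain ⟨c, hc⟩ := heven y
      have hu : IsUnit (1 + 2 * (-2 * a * c)) := isUnit_add_of_two_dvd isUnit_one ⟨_, rfl⟩
      obtain ⟨d, -, hd⟩ := exists_left_inv_of_isUnit hu
      let φ : (ℤ_[2] × ℤ_[2]) →ₗ[ℤ_[2]] M :=
        (LinearMap.toSpanSingleton ℤ_[2] M x).coprod (LinearMap.toSpanSingleton ℤ_[2] M y)
      have hφ : ∀ p, φ p = p.1 • x + p.2 • y := fun _ => rfl
      let π : M →ₗ[ℤ_[2]] (ℤ_[2] × ℤ_[2]) := LinearMap.prod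
        (d • b y - (2 * c * d) • b x) (d • b x - (2 * a * d) • b y)
      have hπ : ∀ m, π m = (d * b y m - 2 * c * d * b x m, d * b x m - 2 * a * d * b y m) :=
        fun _ => rfl
      have h : ∀ p m, b (φ p) (m - φ (π m)) = 0 := fun p m => by
        rw [hφ, hφ, hπ]
        simp only [map_add, map_sub, map_smul, LinearMap.add_apply, LinearMap.smul_apply,
          smul_eq_mul, ha, hc, hxy, hyx]
        linear_combination (-(p.1 * b x m) - p.2 * b y m) * hd
      have h' : ∀ p, (∀ q, b (φ q) (φ p) = 0) → p = 0 := fun p hp => by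
        have h1 := hp (1, 0)
        have h2 := hp (0, 1)
        simp only [hφ, map_add, map_smul, LinearMap.add_apply, LinearMap.smul_apply,
          smul_eq_mul, ha, hc, hxy, hyx] at h1 h2
        ext
        · change p.1 = 0
          linear_combination d * (h2 - 2 * c * h1) - p.1 * hd
        · change p.2 = 0
          linear_combination d * (h1 - 2 * a * h2) - p.2 * hd
      have hrank := finrank_add_orthCompl h h'
      rw [Module.finrank_prod, Module.finrank_self, hn] at hrank
      obtain ⟨us, es, hrep, -, hcard, hus⟩ := ih _ (by omega) (orthCompl b φ)
        (b.domRestrict₁₂ _ _) (fun x y => hb x y) (bijective_orthCompl hb hbij h h') rfl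
      have hus0 : us = 0 := hus.2 fun x => heven x
      subst hus0
      obtain ⟨ε, hε⟩ : ∃ ε, formCls (planeForm j a 1 c) = planeCls j ε := by
        rcases two_dvd_or_isUnit a with h2 | h2
        · exact ⟨_, plane_cls_of_two_dvd_left j c isUnit_one h2⟩
        · rcases two_dvd_or_isUnit c with h3 | h3
          · exact ⟨_, plane_cls_of_two_dvd_right j a isUnit_one h3⟩
          · exact ⟨_, plane_cls_of_isUnit j h2 isUnit_one h3⟩
      have key := rep_add_orthCompl hb h h' j (rep_formCls (planeForm j a 1 c)) (fun p q => by
        rw [planeForm_apply, hφ, hφ]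
        simp only [map_add, map_smul, LinearMap.add_apply, LinearMap.smul_apply,
          smul_eq_mul, ha, hc, hxy, hyx, PadicInt.coe_add, PadicInt.coe_mul, PadicInt.coe_one,
          coe_ofNat]
        ring) hrep
      refine ⟨0, ε ::ₘ es, ?_, by simp, ?_, by simp [heven]⟩
      · rw [hε] at key
        convert key using 1
        simp [blockSum]
      · rw [Multiset.card_cons]
        rw [Multiset.card_zero] at hcard ⊢
        omega
  · push Not at heven
    obtain ⟨x, hx⟩ := heven
    have hxu := (two_dvd_or_isUnit (b x x)).resolve_left hx
    obtain ⟨r, -, hr⟩ := exists_left_inv_of_isUnit hxu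
    let φ : ℤ_[2] →ₗ[ℤ_[2]] M := LinearMap.toSpanSingleton ℤ_[2] M x
    have hφ : ∀ p, φ p = p • x := fun _ => rfl
    let π : M →ₗ[ℤ_[2]] ℤ_[2] := r • b x
    have hπ : ∀ m, π m = r * b x m := fun _ => rfl
    have h : ∀ p m, b (φ p) (m - φ (π m)) = 0 := fun p m => by
      rw [hφ, hφ, hπ]
      simp only [map_sub, map_smul, LinearMap.smul_apply, smul_eq_mul]
      linear_combination (-(p * b x m)) * hr
    have h' : ∀ p, (∀ q, b (φ q) (φ p) = 0) → p = 0 := fun p hp => by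
      have h1 := hp 1
      simp only [hφ, map_smul, LinearMap.smul_apply, smul_eq_mul] at h1
      linear_combination r * h1 - p * hr
    have hrank := finrank_add_orthCompl h h'
    rw [Module.finrank_self, hn] at hrank
    obtain ⟨us, es, hrep, hodd, hcard, -⟩ := ih _ (by omega) (orthCompl b φ)
      (b.domRestrict₁₂ _ _) (fun x y => hb x y) (bijective_orthCompl hb hbij h h') rfl
    have key := rep_add_orthCompl hb h h' j
      (rep_formCls (rankOneForm (2 ^ j * ((b x x : ℤ_[2]) : ℚ_[2])))) (fun p q => by
        rw [rankOneForm_apply, hφ, hφ]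
        simp only [map_smul, LinearMap.smul_apply, smul_eq_mul, PadicInt.coe_mul]
        ring) hrep
    refine ⟨mod8 (b x x) ::ₘ us, es, ?_, ?_, ?_, ?_⟩
    · rw [rankOne_cls_eq j hxu] at key
      convert key using 1
      simp [blockSum, add_assoc]
    · intro u hu
      rcases Multiset.mem_cons.1 hu with rfl | hu
      · exact (isOdd_iff_isUnit_mod8 _).2 hxu
      · exact hodd u hu
    · rw [Multiset.card_cons]
      omega
    · simp only [Multiset.cons_ne_zero, false_iff]
      exact fun h => hx (h x)

/-- One rank one block absorbs the planes one after another, each time becoming three rank one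
blocks. -/
theorem exists_blockSum_eq_ones (j : ℤ) (us : Multiset (ZMod 8)) (es : Multiset Bool)
    (hus : us ≠ 0) (hodd : ∀ u ∈ us, IsOdd u) :
    ∃ us', blockSum j us es = blockSum j us' 0 ∧ (∀ u ∈ us', IsOdd u) ∧
      us'.card = us.card + 2 * es.card := by
  induction es using Multiset.induction_on generalizing us with
  | empty => exact ⟨us, rfl, hodd, by simp⟩
  | cons ε es ih =>
    obtain ⟨u, hu⟩ := Multiset.exists_mem_of_ne_zero hus
    obtain ⟨us, rfl⟩ := Multiset.exists_cons_of_mem hu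
    have huo := hodd u hu
    have key : ∃ u₁ u₂ u₃, IsOdd u₁ ∧ IsOdd u₂ ∧ IsOdd u₃ ∧
        oneCls j u + planeCls j ε = oneCls j u₁ + (oneCls j u₂ + oneCls j u₃) := by
      cases ε with
      | false =>
        exact ⟨u, u, -u, huo, huo, by clear hu hodd hus; revert u; decide,
          oneCls_add_planeCls_false j huo⟩
      | true =>
        have h3 : IsOdd (3 * u) := by clear hu hodd hus; revert u; decide
        have e : 3 * (3 * u) = u := by clear hu hodd hus; revert u; decide
        refine ⟨3 * u, 3 * u, 3 * u, h3, h3, h3, ?_⟩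
        rw [← oneCls_add_planeCls_true j h3, e]
    obtain ⟨u₁, u₂, u₃, h₁, h₂, h₃, e⟩ := key
    obtain ⟨us', he, hus', hcard⟩ := ih (u₁ ::ₘ u₂ ::ₘ u₃ ::ₘ us) (Multiset.cons_ne_zero)
      (by
        intro v hv
        simp only [Multiset.mem_cons] at hv
        rcases hv with rfl | rfl | rfl | hv
        · exact h₁
        · exact h₂
        · exact h₃
        · exact hodd v (Multiset.mem_cons_of_mem hv))
    refine ⟨us', ?_, hus', ?_⟩
    · rw [← he]
      simp only [blockSum, Multiset.map_cons, Multiset.sum_cons]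
      calc _ = (oneCls j u + planeCls j ε) + (us.map (oneCls j)).sum + (es.map (planeCls j)).sum := by
            abel
        _ = _ := by rw [e]; abel
    · rw [hcard]
      simp only [Multiset.card_cons]
      ring

end Fine

/-! ### Constituents of a Jordan decomposition -/

/-- The contribution of a unimodular lattice of oddity `o` and sign `s`, scaled by `2 ^ j`, to the
phase at the scale `2 ^ k`. -/
def termPhase (k j : ℤ) (o : ZMod 8) (s : ℤˣ) : ZMod 8 :=
  if j < k then o + (if Odd (k - j) ∧ s = -1 then 4 else 0) else 0

theorem Block.phase_one_eq (j k : ℤ) (u : ZMod 8) :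
    (Block.one j u).phase k = termPhase k j u (legendre u) := by
  rw [Block.phase_one]
  unfold termPhase
  split_ifs <;> rfl

section Constituent

variable {L : Type*} [AddCommGroup L] [Module ℤ_[2] L] {B : L →ₗ[ℤ_[2]] L →ₗ[ℤ_[2]] ℚ_[2]}

theorem rescale_symm (hB : ∀ x y, B x y = B y x) (N : Submodule ℤ_[2] L) (i : ℤ) (x y : N) :
    rescale B N i x y = rescale B N i y x := by
  rw [rescale_apply, rescale_apply, hB]

theorem formPhase_zero_of_rescale {N : Submodule ℤ_[2] L} {j : ℤ}
    (hN : IsUnimodular (rescale B N j)) {k : ℤ} (hk : k < j ∨ k = j ∧ IsEven (rescale B N j)) :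
    FormPhase (B.domRestrict₁₂ N N) k 0 := by
  obtain ⟨b, hb, -⟩ := hN
  refine hasPhase_one fun x => ?_
  have key : ∃ z : ℤ_[2], 2 ^ (-k) * B x x / 2 = (z : ℚ_[2]) := by
    rcases hk with hk | ⟨rfl, hk⟩
    · obtain ⟨m, hm⟩ := Int.eq_ofNat_of_zero_le (a := j - k - 1) (by omega)
      refine ⟨2 ^ m * b x x, ?_⟩
      rw [form_eq_rescale N j, ← hb, PadicInt.coe_mul, PadicInt.coe_pow, coe_ofNat]
      have : j = m + k + 1 := by omega
      rw [this, zpow_add_one₀ two_ne_zero, zpow_add₀ two_ne_zero, zpow_neg, zpow_natCast]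
      field_simp
    · obtain ⟨z, hz⟩ := hk x
      refine ⟨z, ?_⟩
      rw [form_eq_rescale N k, hz, zpow_neg]
      field_simp
  obtain ⟨z, hz⟩ := key
  change psi (2 ^ (-k) * B x x / 2) = 1
  rw [hz, psi_intCast]

theorem formPhase_of_rescale [Module.Free ℤ_[2] L] [Module.Finite ℤ_[2] L]
    (hB : ∀ x y, B x y = B y x) {N : Submodule ℤ_[2] L} {j : ℤ}
    (hN : IsUnimodular (rescale B N j)) {k : ℤ} (hk : k ≠ j ∨ IsEven (rescale B N j)) :
    FormPhase (B.domRestrict₁₂ N N) k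
      (termPhase k j (latticeOddity (rescale B N j)) (latticeSign (rescale B N j))) := by
  unfold termPhase
  by_cases h : j < k
  · rw [if_pos h]
    obtain ⟨m, hm⟩ := Int.eq_ofNat_of_zero_le (a := k - j) (by omega)
    have := hN.formPhase (rescale_symm hB N j) (m := m) (by omega)
    have ho : Odd (k - j) ↔ Odd m := by rw [hm]; exact Int.odd_coe_nat m
    simp only [ho]
    unfold FormPhase at this ⊢
    convert this using 3 with x
    change 2 ^ (-k) * B x x / 2 = _
    rw [form_eq_rescale N j x x]
    have : k = m + j := by omega
    rw [this, neg_add, zpow_add₀ two_ne_zero, zpow_neg 2 j]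
    field_simp
  · rw [if_neg h]
    refine formPhase_zero_of_rescale hN ?_
    rcases hk with hk | hk
    · left; omega
    · rcases lt_or_eq_of_le (not_lt.1 h) with h | h
      · exact Or.inl h
      · exact Or.inr ⟨h, hk⟩

theorem exists_blockSum_of_rescale [Module.Free ℤ_[2] L] [Module.Finite ℤ_[2] L]
    (hB : ∀ x y, B x y = B y x) {N : Submodule ℤ_[2] L} {j : ℤ}
    (hN : IsUnimodular (rescale B N j)) :
    ∃ us es, Rep (B.domRestrict₁₂ N N) (blockSum j us es) ∧ (∀ u ∈ us, IsOdd u) ∧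
      us.card + 2 * es.card = Module.finrank ℤ_[2] N ∧
      (IsEven (rescale B N j) → us = 0) ∧ (¬ IsEven (rescale B N j) → us ≠ 0 ∧ es = 0) := by
  obtain ⟨b, hb, hbij⟩ := hN
  have hsymm : ∀ x y, b x y = b y x := fun x y => by
    have : ((b x y : ℤ_[2]) : ℚ_[2]) = (b y x : ℤ_[2]) := by
      rw [hb, hb, rescale_symm hB]
    exact Subtype.ext this
  have hform : B.domRestrict₁₂ N N = scaledForm j b := by
    ext x y
    rw [scaledForm_apply, hb, LinearMap.domRestrict₁₂_apply]
    exact form_eq_rescale N j x y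
  have heven : (∀ x, 2 ∣ b x x) ↔ IsEven (rescale B N j) := by
    refine forall_congr' fun x => exists_congr fun z => ?_
    rw [← hb, ← coe_ofNat, ← PadicInt.coe_mul]
    exact ⟨congrArg _, fun h => Subtype.ext h⟩
  rw [hform]
  obtain ⟨us, es, h1, h2, h3, h4⟩ := exists_rep_blockSum j _ N b hsymm hbij rfl
  rw [heven] at h4
  by_cases h : IsEven (rescale B N j)
  · exact ⟨us, es, h1, h2, h3, h4.2, fun h' => absurd h h'⟩
  · obtain ⟨us', h5, h6, h7⟩ := exists_blockSum_eq_ones j us es (fun h' => h (h4.1 h')) h2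
    refine ⟨us', 0, h5 ▸ h1, h6, by simp [h7, h3], fun h' => absurd h' h, fun _ => ⟨?_, rfl⟩⟩
    rintro rfl
    have : us.card = 0 := by
      rw [Multiset.card_zero] at h7; omega
    exact h (h4.1 (Multiset.card_eq_zero.1 this))

theorem phase_blockSum (j k : ℤ) (us : Multiset (ZMod 8)) (es : Multiset Bool)
    (hodd : ∀ u ∈ us, IsOdd u) (hk : k ≠ j ∨ us = 0) : (blockSum j us es).Phase k
      ((us.map fun u => (Block.one j u).phase k).sum +
        (es.map fun ε => (Block.plane j ε).phase k).sum) := by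
  refine LatClass.Phase.add ?_ ?_
  · rcases hk with hk | rfl
    · induction us using Multiset.induction_on with
      | empty => simpa using LatClass.Phase.zero k
      | cons u us ih =>
        simp only [Multiset.map_cons, Multiset.sum_cons]
        exact (oneCls_phase hk.symm (hodd u (Multiset.mem_cons_self _ _))).add
          (ih fun v hv => hodd v (Multiset.mem_cons_of_mem hv))
    · simpa using LatClass.Phase.zero k
  · induction es using Multiset.induction_on with
    | empty => simpa using LatClass.Phase.zero k
    | cons u us ih =>
      simp only [Multiset.map_cons, Multiset.sum_cons]
      exact (planeCls_phase j k u).add ih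

variable [Module.Free ℤ_[2] L] [Module.Finite ℤ_[2] L] {N : Submodule ℤ_[2] L} {j : ℤ}

/-- The oddity is defined by an arbitrary diagonalization. Signs do not enter the phase at scale
2^(j+2), so the oddity can be read off there, and planes contribute 0 to it. -/
theorem latticeOddity_eq_zero_of_isEven (hB : ∀ x y, B x y = B y x)
    (hN : IsUnimodular (rescale B N j)) (h : IsEven (rescale B N j)) :
    latticeOddity (rescale B N j) = 0 := by
  obtain ⟨us, es, h1, h2, -, h4, -⟩ := exists_blockSum_of_rescale hB hN
  obtain rfl := h4 h
  have h5 := (h1.phase (formPhase_of_rescale hB hN (k := j + 2) (Or.inr h))).unique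
    (phase_blockSum j (j + 2) 0 es h2 (Or.inr rfl))
  have hodd : ¬ Odd (j + 2 - j) := by rw [add_sub_cancel_left]; decide
  unfold termPhase at h5
  rw [if_pos (by omega), if_neg (fun h => hodd h.1), add_zero] at h5
  rw [h5]
  simp only [Block.phase_plane, hodd, false_and, and_false, if_false]
  simp

theorem latticeSign_eq_one_of_finrank (hB : ∀ x y, B x y = B y x)
    (hN : IsUnimodular (rescale B N j)) (h : Module.finrank ℤ_[2] N = 0) :
    latticeSign (rescale B N j) = 1 ∧ IsEven (rescale B N j) := by
  obtain ⟨us, es, h1, h2, h3, -, h5⟩ := exists_blockSum_of_rescale hB hN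
  rw [h] at h3
  have hus : us = 0 := Multiset.card_eq_zero.1 (by omega)
  have hes : es = 0 := Multiset.card_eq_zero.1 (by omega)
  have heven : IsEven (rescale B N j) := by
    by_contra h'
    exact (h5 h').1 hus
  refine ⟨?_, heven⟩
  subst hus hes
  have h6 := (h1.phase (formPhase_of_rescale hB hN (k := j + 1) (Or.inr heven))).unique
    (phase_blockSum j (j + 1) 0 0 h2 (Or.inr rfl))
  have hodd : Odd (j + 1 - j) := by rw [add_sub_cancel_left]; decide
  unfold termPhase at h6
  rw [if_pos (by omega), latticeOddity_eq_zero_of_isEven hB hN heven] at h6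
  simp only [hodd, true_and, Multiset.map_zero, Multiset.sum_zero, zero_add, add_zero] at h6
  rcases Int.units_eq_one_or (latticeSign (rescale B N j)) with h7 | h7
  · exact h7
  · rw [if_pos h7] at h6
    exact absurd h6 (by decide)

/-- The phase at scale 2^(j+2) gives the oddity. Comparison with the phase at scale 2^(j+1) then
gives the sign. -/
theorem latticeSign_eq_of_finrank_eq_one (hB : ∀ x y, B x y = B y x)
    (hN : IsUnimodular (rescale B N j)) (h : Module.finrank ℤ_[2] N = 1)
    (hodd : ¬ IsEven (rescale B N j)) : IsOdd (latticeOddity (rescale B N j)) ∧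
      latticeSign (rescale B N j) = legendre (latticeOddity (rescale B N j)) := by
  obtain ⟨us, es, h1, h2, h3, -, h5⟩ := exists_blockSum_of_rescale hB hN
  obtain ⟨-, rfl⟩ := h5 hodd
  rw [h, Multiset.card_zero, mul_zero, add_zero, Multiset.card_eq_one] at h3
  obtain ⟨u, rfl⟩ := h3
  have h6 := (h1.phase (formPhase_of_rescale hB hN (k := j + 1) (Or.inl (by omega)))).unique
    (phase_blockSum j (j + 1) {u} 0 h2 (Or.inl (by omega)))
  have h7 := (h1.phase (formPhase_of_rescale hB hN (k := j + 2) (Or.inl (by omega)))).unique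
    (phase_blockSum j (j + 2) {u} 0 h2 (Or.inl (by omega)))
  have hodd1 : Odd (j + 1 - j) := by rw [add_sub_cancel_left]; decide
  have hodd2 : ¬ Odd (j + 2 - j) := by rw [add_sub_cancel_left]; decide
  have hu := h2 u (Multiset.mem_singleton_self u)
  simp only [Multiset.map_singleton, Multiset.sum_singleton, Block.phase_one_eq,
    Multiset.map_zero, Multiset.sum_zero, add_zero, termPhase, hodd1, hodd2, false_and,
    true_and, if_false, show j < j + 1 by omega, show j < j + 2 by omega, if_true] at h6 h7
  rw [h7] at h6 ⊢
  refine ⟨hu, ?_⟩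
  have h8 := add_left_cancel h6
  rcases Int.units_eq_one_or (latticeSign (rescale B N j)) with h9 | h9 <;>
    rcases Int.units_eq_one_or (legendre u) with h10 | h10 <;>
    rw [h9, h10] at h8 ⊢
  · exact absurd h8 (by decide)
  · exact absurd h8 (by decide)

end Constituent

/-! ### Compartments -/

section Compartment

variable {T : ℤ → Prop} {i j : ℤ}

theorem self_mem_compartment (h : T i) : i ∈ compartment T i := by
  intro k hk
  rw [Set.uIcc_self, Set.mem_singleton_iff] at hk
  exact hk ▸ h

theorem mem_compartment_comm : j ∈ compartment T i ↔ i ∈ compartment T j := by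
  unfold compartment
  rw [Set.mem_ofPred_eq, Set.mem_ofPred_eq, Set.uIcc_comm]

theorem left_of_mem_compartment (h : j ∈ compartment T i) : T i := h i Set.left_mem_uIcc

theorem right_of_mem_compartment (h : j ∈ compartment T i) : T j := h j Set.right_mem_uIcc

theorem mem_compartment_trans {k : ℤ} (h : j ∈ compartment T i) (h' : k ∈ compartment T j) :
    k ∈ compartment T i := fun _ hl =>
  (Set.uIcc_subset_uIcc_union_uIcc hl).elim (h _) (h' _)

theorem succ_mem_compartment (h : T i) (h' : T (i + 1)) : i + 1 ∈ compartment T i := by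
  intro k hk
  rw [Set.mem_uIcc] at hk
  obtain rfl | rfl : k = i ∨ k = i + 1 := by omega
  · exact h
  · exact h'

theorem pred_mem_compartment (h : T i) (h' : T (i - 1)) : i - 1 ∈ compartment T i := by
  intro k hk
  rw [Set.mem_uIcc] at hk
  obtain rfl | rfl : k = i ∨ k = i - 1 := by omega
  · exact h
  · exact h'

theorem not_mem_compartment_of_gap (h : ¬ T (i + 1)) (hj : i + 2 = j) : j ∉ compartment T i :=
  fun hm => h (hm _ (by rw [Set.mem_uIcc]; omega))

theorem compartment_eq_pair (h : T i) (h' : T (i + 1)) (hl : ¬ T (i - 1)) (hr : ¬ T (i + 2)) :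
    compartment T i = {i, i + 1} := by
  ext l
  rw [Set.mem_insert_iff, Set.mem_singleton_iff]
  constructor
  · intro hm
    by_contra hne
    rcases lt_or_ge l i with hlt | hge
    · exact hl (hm _ (by rw [Set.mem_uIcc]; omega))
    · exact hr (hm _ (by rw [Set.mem_uIcc]; omega))
  · rintro (rfl | rfl)
    · exact self_mem_compartment h
    · exact succ_mem_compartment h h'

end Compartment

namespace Symbol

/-! ### Legal symbols and their phases -/

open Classical in
/-- The properties of 2-adic symbols of lattices that matter here: `o` gives the oddities of the
terms, and all nontrivial terms have scales `2 ^ i` with `a ≤ i < b`. -/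
structure Legal (S : Symbol) (o : ℤ → ZMod 8) (a b : ℤ) : Prop where
  trivial : ∀ i, S.dim i = 0 → S.sign i = 1 ∧ ¬ S.typeI i
  support : ∀ i, i ∉ Finset.Ico a b → S.dim i = 0
  oddity_typeII : ∀ i, ¬ S.typeI i → o i = 0
  oddity_eq : ∀ i, S.oddity i =
    ∑ j ∈ Finset.Ico a b, if j ∈ compartment S.typeI i then o j else 0
  -- Such a compartment has oddity x + y with x, y odd. Unless this is ±2, it is 0 or 4 according to
  -- whether the signs of x and y agree. Walking between the two terms would then destroy this
  -- relation, which is why condition 2 excludes it.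
  bad : ∀ i, S.typeI i → S.typeI (i + 1) → ¬ S.typeI (i - 1) → ¬ S.typeI (i + 2) → S.dim i = 1 →
    S.dim (i + 1) = 1 → S.oddity i = 2 ∨ S.oddity i = -2 ∨
      S.oddity i = if S.sign i = S.sign (i + 1) then 0 else 4

/-- The phase of the Gauss mean at the scale `2 ^ k`, as read off the symbol. -/
def phase (S : Symbol) (o : ℤ → ZMod 8) (a b k : ℤ) : ZMod 8 :=
  ∑ j ∈ Finset.Ico a b, termPhase k j (o j) (S.sign j)

variable {S S' : Symbol} {o o' : ℤ → ZMod 8} {a b : ℤ}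

theorem Legal.mem_Ico (h : S.Legal o a b) {i : ℤ} (hi : S.dim i ≠ 0) : i ∈ Finset.Ico a b := by
  by_contra hn
  exact hi (h.support i hn)

theorem Legal.dim_ne_zero (h : S.Legal o a b) {i : ℤ} (hi : S.typeI i) : S.dim i ≠ 0 :=
  fun h0 => (h.trivial i h0).2 hi

theorem termPhase_neg_sign (k j : ℤ) (x : ZMod 8) (s : ℤˣ) :
    termPhase k j x (-s) = termPhase k j x s + if j < k ∧ Odd (k - j) then 4 else 0 := by
  have h8 : (4 + 4 : ZMod 8) = 0 := by decide
  unfold termPhase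
  by_cases h : j < k <;> by_cases ho : Odd (k - j) <;> rcases Int.units_eq_one_or s with rfl | rfl <;>
    simp [h, ho, add_assoc, h8]

theorem termPhase_add (k j : ℤ) (x y : ZMod 8) (s : ℤˣ) :
    termPhase k j (x + y) s = termPhase k j x s + if j < k then y else 0 := by
  unfold termPhase
  by_cases h : j < k <;> simp only [h, if_true, if_false] <;> ring

theorem ite_add_four (x : ZMod 8) {s t : ℤˣ}
    (h : x = 2 ∨ x = -2 ∨ x = if s = t then 0 else 4) :
    x + 4 = 2 ∨ x + 4 = -2 ∨ x + 4 = if -s = t then 0 else 4 := by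
  rcases h with rfl | rfl | rfl
  · right; left; decide
  · left; decide
  · right; right
    rcases Int.units_eq_one_or s with rfl | rfl <;> rcases Int.units_eq_one_or t with rfl | rfl <;>
      decide

theorem ite_add_four_right (x : ZMod 8) {s t : ℤˣ}
    (h : x = 2 ∨ x = -2 ∨ x = if s = t then 0 else 4) :
    x + 4 = 2 ∨ x + 4 = -2 ∨ x + 4 = if s = -t then 0 else 4 := by
  simp only [eq_comm (a := s)] at h ⊢
  exact ite_add_four x h

theorem walk_dim (i j : ℤ) : (S.walk i j).dim = S.dim := rfl

theorem walk_typeI (i j : ℤ) : (S.walk i j).typeI = S.typeI := rfl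

theorem CanWalk.cases {i j : ℤ} (h : S.CanWalk i j) (hS : S.Legal o a b) :
    (j = i + 1 ∧ S.typeI i ∧ ¬ S.typeI j) ∨ (j = i + 1 ∧ ¬ S.typeI i ∧ S.typeI j) ∨
    (j = i + 1 ∧ S.typeI i ∧ S.typeI j) ∨
    (j = i + 2 ∧ S.typeI i ∧ S.typeI j ∧ ¬ S.typeI (i + 1)) := by
  obtain ⟨-, -, ⟨h1, h2 | h2⟩ | ⟨h1, h2, h3, -⟩ | ⟨h1, h2, h3, h4⟩⟩ := h
  · exact Or.inl ⟨h1, h2⟩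
  · exact Or.inr (Or.inl ⟨h1, h2⟩)
  · exact Or.inr (Or.inr (Or.inl ⟨h1, h2, h3⟩))
  · exact Or.inr (Or.inr (Or.inr ⟨h1, h2, h3, (hS.trivial _ h4).2⟩))

theorem CanWalk.lt {i j : ℤ} (h : S.CanWalk i j) : i < j := by
  obtain ⟨-, -, ⟨h1, -⟩ | ⟨h1, -⟩ | ⟨h1, -⟩⟩ := h <;> omega

open Classical in
/-- The oddities of the terms after a sign walk. -/
def walkOddity (S : Symbol) (o : ℤ → ZMod 8) (i j l : ℤ) : ZMod 8 :=
  o l + (if l = i ∧ S.typeI i then 4 else 0) +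
    (if l = j ∧ S.typeI j ∧ j ∉ compartment S.typeI i then 4 else 0)

/-- The symbol records only sums over compartments, so a change by 4 can be placed on a single term,
and only once when both walked terms share a compartment. -/
theorem Legal.walk_oddity_eq (h : S.Legal o a b) {i j : ℤ} (hi : i ∈ Finset.Ico a b)
    (hj : j ∈ Finset.Ico a b) (k : ℤ) : (S.walk i j).oddity k =
      open Classical in ∑ l ∈ Finset.Ico a b, if l ∈ compartment S.typeI k then
        S.walkOddity o i j l else 0 := by
  classical
  have e : ∀ l, (if l ∈ compartment S.typeI k then S.walkOddity o i j l else 0) =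
      (if l ∈ compartment S.typeI k then o l else 0) +
      (if l = i then (if i ∈ compartment S.typeI k then 4 else 0) else 0) +
      (if l = j then
        (if j ∈ compartment S.typeI k ∧ j ∉ compartment S.typeI i then 4 else 0) else 0) := by
    intro l
    have hti := fun hm : i ∈ compartment S.typeI k => right_of_mem_compartment hm
    have htj := fun hm : j ∈ compartment S.typeI k => right_of_mem_compartment hm
    unfold walkOddity
    by_cases hlk : l ∈ compartment S.typeI k
    · have hl := right_of_mem_compartment hlk
      by_cases h1 : l = i <;> by_cases h2 : l = j
      · subst h1; subst h2; simp [hlk, hl]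
      · subst h1; simp [hlk, hl, h2]
      · subst h2; simp [hlk, hl, h1]
      · simp [hlk, h1, h2]
    · by_cases h1 : l = i <;> by_cases h2 : l = j
      · subst h1; subst h2; simp [hlk]
      · subst h1; simp [hlk, h2]
      · subst h2; simp [hlk, h1]
      · simp [hlk, h1, h2]
  rw [Finset.sum_congr rfl fun l _ => e l, Finset.sum_add_distrib, Finset.sum_add_distrib,
    ← h.oddity_eq, Finset.sum_ite_eq', Finset.sum_ite_eq', if_pos hi, if_pos hj]
  unfold walk
  simp only [Set.mem_union]
  by_cases h1 : k ∈ compartment S.typeI i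
  · have h1' := mem_compartment_comm.1 h1
    by_cases h2 : j ∈ compartment S.typeI k
    · simp [h1, h1', mem_compartment_trans h1 h2]
    · simp [h1, h1', h2]
  · have h1' : i ∉ compartment S.typeI k := fun hm => h1 (mem_compartment_comm.1 hm)
    by_cases h2 : j ∈ compartment S.typeI k
    · have h3 : j ∉ compartment S.typeI i := fun hm =>
        h1 (mem_compartment_trans hm (mem_compartment_comm.1 h2))
      simp [h1, h1', h2, mem_compartment_comm.1 h2, h3]
    · have h3 : k ∉ compartment S.typeI j := fun hm => h2 (mem_compartment_comm.1 hm)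
      simp [h1, h1', h2, h3]

/-- Below k, each negated sign at odd distance and each changed oddity adds 4. For adjacent scales
below k exactly one distance is odd and exactly one oddity is changed. For scales differing by a
factor of 4, both contributions occur in pairs. The boundary cases also cancel because k has type
II. -/
theorem Legal.walk_phase_eq (h : S.Legal o a b) {i j : ℤ} (hw : S.CanWalk i j) {k : ℤ}
    (hk : ¬ S.typeI k) :
    (S.walk i j).phase (S.walkOddity o i j) a b k = S.phase o a b k := by
  classical
  have hi := h.mem_Ico hw.1
  have hj := h.mem_Ico hw.2.1
  have hij := hw.lt
  unfold phase
  have e : ∀ l, termPhase k l (S.walkOddity o i j l) ((S.walk i j).sign l) =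
      termPhase k l (o l) (S.sign l) +
      (if l = i then ((if i < k then (if S.typeI i then 4 else 0) else 0) +
        (if i < k ∧ Odd (k - i) then 4 else 0)) else 0) +
      (if l = j then
        ((if j < k then (if S.typeI j ∧ j ∉ compartment S.typeI i then 4 else 0) else 0) +
        (if j < k ∧ Odd (k - j) then 4 else 0)) else 0) := by
    intro l
    unfold walkOddity
    rw [termPhase_add, termPhase_add]
    unfold walk
    by_cases h1 : l = i
    · have h2 : l ≠ j := by omega
      subst h1
      simp only [true_or, if_true, true_and, termPhase_neg_sign, h2, false_and, if_false, ite_self,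
        add_zero]
      ring
    · by_cases h2 : l = j
      · subst h2
        simp only [or_true, if_true, true_and, termPhase_neg_sign, h1, false_and, if_false,
          ite_self, add_zero]
        ring
      · simp only [h1, h2, or_self, if_false, false_and, ite_self, add_zero]
  rw [Finset.sum_congr rfl fun l _ => e l, Finset.sum_add_distrib, Finset.sum_add_distrib,
    Finset.sum_ite_eq', Finset.sum_ite_eq', if_pos hi, if_pos hj]
  rw [add_assoc, add_eq_left]
  have h8 : (4 + 4 : ZMod 8) = 0 := by decide
  have hki := fun hi : S.typeI i => (show k ≠ i by rintro rfl; exact hk hi)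
  have hkj := fun hj : S.typeI j => (show k ≠ j by rintro rfl; exact hk hj)
  rcases hw.cases h with ⟨rfl, h1, h2⟩ | ⟨rfl, h1, h2⟩ | ⟨rfl, h1, h2⟩ | ⟨rfl, h1, h2, h3⟩
  · have := hki h1
    simp only [h1, h2, if_true, false_and, if_false, ite_self, zero_add, Int.odd_iff]
    split_ifs <;> first | omega | simp [h8]
  · have := hkj h2
    have hn : i + 1 ∉ compartment S.typeI i := fun hm => h1 (left_of_mem_compartment hm)
    simp only [h1, h2, hn, not_false_eq_true, and_self, if_true, if_false, ite_self, zero_add,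
      Int.odd_iff]
    split_ifs <;> first | omega | simp [h8]
  · have := hki h1
    have := hkj h2
    have hn : i + 1 ∈ compartment S.typeI i := succ_mem_compartment h1 h2
    simp only [h1, hn, not_true, and_false, if_true, if_false, ite_self, zero_add,
      Int.odd_iff]
    split_ifs <;> first | omega | simp [h8]
  · have := hki h1
    have := hkj h2
    have hn : i + 2 ∉ compartment S.typeI i := not_mem_compartment_of_gap h3 rfl
    simp only [h1, h2, hn, not_false_eq_true, and_self, if_true, Int.odd_iff]
    split_ifs <;> first | omega | simp [h8]

theorem Legal.walk (h : S.Legal o a b) {i j : ℤ} (hw : S.CanWalk i j) :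
    (S.walk i j).Legal (S.walkOddity o i j) a b where
  trivial k hk := by
    refine ⟨?_, (h.trivial k hk).2⟩
    have h1 : k ≠ i := by rintro rfl; exact hw.1 hk
    have h2 : k ≠ j := by rintro rfl; exact hw.2.1 hk
    unfold Symbol.walk
    simp only [h1, h2, or_self, if_false]
    exact (h.trivial k hk).1
  support := h.support
  oddity_typeII k hk := by
    unfold walkOddity
    rw [h.oddity_typeII k hk, if_neg (by rintro ⟨rfl, h'⟩; exact hk h'),
      if_neg (by rintro ⟨rfl, h', -⟩; exact hk h'), add_zero, add_zero]
  oddity_eq k := h.walk_oddity_eq (h.mem_Ico hw.1) (h.mem_Ico hw.2.1) k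
  bad k h1 h2 h3 h4 h5 h6 := by
    rw [walk_typeI] at h1 h2 h3 h4
    rw [walk_dim] at h5 h6
    have hbad := h.bad k h1 h2 h3 h4 h5 h6
    have hcomp := compartment_eq_pair h1 h2 h3 h4
    have hmem : ∀ l, k ∈ compartment S.typeI l ↔ l = k ∨ l = k + 1 := fun l => by
      rw [mem_compartment_comm, hcomp, Set.mem_insert_iff, Set.mem_singleton_iff]
    have hij := hw.lt
    have key : ∀ x s t, (S.walk i j).oddity k = x → (S.walk i j).sign k = s →
        (S.walk i j).sign (k + 1) = t → (x = 2 ∨ x = -2 ∨ x = if s = t then 0 else 4) →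
        (S.walk i j).oddity k = 2 ∨ (S.walk i j).oddity k = -2 ∨ (S.walk i j).oddity k =
          if (S.walk i j).sign k = (S.walk i j).sign (k + 1) then 0 else 4 := by
      rintro _ _ _ rfl rfl rfl h
      exact h
    have hodd : i = k ∨ i = k + 1 ∨ j = k ∨ j = k + 1 → (S.walk i j).oddity k = S.oddity k + 4 :=
      fun h => if_pos (by rw [Set.mem_union, hmem, hmem]; tauto)
    -- If both terms of the exceptional compartment are walked, its dimension 2 forces oddity ±2,
    -- and {2, -2} is stable under adding 4. If only one is walked, one sign and the oddity change
    -- together, which keeps the relation.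
    by_cases hp : i = k ∨ i = k + 1
    · by_cases hq : j = k ∨ j = k + 1
      · obtain rfl : i = k := by omega
        obtain rfl : j = i + 1 := by omega
        have hdim : S.compartmentDim i = 2 := by
          unfold compartmentDim
          rw [hcomp, finsum_mem_pair (by omega)]
          omega
        refine key _ _ _ (hodd (Or.inl rfl)) rfl rfl ?_
        obtain ⟨-, -, ⟨-, h7⟩ | ⟨-, -, -, h7⟩ | ⟨h7, -⟩⟩ := hw
        · exact absurd h7 (by tauto)
        · rcases h7 with h7 | h7 | h7
          · omega
          · rw [h7]; right; left; decide
          · rw [h7]; left; decide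
        · omega
      · rcases hp with rfl | rfl
        · exact key _ _ _ (hodd (Or.inl rfl)) (if_pos (Or.inl rfl)) (if_neg (by omega))
            (ite_add_four _ hbad)
        · exact key _ _ _ (hodd (Or.inr (Or.inl rfl))) (if_neg (by omega)) (if_pos (Or.inl rfl))
            (ite_add_four_right _ hbad)
    · by_cases hq : j = k ∨ j = k + 1
      · rcases hq with rfl | rfl
        · exact key _ _ _ (hodd (Or.inr (Or.inr (Or.inl rfl)))) (if_pos (Or.inr rfl))
            (if_neg (by omega)) (ite_add_four _ hbad)
        · exact key _ _ _ (hodd (Or.inr (Or.inr (Or.inr rfl)))) (if_neg (by omega))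
            (if_pos (Or.inr rfl)) (ite_add_four_right _ hbad)
      · exact key _ _ _ (if_neg (by rw [Set.mem_union, hmem, hmem]; tauto)) (if_neg (by omega))
          (if_neg (by omega)) hbad

end Symbol

namespace Symbol

/-! ### Legal symbols with the same phases are related by sign walks -/

theorem sum_ite_lt_succ {a b : ℤ} (g : ℤ → ZMod 8) (k : ℤ) (hg : k ∉ Finset.Ico a b → g k = 0) :
    (∑ l ∈ Finset.Ico a b, if l < k + 1 then g l else 0) =
      (∑ l ∈ Finset.Ico a b, if l < k then g l else 0) + g k := by
  have e : ∀ l, (if l < k + 1 then g l else 0) =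
      (if l < k then g l else 0) + if l = k then g k else 0 := fun l => by
    rcases lt_trichotomy l k with h | rfl | h
    · rw [if_pos (by omega), if_pos h, if_neg (by omega), add_zero]
    · rw [if_pos (by omega), if_neg (by omega), if_pos rfl, zero_add]
    · rw [if_neg (by omega), if_neg (by omega), if_neg (by omega), add_zero]
  rw [Finset.sum_congr rfl fun l _ => e l, Finset.sum_add_distrib, Finset.sum_ite_eq']
  split_ifs with h
  · rfl
  · rw [hg h]

/-- `4` if the signs differ, and `0` otherwise. -/
def signDiff (s t : ℤˣ) : ZMod 8 := if s = t then 0 else 4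

theorem termPhase_sub (k l : ℤ) (x y : ZMod 8) (s t : ℤˣ) :
    termPhase k l x s - termPhase k l y t =
      if l < k then x - y + (if Odd (k - l) then signDiff s t else 0) else 0 := by
  have h1 : ¬ ((1 : ℤˣ) = -1) := by decide
  have h2 : ¬ ((-1 : ℤˣ) = 1) := by decide
  have h3 : ∀ x y : ZMod 8, x - (y + 4) = x - y + 4 := by decide
  unfold termPhase signDiff
  by_cases h : l < k <;> by_cases ho : Odd (k - l) <;>
    rcases Int.units_eq_one_or s with rfl | rfl <;> rcases Int.units_eq_one_or t with rfl | rfl <;>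
    simp only [h, ho, h1, h2, h3, if_true, if_false, and_true, and_false, add_zero, ite_self,
      sub_self] <;>
    clear h ho h1 h2 h3 <;> revert x y <;> decide

variable {S S' : Symbol} {o o' : ℤ → ZMod 8} {a b : ℤ}

/-- The difference of the partial sums of the oddities. -/
def oddityDiff (o o' : ℤ → ZMod 8) (a b k : ℤ) : ZMod 8 :=
  ∑ l ∈ Finset.Ico a b, if l < k then o l - o' l else 0

/-- The type II scales p and q bound the compartment of k, so its oddity is a difference of partial
sums taken at type II scales, where phases are available. -/
theorem oddity_sub_eq (h : S.Legal o a b) (h' : S'.Legal o' a b) (htype : S.typeI = S'.typeI)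
    {p q k : ℤ} (hp : ¬ S.typeI p) (hq : ¬ S.typeI q) (hpk : p < k) (hkq : k < q)
    (hT : ∀ l, p < l → l < q → S.typeI l) :
    S.oddity k - S'.oddity k = oddityDiff o o' a b q - oddityDiff o o' a b (p + 1) := by
  classical
  have hcomp : ∀ l, l ∈ compartment S.typeI k ↔ p < l ∧ l < q := by
    intro l
    constructor
    · intro hl
      constructor
      · by_contra hn
        exact hp (hl _ (by rw [Set.mem_uIcc]; omega))
      · by_contra hn
        exact hq (hl _ (by rw [Set.mem_uIcc]; omega))
    · rintro ⟨h1, h2⟩ x hx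
      rw [Set.mem_uIcc] at hx
      exact hT x (by omega) (by omega)
  rw [h.oddity_eq, h'.oddity_eq, ← htype]
  unfold oddityDiff
  rw [← Finset.sum_sub_distrib, ← Finset.sum_sub_distrib]
  refine Finset.sum_congr rfl fun l _ => ?_
  simp only [hcomp]
  by_cases h1 : p < l
  · by_cases h2 : l < q
    · rw [if_pos ⟨h1, h2⟩, if_pos ⟨h1, h2⟩, if_pos h2, if_neg (by omega), sub_zero]
    · rw [if_neg (by tauto), if_neg (by tauto), if_neg h2, if_neg (by omega)]
  · rw [if_neg (by tauto), if_neg (by tauto), if_pos (by omega), if_pos (by omega), sub_self,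
      sub_self]

theorem Legal.exists_lt (h : S.Legal o a b) (k : ℤ) :
    ∃ p < k, ¬ S.typeI p ∧ ∀ l, p < l → l < k → S.typeI l := by
  obtain ⟨p, ⟨hp, hpk⟩, hp'⟩ := Int.exists_greatest_of_bdd (P := fun p => ¬ S.typeI p ∧ p < k)
    ⟨k, fun z hz => hz.2.le⟩ ⟨min (a - 1) (k - 1), (h.trivial _ (h.support _ (by
      rw [Finset.mem_Ico]; omega))).2, by omega⟩
  refine ⟨p, hpk, hp, fun l h1 h2 => ?_⟩
  by_contra hn
  have := hp' l ⟨hn, h2⟩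
  omega

theorem Legal.exists_gt (h : S.Legal o a b) (k : ℤ) :
    ∃ q > k, ¬ S.typeI q ∧ ∀ l, k < l → l < q → S.typeI l := by
  obtain ⟨q, ⟨hq, hkq⟩, hq'⟩ := Int.exists_least_of_bdd (P := fun p => ¬ S.typeI p ∧ k < p)
    ⟨k, fun z hz => hz.2.le⟩ ⟨max b (k + 1), (h.trivial _ (h.support _ (by
      rw [Finset.mem_Ico]; omega))).2, by omega⟩
  refine ⟨q, hkq, hq, fun l h1 h2 => ?_⟩
  by_contra hn
  have := hq' l ⟨hn, h1⟩
  omega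

/-- Two legal symbols with the same dimensions, types and phases. -/
structure SamePhase (S S' : Symbol) (o o' : ℤ → ZMod 8) (a b : ℤ) : Prop where
  left : S.Legal o a b
  right : S'.Legal o' a b
  dim_eq : S.dim = S'.dim
  typeI_eq : S.typeI = S'.typeI
  phase_eq : ∀ k, ¬ S.typeI k → S.phase o a b k = S'.phase o' a b k

/-! ### Comparing two symbols from the lowest scale upwards -/

namespace SamePhase

theorem sub_eq_zero_of_typeII (h : SamePhase S S' o o' a b) {k : ℤ} (hk : ¬ S.typeI k) : o k - o' k = 0 := by
  rw [h.left.oddity_typeII k hk, h.right.oddity_typeII k (h.typeI_eq ▸ hk), sub_zero]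

theorem signDiff_eq_zero_of_trivial (h : SamePhase S S' o o' a b) {k : ℤ} (hk : S.dim k = 0) :
    signDiff (S.sign k) (S'.sign k) = 0 := by
  rw [(h.left.trivial k hk).1, (h.right.trivial k (h.dim_eq ▸ hk)).1]
  exact if_pos rfl

theorem oddityDiff_succ (h : SamePhase S S' o o' a b) (k : ℤ) :
    oddityDiff o o' a b (k + 1) = oddityDiff o o' a b k + (o k - o' k) :=
  sum_ite_lt_succ _ _ fun hk => h.sub_eq_zero_of_typeII
    (h.left.trivial k (h.left.support k hk)).2

theorem sum_diff_eq_zero (h : SamePhase S S' o o' a b) {k : ℤ} (hk : ¬ S.typeI k) :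
    (∑ l ∈ Finset.Ico a b, if l < k then o l - o' l +
      (if Odd (k - l) then signDiff (S.sign l) (S'.sign l) else 0) else 0) = 0 := by
  rw [← Finset.sum_congr rfl fun l _ => termPhase_sub k l (o l) (o' l) (S.sign l) (S'.sign l),
    Finset.sum_sub_distrib]
  exact sub_eq_zero.2 (h.phase_eq k hk)

theorem sum_diff_of_sign_eq {i : ℤ} (hi : ∀ l < i, S.sign l = S'.sign l) (k : ℤ) :
    (∑ l ∈ Finset.Ico a b, if l < i then o l - o' l +
      (if Odd (k - l) then signDiff (S.sign l) (S'.sign l) else 0) else 0) =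
      oddityDiff o o' a b i := by
  refine Finset.sum_congr rfl fun l _ => ?_
  split_ifs with h1 h2
  · rw [hi l h1, signDiff, if_pos rfl, add_zero]
  · rw [add_zero]
  · rfl

/-- As long as the signs agree, equality of phases is equality of partial sums of oddities. -/
theorem oddityDiff_eq_zero (h : SamePhase S S' o o' a b) {i k : ℤ} (hi : ∀ l < i, S.sign l = S'.sign l) (hki : k ≤ i)
    (hk : ¬ S.typeI k) : oddityDiff o o' a b k = 0 := by
  rw [← sum_diff_of_sign_eq (i := k) (fun l hl => hi l (by omega)) k]
  exact h.sum_diff_eq_zero hk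

/-- In the phase at scale i + 1, the only sign that can differ is the one at i, which lies at
distance 1. -/
theorem oddityDiff_succ_eq_zero (h : SamePhase S S' o o' a b) {i : ℤ} (hi : ∀ l < i, S.sign l = S'.sign l)
    (hk : ¬ S.typeI (i + 1)) :
    oddityDiff o o' a b i + (o i - o' i + signDiff (S.sign i) (S'.sign i)) = 0 := by
  have := h.sum_diff_eq_zero hk
  rw [sum_ite_lt_succ (fun l => o l - o' l +
      (if Odd (i + 1 - l) then signDiff (S.sign l) (S'.sign l) else 0)) i (fun hk => ?_),
    sum_diff_of_sign_eq hi, if_pos] at this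
  · exact this
  · rw [add_sub_cancel_left]; decide
  · have h0 := h.left.support i hk
    rw [h.sub_eq_zero_of_typeII (h.left.trivial i h0).2,
      h.signDiff_eq_zero_of_trivial h0, ite_self, add_zero]

/-- In the phase at scale i + 2, the term i lies at even distance, so its sign drops out and only
the sign at i + 1 enters. -/
theorem oddityDiff_succ_succ_eq_zero (h : SamePhase S S' o o' a b) {i : ℤ} (hi : ∀ l < i, S.sign l = S'.sign l)
    (hk : ¬ S.typeI (i + 2)) :
    oddityDiff o o' a b i + (o i - o' i) +
      (o (i + 1) - o' (i + 1) + signDiff (S.sign (i + 1)) (S'.sign (i + 1))) = 0 := by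
  have hz : ∀ k p, k ∉ Finset.Ico a b → o k - o' k +
      (if Odd (p - k) then signDiff (S.sign k) (S'.sign k) else 0) = 0 := fun k p hk => by
    have h0 := h.left.support k hk
    rw [h.sub_eq_zero_of_typeII (h.left.trivial k h0).2,
      h.signDiff_eq_zero_of_trivial h0, ite_self, add_zero]
  have := h.sum_diff_eq_zero hk
  rw [show i + 2 = i + 1 + 1 by ring, sum_ite_lt_succ (fun l => o l - o' l +
      (if Odd (i + 1 + 1 - l) then signDiff (S.sign l) (S'.sign l) else 0)) (i + 1)
      (hz _ _), sum_ite_lt_succ (fun l => o l - o' l +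
      (if Odd (i + 1 + 1 - l) then signDiff (S.sign l) (S'.sign l) else 0)) i (hz _ _),
    sum_diff_of_sign_eq hi, if_neg, add_zero, if_pos] at this
  · exact this
  · rw [add_sub_cancel_left]; decide
  · rw [add_assoc, add_sub_cancel_left]; decide

theorem oddity_eq_of_sign_eq (h : SamePhase S S' o o' a b) (hsign : S.sign = S'.sign) : S.oddity = S'.oddity := by
  classical
  funext k
  rw [← sub_eq_zero]
  by_cases hk : S.typeI k
  · obtain ⟨p, hpk, hp, hp'⟩ := h.left.exists_lt k
    obtain ⟨q, hkq, hq, hq'⟩ := h.left.exists_gt k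
    have hlt : ∀ k l, l < k → S.sign l = S'.sign l := fun _ l _ => congrFun hsign l
    rw [oddity_sub_eq h.left h.right h.typeI_eq hp hq hpk hkq, h.oddityDiff_eq_zero (hlt q) le_rfl hq,
      h.oddityDiff_succ, h.oddityDiff_eq_zero (hlt p) le_rfl hp, h.sub_eq_zero_of_typeII hp,
      add_zero, sub_zero]
    intro l h1 h2
    rcases lt_trichotomy l k with h3 | rfl | h3
    · exact hp' l h1 h3
    · exact hk
    · exact hq' l h3 h2
  · have hz : ∀ l, l ∉ compartment S.typeI k := fun l hl => hk (left_of_mem_compartment hl)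
    rw [h.left.oddity_eq, h.right.oddity_eq, ← h.typeI_eq]
    simp [hz]

/-- Since x - y is 0 or 4 and x is not ±2, neither is y. The oddities then record the products st
and s't', and knowing whether t and t' differ decides that s and s' agree. -/
theorem eq_of_pair {x y : ZMod 8} {s t s' t' : ℤˣ}
    (h : x = 2 ∨ x = -2 ∨ x = if s = t then 0 else 4) (h2 : ¬ (x = 2 ∨ x = -2))
    (h' : y = 2 ∨ y = -2 ∨ y = if s' = t' then 0 else 4) (hxy : x - y + signDiff t t' = 0) :
    s = s' := by
  have h3 : ¬ ((1 : ℤˣ) = -1) := by decide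
  have h4 : ¬ ((-1 : ℤˣ) = 1) := by decide
  unfold signDiff at hxy
  rcases Int.units_eq_one_or s with rfl | rfl <;> rcases Int.units_eq_one_or t with rfl | rfl <;>
    rcases Int.units_eq_one_or s' with rfl | rfl <;>
    rcases Int.units_eq_one_or t' with rfl | rfl <;>
    simp only [h3, h4, if_true, if_false] at * <;>
    exact absurd hxy (by clear hxy; revert x y; decide)

/-- The scale i is the lowest with different signs. In each configuration that allows no walk from i
upwards, the phases at the next type II scales give a contradiction. -/
theorem exists_canWalk (h : SamePhase S S' o o' a b) {i : ℤ}
    (hi : ∀ l < i, S.sign l = S'.sign l) (hne : S.sign i ≠ S'.sign i) :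
    ∃ j, i < j ∧ S.CanWalk i j := by
  classical
  have h4 : signDiff (S.sign i) (S'.sign i) = 4 := if_neg hne
  have h40 : ¬ (4 : ZMod 8) = 0 := by decide
  have hdi : S.dim i ≠ 0 := fun h0 => by
    rw [h.signDiff_eq_zero_of_trivial h0] at h4
    exact h40 h4.symm
  by_cases hti : S.typeI i
  · by_cases hdj : S.dim (i + 1) = 0
    · have htj := (h.left.trivial _ hdj).2
      by_cases htk : S.typeI (i + 2)
      · exact ⟨i + 2, by omega, hdi, h.left.dim_ne_zero htk, Or.inr (Or.inr ⟨rfl, hti, htk, hdj⟩)⟩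
      · have e1 := h.oddityDiff_succ_eq_zero hi htj
        have e2 := h.oddityDiff_succ_succ_eq_zero hi htk
        rw [h.sub_eq_zero_of_typeII htj, h.signDiff_eq_zero_of_trivial hdj, add_zero,
          add_zero] at e2
        rw [← add_assoc, e2, zero_add, h4] at e1
        exact absurd e1 h40
    · by_cases htj : S.typeI (i + 1)
      · by_cases hw : 2 < S.compartmentDim i ∨ S.oddity i = 2 ∨ S.oddity i = -2
        · exact ⟨i + 1, by omega, hdi, hdj, Or.inr (Or.inl ⟨rfl, hti, htj, hw⟩)⟩
        · exfalso
          -- If condition 2 fails, the compartment has dimension at most 2, so it consists of two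
          -- one-dimensional terms at i and i + 1, and `bad` applies to both symbols.
          have hw1 : S.compartmentDim i ≤ 2 := by
            by_contra hn; exact hw (Or.inl (by omega))
          have hw2 : ¬ (S.oddity i = 2 ∨ S.oddity i = -2) := fun hn => hw (Or.inr hn)
          have hfin : (compartment S.typeI i).Finite :=
            (Finset.Ico a b).finite_toSet.subset fun l hl =>
              h.left.mem_Ico (h.left.dim_ne_zero (right_of_mem_compartment hl))
          have hle : ∀ s : Finset ℤ, (∀ l ∈ s, l ∈ compartment S.typeI i) →
              ∑ l ∈ s, S.dim l ≤ 2 := fun s hs => by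
            refine le_trans ?_ hw1
            unfold compartmentDim
            rw [finsum_mem_eq_finite_toFinset_sum _ hfin]
            exact Finset.sum_le_sum_of_subset fun l hl => hfin.mem_toFinset.2 (hs l hl)
          have hmi := self_mem_compartment hti
          have hmj := succ_mem_compartment hti htj
          have hl : ¬ S.typeI (i - 1) := fun hl => by
            have := hle {i - 1, i, i + 1} (by
              simp only [Finset.mem_insert, Finset.mem_singleton]
              rintro l (rfl | rfl | rfl)
              · exact pred_mem_compartment hti hl
              · exact hmi
              · exact hmj)
            rw [Finset.sum_insert (by simp only [Finset.mem_insert, Finset.mem_singleton]; omega),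
              Finset.sum_pair (by omega)] at this
            have := h.left.dim_ne_zero hl
            omega
          have hr : ¬ S.typeI (i + 2) := fun hr => by
            have := hle {i, i + 1, i + 2} (by
              simp only [Finset.mem_insert, Finset.mem_singleton]
              rintro l (rfl | rfl | rfl)
              · exact hmi
              · exact hmj
              · refine mem_compartment_trans hmj ?_
                rw [show i + 2 = i + 1 + 1 by ring] at hr ⊢
                exact succ_mem_compartment htj hr)
            rw [Finset.sum_insert (by simp only [Finset.mem_insert, Finset.mem_singleton]; omega),
              Finset.sum_pair (by omega)] at this
            have := h.left.dim_ne_zero hr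
            omega
          have h2 := hle {i, i + 1} (by
            simp only [Finset.mem_insert, Finset.mem_singleton]
            rintro l (rfl | rfl)
            · exact hmi
            · exact hmj)
          rw [Finset.sum_pair (by omega)] at h2
          have hcomp := compartment_eq_pair hti htj hl hr
          have hdi' : S.dim i = 1 := by omega
          have hdj' : S.dim (i + 1) = 1 := by omega
          have hodd : ∀ {S : Symbol} {o : ℤ → ZMod 8}, S.Legal o a b → S.dim i ≠ 0 →
              S.dim (i + 1) ≠ 0 → compartment S.typeI i = {i, i + 1} →
              S.oddity i = o i + o (i + 1) := by
            intro S o h hi hj hc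
            have e : ∀ l, (if l ∈ compartment S.typeI i then o l else 0) =
                (if l = i then o i else 0) + if l = i + 1 then o (i + 1) else 0 := fun l => by
              rw [hc]
              simp only [Set.mem_insert_iff, Set.mem_singleton_iff]
              by_cases h1 : l = i
              · subst h1; simp
              · by_cases h2 : l = i + 1
                · subst h2; simp
                · simp [h1, h2]
            rw [h.oddity_eq, Finset.sum_congr rfl fun l _ => e l, Finset.sum_add_distrib,
              Finset.sum_ite_eq', Finset.sum_ite_eq', if_pos (h.mem_Ico hi),
              if_pos (h.mem_Ico hj)]
          have e1 := h.oddityDiff_eq_zero hi (show i - 1 ≤ i by omega) hl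
          have e2 := h.oddityDiff_succ (i - 1)
          rw [sub_add_cancel, e1, h.sub_eq_zero_of_typeII hl, add_zero] at e2
          have e3 := h.oddityDiff_succ_succ_eq_zero hi hr
          rw [e2, zero_add] at e3
          refine hne (eq_of_pair (h.left.bad i hti htj hl hr hdi' hdj') hw2
            (h.right.bad i (h.typeI_eq ▸ hti) (h.typeI_eq ▸ htj) (h.typeI_eq ▸ hl)
              (h.typeI_eq ▸ hr) (h.dim_eq ▸ hdi') (h.dim_eq ▸ hdj')) ?_)
          rw [hodd h.left hdi hdj hcomp, hodd h.right (h.dim_eq ▸ hdi) (h.dim_eq ▸ hdj)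
            (h.typeI_eq ▸ hcomp), ← e3]
          ring
      · exact ⟨i + 1, by omega, hdi, hdj, Or.inl ⟨rfl, Or.inl ⟨hti, htj⟩⟩⟩
  · by_cases htj : S.typeI (i + 1)
    · exact ⟨i + 1, by omega, hdi, h.left.dim_ne_zero htj, Or.inl ⟨rfl, Or.inr ⟨hti, htj⟩⟩⟩
    · have e1 := h.oddityDiff_succ_eq_zero hi htj
      rw [h.oddityDiff_eq_zero hi le_rfl hti, h.sub_eq_zero_of_typeII hti, h4, zero_add,
        zero_add] at e1
      exact absurd e1 h40

/-- The number m counts the scales below b whose signs may still differ. A walk from the lowest of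
them leaves all smaller scales untouched, and when none is left the phases determine the oddities.
-/
theorem reflTransGen_of_sign_eq (m : ℕ) : ∀ {S : Symbol} {o : ℤ → ZMod 8},
    SamePhase S S' o o' a b → (∀ l < b - m, S.sign l = S'.sign l) →
    Relation.ReflTransGen SignWalk S S' := by
  induction m with
  | zero =>
    intro S o h hm
    have hsign : S.sign = S'.sign := by
      funext l
      rcases lt_or_ge l b with hl | hl
      · exact hm l (by simpa using hl)
      · have h0 := h.left.support l (by rw [Finset.mem_Ico]; omega)
        rw [(h.left.trivial l h0).1, (h.right.trivial l (h.dim_eq ▸ h0)).1]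
    have : S = S' := Symbol.ext hsign h.dim_eq h.typeI_eq (h.oddity_eq_of_sign_eq hsign)
    rw [this]
  | succ m ih =>
    intro S o h hm
    have hcast : b - ((m + 1 : ℕ) : ℤ) + 1 = b - m := by push_cast; ring
    generalize b - ((m + 1 : ℕ) : ℤ) = i at hm hcast
    rw [← hcast] at ih
    by_cases hne : S.sign i = S'.sign i
    · refine ih h fun l hl => ?_
      rcases (show l < i ∨ l = i by omega) with h1 | rfl
      · exact hm l h1
      · exact hne
    · obtain ⟨j, hij, hw⟩ := h.exists_canWalk hm hne
      refine Relation.ReflTransGen.head ⟨i, j, hw, rfl⟩ (ih (o := S.walkOddity o i j)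
        ⟨h.left.walk hw, h.right, h.dim_eq, h.typeI_eq, fun k hk => ?_⟩ fun l hl => ?_)
      · rw [h.left.walk_phase_eq hw hk, h.phase_eq k hk]
      · rcases (show l < i ∨ l = i by omega) with h1 | rfl
        · rw [← hm l h1]
          exact if_neg (by omega)
        · refine (if_pos (Or.inl rfl)).trans ?_
          rcases Int.units_eq_one_or (S.sign l) with h1 | h1 <;>
            rcases Int.units_eq_one_or (S'.sign l) with h2 | h2 <;> rw [h1, h2] at hne ⊢
          · exact absurd rfl hne
          · exact neg_neg 1
          · exact absurd rfl hne

theorem reflTransGen (h : SamePhase S S' o o' a b) : Relation.ReflTransGen SignWalk S S' := by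
  refine reflTransGen_of_sign_eq (b - a).toNat h fun l hl => ?_
  have h0 := h.left.support l (by rw [Finset.mem_Ico]; omega)
  rw [(h.left.trivial l h0).1, (h.right.trivial l (h.dim_eq ▸ h0)).1]

end SamePhase

/-- A partial sum of oddities up to a type II scale consists of whole compartments, whose sums are
part of the symbol. The induction steps down either by one type II scale or across an entire
compartment. -/
theorem Legal.oddityDiff_eq_zero (h : S.Legal o a b) (h' : S.Legal o' a b) (n : ℕ) :
    ∀ k ≤ a + n, ¬ S.typeI k → oddityDiff o o' a b k = 0 := by
  have hsucc : ∀ k, ¬ S.typeI k → oddityDiff o o' a b (k + 1) = oddityDiff o o' a b k :=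
    fun k hk => by
      unfold oddityDiff
      rw [sum_ite_lt_succ, h.oddity_typeII k hk, h'.oddity_typeII k hk, sub_zero, add_zero]
      intro _
      rw [h.oddity_typeII k hk, h'.oddity_typeII k hk, sub_zero]
  induction n with
  | zero =>
    intro k hk _
    refine Finset.sum_eq_zero fun l hl => if_neg ?_
    rw [Finset.mem_Ico] at hl
    rw [Nat.cast_zero, add_zero] at hk
    omega
  | succ n ih =>
    intro k hk hTk
    rw [Nat.cast_succ] at hk
    by_cases hT : S.typeI (k - 1)
    · obtain ⟨p, hpk, hp, hp'⟩ := h.exists_lt k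
      have hne : p ≠ k - 1 := by rintro rfl; exact hp hT
      have := oddity_sub_eq h h' rfl hp hTk (show p < k - 1 by omega) (by omega) hp'
      rw [sub_self, hsucc p hp, ih p (by omega) hp, sub_zero] at this
      exact this.symm
    · rw [← sub_add_cancel k 1, hsucc _ hT]
      exact ih _ (by omega) hT

/-- The phase does not depend on how the oddities of the compartments are distributed. -/
theorem Legal.phase_eq (h : S.Legal o a b) (h' : S.Legal o' a b) {k : ℤ} (hk : ¬ S.typeI k) :
    S.phase o a b k = S.phase o' a b k := by
  rw [← sub_eq_zero, ← h.oddityDiff_eq_zero h' (k - a).toNat k (by omega) hk]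
  unfold phase
  rw [← Finset.sum_sub_distrib, Finset.sum_congr rfl fun l _ => termPhase_sub k l _ _ _ _]
  simp only [signDiff, if_true, ite_self, add_zero]
  rfl

/-- Sign walks preserve legality, dimensions, types and phases. -/
theorem Legal.of_reflTransGen {S S' : Symbol} {o : ℤ → ZMod 8} {a b : ℤ} (h : S.Legal o a b)
    (hS : Relation.ReflTransGen SignWalk S S') : ∃ o', SamePhase S S' o o' a b := by
  induction hS with
  | refl => exact ⟨o, h, h, rfl, rfl, fun _ _ => rfl⟩
  | tail _ hw ih =>
    obtain ⟨o', h'⟩ := ih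
    obtain ⟨i, j, hw, rfl⟩ := hw
    exact ⟨_, h, h'.right.walk hw, h'.dim_eq, h'.typeI_eq, fun k hk => by
      rw [h'.right.walk_phase_eq hw (h'.typeI_eq ▸ hk), h'.phase_eq k hk]⟩

end Symbol

/-! ### Sums of blocks with the same shapes and phases -/

/-- The scale of a block, and whether it has rank one. -/
def Block.shape : Block → ℤ × Bool
  | .one k _ => (k, true)
  | .plane k _ => (k, false)

theorem Block.exists_eq_one {c : Block} {k : ℤ} (h : c.shape = (k, true)) : ∃ u, c = .one k u := by
  cases c with
  | one j u =>
    obtain rfl : j = k := congrArg Prod.fst h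
    exact ⟨u, rfl⟩
  | plane j ε => exact absurd (congrArg Prod.snd h) Bool.false_ne_true

theorem Block.exists_eq_plane {c : Block} {k : ℤ} (h : c.shape = (k, false)) :
    ∃ ε, c = .plane k ε := by
  cases c with
  | one j u => exact absurd (congrArg Prod.snd h).symm Bool.false_ne_true
  | plane j ε =>
    obtain rfl : j = k := congrArg Prod.fst h
    exact ⟨ε, rfl⟩

theorem Block.phase_eq_zero {c : Block} {k : ℤ} (h : k ≤ c.shape.1) : c.phase k = 0 := by
  cases c with
  | one j u => rw [phase_one]; exact if_neg (not_lt.2 h)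
  | plane j ε => rw [phase_plane]; exact if_neg fun h' => not_lt.2 h h'.1

theorem Block.phase_one_succ (k : ℤ) (u : ZMod 8) :
    (Block.one k u).phase (k + 1) = u + if legendre u = -1 then 4 else 0 := by
  have h : Odd (k + 1 - k) := by rw [add_sub_cancel_left]; decide
  rw [phase_one, if_pos (by omega)]
  simp only [h, true_and]

theorem Block.phase_one_add_two (k : ℤ) (u : ZMod 8) : (Block.one k u).phase (k + 2) = u := by
  have h : ¬ Odd (k + 2 - k) := by rw [add_sub_cancel_left]; decide
  rw [phase_one, if_pos (by omega), if_neg (fun h' => h h'.1), add_zero]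

theorem Block.phase_plane_succ (k : ℤ) (ε : Bool) :
    (Block.plane k ε).phase (k + 1) = if ε = true then 4 else 0 := by
  have h : Odd (k + 1 - k) := by rw [add_sub_cancel_left]; decide
  rw [phase_plane]
  simp only [h, true_and, show k < k + 1 by omega]

namespace Blocks

/-- The isometry class of the orthogonal sum. -/
def cls (S : Multiset Block) : LatClass := (S.map Block.cls).sum

/-- The phase of the orthogonal sum at the scale `2 ^ k`. -/
def phase (k : ℤ) (S : Multiset Block) : ZMod 8 := (S.map (Block.phase k)).sum

/-- All entries of rank one blocks are odd. -/
def Proper (S : Multiset Block) : Prop := ∀ c ∈ S, c.Proper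

theorem cls_cons (c : Block) (S : Multiset Block) : cls (c ::ₘ S) = c.cls + cls S := by
  simp [cls]

theorem phase_cons (k : ℤ) (c : Block) (S : Multiset Block) :
    phase k (c ::ₘ S) = c.phase k + phase k S := by
  simp [phase]

theorem proper_cons {c : Block} {S : Multiset Block} :
    Proper (c ::ₘ S) ↔ c.Proper ∧ Proper S := Multiset.forall_mem_cons

theorem phase_eq_zero {k : ℤ} {S : Multiset Block} (h : ∀ c ∈ S, k ≤ c.shape.1) :
    phase k S = 0 := by
  refine Multiset.sum_eq_zero fun x hx => ?_
  obtain ⟨c, hc, rfl⟩ := Multiset.mem_map.1 hx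
  exact Block.phase_eq_zero (h c hc)

theorem cls_phase {S : Multiset Block} (hS : Proper S) {k : ℤ} (h : ∀ u, .one k u ∉ S) :
    (cls S).Phase k (phase k S) := by
  induction S using Multiset.induction_on with
  | empty => exact LatClass.Phase.zero k
  | cons c S ih =>
    rw [cls_cons, phase_cons]
    rw [proper_cons] at hS
    exact (Block.cls_phase hS.1 fun u hu => h u (hu ▸ Multiset.mem_cons_self _ _)).add
      (ih hS.2 fun u hu => h u (Multiset.mem_cons_of_mem hu))

theorem exists_one_of_shape_eq {S S' : Multiset Block}
    (h : S.map Block.shape = S'.map Block.shape) {k : ℤ} {u : ZMod 8} (hu : .one k u ∈ S) :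
    ∃ u', .one k u' ∈ S' := by
  have : (k, true) ∈ S'.map Block.shape := h ▸ Multiset.mem_map_of_mem Block.shape hu
  obtain ⟨c, hc, hck⟩ := Multiset.mem_map.1 this
  obtain ⟨u', rfl⟩ := Block.exists_eq_one hck
  exact ⟨u', hc⟩

theorem exists_plane_of_shape_eq {S S' : Multiset Block}
    (h : S.map Block.shape = S'.map Block.shape) {k : ℤ} {ε : Bool} (hu : .plane k ε ∈ S) :
    ∃ ε', .plane k ε' ∈ S' := by
  have : (k, false) ∈ S'.map Block.shape := h ▸ Multiset.mem_map_of_mem Block.shape hu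
  obtain ⟨c, hc, hck⟩ := Multiset.mem_map.1 this
  obtain ⟨u', rfl⟩ := Block.exists_eq_plane hck
  exact ⟨u', hc⟩

theorem scale_le_of_shape_eq {S S' : Multiset Block}
    (h : S.map Block.shape = S'.map Block.shape) {k : ℤ} (hk : ∀ c ∈ S, k ≤ c.shape.1) :
    ∀ c ∈ S', k ≤ c.shape.1 := by
  intro c hc
  have : c.shape ∈ S.map Block.shape := h ▸ Multiset.mem_map_of_mem Block.shape hc
  obtain ⟨c', hc', hck⟩ := Multiset.mem_map.1 this
  exact hck ▸ hk c' hc'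

/-- `T` is obtained from `S` by changing the blocks, keeping their shapes and the isometry class
of the sum. -/
structure Equiv (S T : Multiset Block) : Prop where
  cls_eq : cls S = cls T
  shape_eq : S.map Block.shape = T.map Block.shape
  proper : Proper T

theorem Equiv.trans {S T U : Multiset Block} (h : Equiv S T) (h' : Equiv T U) : Equiv S U :=
  ⟨h.cls_eq.trans h'.cls_eq, h.shape_eq.trans h'.shape_eq, h'.proper⟩

/-- The hypotheses of the comparison of two sums of blocks of scale at least `2 ^ k`. -/
structure Match (S S' : Multiset Block) (k : ℤ) : Prop where
  proper_left : Proper S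
  proper_right : Proper S'
  shape_eq : S.map Block.shape = S'.map Block.shape
  -- Each scale carries only rank one blocks or only planes, which is the normal form of a type I or
  -- type II term.
  normal : ∀ j u ε, .one j u ∈ S → .plane j ε ∉ S
  phase_eq : ∀ j, (∀ u, .one j u ∉ S) → phase j S = phase j S'
  le_scale : ∀ c ∈ S, k ≤ c.shape.1

theorem normal_of_shape_eq {S S' : Multiset Block} (h : S.map Block.shape = S'.map Block.shape)
    (hS : ∀ j u ε, .one j u ∈ S → .plane j ε ∉ S) (j : ℤ) (u : ZMod 8) (ε : Bool)
    (hu : .one j u ∈ S') : .plane j ε ∉ S' := fun hε => by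
  obtain ⟨u', hu'⟩ := exists_one_of_shape_eq h.symm hu
  obtain ⟨ε', hε'⟩ := exists_plane_of_shape_eq h.symm hε
  exact hS j u' ε' hu' hε'

theorem Match.symm {S S' : Multiset Block} {k : ℤ} (h : Match S S' k) : Match S' S k where
  proper_left := h.proper_right
  proper_right := h.proper_left
  shape_eq := h.shape_eq.symm
  normal := normal_of_shape_eq h.shape_eq h.normal
  phase_eq j hj := (h.phase_eq j fun u hu => by
    obtain ⟨u', hu'⟩ := exists_one_of_shape_eq h.shape_eq hu
    exact hj u' hu').symm
  le_scale := scale_le_of_shape_eq h.shape_eq h.le_scale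

theorem Match.of_equiv {S S' T : Multiset Block} {k : ℤ} (h : Match S S' k) (hT : Equiv S T) :
    Match T S' k where
  proper_left := hT.proper
  proper_right := h.proper_right
  shape_eq := hT.shape_eq.symm.trans h.shape_eq
  normal := normal_of_shape_eq hT.shape_eq h.normal
  phase_eq j hj := by
    have hj' : ∀ u, .one j u ∉ S := fun u hu => by
      obtain ⟨u', hu'⟩ := exists_one_of_shape_eq hT.shape_eq hu
      exact hj u' hu'
    rw [← h.phase_eq j hj']
    -- Exchanges keep the isometry class, hence the Gauss mean, hence the phase.
    have := cls_phase h.proper_left hj'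
    rw [hT.cls_eq] at this
    exact (cls_phase hT.proper hj).unique this
  le_scale := scale_le_of_shape_eq hT.shape_eq h.le_scale

/-- Up to equivalence, both sums contain the same block of scale `2 ^ k`. -/
def Common (S S' : Multiset Block) (k : ℤ) : Prop :=
  ∃ T T' c, Equiv S T ∧ Equiv S' T' ∧ c ∈ T ∧ c ∈ T' ∧ c.shape.1 = k

theorem Common.symm {S S' : Multiset Block} {k : ℤ} (h : Common S S' k) : Common S' S k := by
  obtain ⟨T, T', c, h1, h2, h3, h4, h5⟩ := h
  exact ⟨T', T, c, h2, h1, h4, h3, h5⟩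

theorem Common.of_equiv {S S' T : Multiset Block} {k : ℤ} (h : Common T S' k)
    (hT : Equiv S T) : Common S S' k := by
  obtain ⟨T, T', c, h1, h2, h3, h4, h5⟩ := h
  exact ⟨T, T', c, hT.trans h1, h2, h3, h4, h5⟩

theorem Match.common_of_mem {S S' : Multiset Block} {k : ℤ} (h : Match S S' k) {c : Block}
    (hc : c ∈ S) (hc' : c ∈ S') (hck : c.shape.1 = k) : Common S S' k :=
  ⟨S, S', c, ⟨rfl, rfl, h.proper_left⟩, ⟨rfl, rfl, h.proper_right⟩, hc, hc', hck⟩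

theorem equiv_cons_cons {x y x' y' : Block} {R : Multiset Block}
    (h : x.cls + y.cls = x'.cls + y'.cls) (hx : x.shape = x'.shape) (hy : y.shape = y'.shape)
    (hx' : x'.Proper) (hy' : y'.Proper) (hR : Proper R) :
    Equiv (x ::ₘ y ::ₘ R) (x' ::ₘ y' ::ₘ R) where
  cls_eq := by
    rw [cls_cons, cls_cons, cls_cons, cls_cons, ← add_assoc, ← add_assoc, h]
  shape_eq := by simp [hx, hy]
  proper := proper_cons.2 ⟨hx', proper_cons.2 ⟨hy', hR⟩⟩

theorem isOdd_five_mul {u : ZMod 8} (hu : IsOdd u) : IsOdd (5 * u) := by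
  revert u; decide

theorem Match.proper_tail {c : Block} {R S' : Multiset Block} {k : ℤ}
    (h : Match (c ::ₘ R) S' k) : Proper R := (proper_cons.1 h.proper_left).2

theorem Match.isOdd_of_mem {S S' : Multiset Block} {k j : ℤ} (h : Match S S' k) {u : ZMod 8}
    (hu : .one j u ∈ S) : IsOdd u := h.proper_left _ hu

theorem sum_ite_shape (R : Multiset Block) (s : ℤ × Bool) (x : ZMod 8) :
    (R.map fun c => if c.shape = s then x else 0).sum = (R.map Block.shape).count s • x := by
  induction R using Multiset.induction_on with
  | empty => simp
  | cons c R ih =>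
    rw [Multiset.map_cons, Multiset.sum_cons, ih, Multiset.map_cons, Multiset.count_cons]
    by_cases h : c.shape = s
    · rw [if_pos h, if_pos h.symm, add_smul, one_smul, add_comm]
    · rw [if_neg h, if_neg (Ne.symm h), zero_add, add_zero]

theorem exists_cons_of_count {R : Multiset Block} {k : ℤ} {n : ℕ}
    (h : (R.map Block.shape).count (k, true) = n + 1) :
    ∃ u R', R = .one k u ::ₘ R' ∧ (R'.map Block.shape).count (k, true) = n := by
  have hmem : (k, true) ∈ R.map Block.shape := Multiset.count_pos.1 (by omega)
  obtain ⟨c, hc, hck⟩ := Multiset.mem_map.1 hmem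
  obtain ⟨u, rfl⟩ := Block.exists_eq_one hck
  obtain ⟨R', rfl⟩ := Multiset.exists_cons_of_mem hc
  refine ⟨u, R', rfl, ?_⟩
  rw [Multiset.map_cons, Multiset.count_cons, if_pos hck.symm] at h
  omega

/-- A factor 5 can be traded with another rank one block of scale 2^k, one of scale 2^(k+2), or a
plane of scale 2^(k+1). If none exists, every other block is either of rank one at scale 2^(k+1) or
of scale at least 2^(k+2). The phase at k + 2 then involves only a and the blocks at k + 1. -/
theorem Match.common_of_five {k : ℤ} {a : ZMod 8} {R R' : Multiset Block}
    (h : Match (.one k a ::ₘ R) (.one k (5 * a) ::ₘ R') k) :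
    Common (.one k a ::ₘ R) (.one k (5 * a) ::ₘ R') k := by
  have ha : IsOdd a := h.isOdd_of_mem (Multiset.mem_cons_self _ _)
  have ha5 := isOdd_five_mul ha
  have flip : ∀ (y y' : Block) (R₁ : Multiset Block), R = y ::ₘ R₁ →
      oneCls k a + y.cls = oneCls k (5 * a) + y'.cls → y.shape = y'.shape → y'.Proper →
      Common (.one k a ::ₘ R) (.one k (5 * a) ::ₘ R') k := by
    rintro y y' R₁ rfl he hs hp
    have hE : Equiv (.one k a ::ₘ y ::ₘ R₁) (.one k (5 * a) ::ₘ y' ::ₘ R₁) :=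
      equiv_cons_cons he rfl hs ha5 hp (proper_cons.1 h.proper_tail).2
    exact ((h.of_equiv hE).common_of_mem (Multiset.mem_cons_self _ _)
      (Multiset.mem_cons_self _ _) rfl).of_equiv hE
  have hR : ∀ {j u}, .one j u ∈ R → IsOdd u := fun hu => h.isOdd_of_mem (Multiset.mem_cons_of_mem hu)
  by_cases h1 : ∃ b, .one k b ∈ R
  · obtain ⟨b, hb⟩ := h1
    have hbo := hR hb
    obtain ⟨R₁, hR₁⟩ := Multiset.exists_cons_of_mem hb
    exact flip _ (.one k (5 * b)) R₁ hR₁ (oneCls_add_same k ha hbo) rfl (isOdd_five_mul hbo)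
  by_cases h2 : ∃ b, .one (k + 2) b ∈ R
  · obtain ⟨b, hb⟩ := h2
    have hbo := hR hb
    obtain ⟨R₁, hR₁⟩ := Multiset.exists_cons_of_mem hb
    exact flip _ (.one (k + 2) (5 * b)) R₁ hR₁ (oneCls_add_two k ha hbo) rfl (isOdd_five_mul hbo)
  by_cases h3 : ∃ ε, .plane (k + 1) ε ∈ R
  · obtain ⟨ε, hε⟩ := h3
    obtain ⟨R₁, hR₁⟩ := Multiset.exists_cons_of_mem hε
    refine flip _ (.plane (k + 1) (!ε)) R₁ hR₁ ?_ rfl trivial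
    cases ε with
    | true => exact oneCls_add_planeCls_succ k ha
    | false =>
      have := oneCls_add_planeCls_succ k ha5
      rw [← mul_assoc, show (5 * 5 : ZMod 8) = 1 by decide, one_mul] at this
      exact this.symm
  have hshape : R.map Block.shape = R'.map Block.shape := by
    have := h.shape_eq
    rw [Multiset.map_cons, Multiset.map_cons] at this
    exact (Multiset.cons_inj_right _).1 this
  have hscale : ∀ c ∈ R, (∀ u, c ≠ .one (k + 1) u) → k + 2 ≤ c.shape.1 := by
    intro c hc hne
    have hk := h.le_scale c (Multiset.mem_cons_of_mem hc)
    cases c with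
    | one j u =>
      change k ≤ j at hk
      change k + 2 ≤ j
      have hj : j ≠ k := by rintro rfl; exact h1 ⟨u, hc⟩
      have hj' : j ≠ k + 1 := by rintro rfl; exact hne u rfl
      omega
    | plane j ε =>
      change k ≤ j at hk
      change k + 2 ≤ j
      have hj : j ≠ k := by
        rintro rfl
        exact h.normal j a ε (Multiset.mem_cons_self _ _) (Multiset.mem_cons_of_mem hc)
      have hj' : j ≠ k + 1 := by rintro rfl; exact h3 ⟨ε, hc⟩
      omega
  have hphase := h.phase_eq (k + 2) fun u hu => by
    rcases Multiset.mem_cons.1 hu with hu | hu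
    · have := congrArg (fun c => c.shape.1) hu
      change k + 2 = k at this
      omega
    · exact h2 ⟨u, hu⟩
  rw [phase_cons, phase_cons, Block.phase_one_add_two, Block.phase_one_add_two] at hphase
  -- With no rank one block at k + 1, the phases a and 5a would be equal.
  rcases hn : (R.map Block.shape).count (k + 1, true) with _ | n
  · exfalso
    have hle : ∀ c ∈ R, k + 2 ≤ c.shape.1 := fun c hc => hscale c hc fun u hu => by
      have : (k + 1, true) ∈ R.map Block.shape :=
        Multiset.mem_map.2 ⟨c, hc, by rw [hu]; rfl⟩
      exact (Multiset.count_eq_zero.1 hn) this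
    rw [phase_eq_zero hle, phase_eq_zero (scale_le_of_shape_eq hshape hle)] at hphase
    clear flip h hR h1 h2 h3 hshape hscale hle
    revert a
    decide
  · have hn' := hn
    rw [hshape] at hn'
    obtain ⟨b, R₁, rfl, hb⟩ := exists_cons_of_count hn
    obtain ⟨b', R₁', rfl, hb'⟩ := exists_cons_of_count hn'
    have hbo : IsOdd b := hR (Multiset.mem_cons_self _ _)
    have hbo' : IsOdd b' := h.symm.isOdd_of_mem
      (Multiset.mem_cons_of_mem (Multiset.mem_cons_self _ _))
    have hshape₁ : R₁.map Block.shape = R₁'.map Block.shape := by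
      rw [Multiset.map_cons, Multiset.map_cons] at hshape
      exact (Multiset.cons_inj_right _).1 hshape
    rcases n with _ | n
    -- A single block at k + 1 contributes ±1 to the phase at k + 2, since the sign correction moves
    -- 3 to 7 and 5 to 1. It cannot compensate for the difference 4 between a and 5a.
    · exfalso
      have hle : ∀ c ∈ R₁, k + 2 ≤ c.shape.1 := fun c hc =>
        hscale c (Multiset.mem_cons_of_mem hc) fun u hu => by
          have : (k + 1, true) ∈ R₁.map Block.shape :=
            Multiset.mem_map.2 ⟨c, hc, by rw [hu]; rfl⟩
          exact (Multiset.count_eq_zero.1 hb) this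
      have e : k + 2 = k + 1 + 1 := by ring
      rw [phase_cons, phase_cons, phase_eq_zero hle,
        phase_eq_zero (scale_le_of_shape_eq hshape₁ hle), e, Block.phase_one_succ,
        Block.phase_one_succ, add_zero, add_zero] at hphase
      clear flip h hR h1 h2 h3 hshape hscale hle hn hn' hb hb' hshape₁ ha5
      unfold legendre at hphase
      revert a b b'
      decide
    · obtain ⟨b₂, R₂, rfl, -⟩ := exists_cons_of_count hb
      have hbo₂ : IsOdd b₂ := hR (Multiset.mem_cons_of_mem (Multiset.mem_cons_self _ _))
      have hR₂ : Proper R₂ := (proper_cons.1 (proper_cons.1 h.proper_tail).2).2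
      have hR₁' : Proper R₁' := (proper_cons.1 h.symm.proper_tail).2
      have odd1 : ∀ a b : ZMod 8, IsOdd a → IsOdd b → IsOdd (a + 2 * b) ∧
          IsOdd (b * a * (a + 2 * b)) := by decide
      have E1 : Equiv (.one k a ::ₘ .one (k + 1) b ::ₘ .one (k + 1) b₂ ::ₘ R₂)
          (.one k (a + 2 * b) ::ₘ .one (k + 1) (b * a * (a + 2 * b)) ::ₘ .one (k + 1) b₂ ::ₘ R₂) :=
        equiv_cons_cons (oneCls_add_succ k ha hbo) rfl rfl (odd1 a b ha hbo).1
          (odd1 a b ha hbo).2 (proper_cons.2 ⟨hbo₂, hR₂⟩)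
      have E2 : Equiv (.one k a ::ₘ .one (k + 1) b ::ₘ .one (k + 1) b₂ ::ₘ R₂)
          (.one k (a + 2 * b₂) ::ₘ .one (k + 1) (b₂ * a * (a + 2 * b₂)) ::ₘ .one (k + 1) b ::ₘ R₂) := by
        rw [Multiset.cons_swap (Block.one (k + 1) b)]
        exact equiv_cons_cons (oneCls_add_succ k ha hbo₂) rfl rfl (odd1 a b₂ ha hbo₂).1
          (odd1 a b₂ ha hbo₂).2 (proper_cons.2 ⟨hbo, hR₂⟩)
      have E' : Equiv (.one k (5 * a) ::ₘ .one (k + 1) b' ::ₘ R₁')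
          (.one k (5 * a + 2 * b') ::ₘ .one (k + 1) (b' * (5 * a) * (5 * a + 2 * b')) ::ₘ R₁') :=
        equiv_cons_cons (oneCls_add_succ k ha5 hbo') rfl rfl (odd1 _ b' ha5 hbo').1
          (odd1 _ b' ha5 hbo').2 hR₁'
      -- If b = b₂ modulo 4, two exchanges turn a into 5a. Otherwise one of b, b₂ differs from b'
      -- modulo 4, and one exchange on each side makes the leading entries equal.
      have key : a + 2 * b + 2 * b₂ = 5 * a ∨ 5 * a + 2 * b' = a + 2 * b ∨
          5 * a + 2 * b' = a + 2 * b₂ := by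
        clear flip h hR h1 h2 h3 hshape hscale hn hn' hb hb' hshape₁ ha5 hphase E1 E2 E' odd1
          hR₂ hR₁'
        revert a b b' b₂
        decide
      rcases key with e | e | e
      · have ho := odd1 a b ha hbo
        have E3 : Equiv (.one k (a + 2 * b) ::ₘ .one (k + 1) (b * a * (a + 2 * b)) ::ₘ
            .one (k + 1) b₂ ::ₘ R₂) (.one k (a + 2 * b + 2 * b₂) ::ₘ
            .one (k + 1) (b₂ * (a + 2 * b) * (a + 2 * b + 2 * b₂)) ::ₘ
            .one (k + 1) (b * a * (a + 2 * b)) ::ₘ R₂) := by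
          rw [Multiset.cons_swap (Block.one (k + 1) (b * a * (a + 2 * b)))]
          exact equiv_cons_cons (oneCls_add_succ k ho.1 hbo₂) rfl rfl (odd1 _ b₂ ho.1 hbo₂).1
            (odd1 _ b₂ ho.1 hbo₂).2 (proper_cons.2 ⟨ho.2, hR₂⟩)
        refine ⟨_, _, .one k (5 * a), E1.trans E3, ⟨rfl, rfl, h.proper_right⟩, ?_,
          Multiset.mem_cons_self _ _, rfl⟩
        rw [← e]
        exact Multiset.mem_cons_self _ _
      · refine ⟨_, _, .one k (5 * a + 2 * b'), E1, E', ?_, Multiset.mem_cons_self _ _, rfl⟩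
        rw [e]
        exact Multiset.mem_cons_self _ _
      · refine ⟨_, _, .one k (5 * a + 2 * b'), E2, E', ?_, Multiset.mem_cons_self _ _, rfl⟩
        rw [e]
        exact Multiset.mem_cons_self _ _

end Blocks

/-! ### Splitting off a common block of least scale -/

namespace Blocks

theorem Match.common_of_eq_or {k : ℤ} {a a' : ZMod 8} {R R' : Multiset Block}
    (h : Match (.one k a ::ₘ R) (.one k a' ::ₘ R') k) (haa : a' = a ∨ a' = 5 * a) :
    Common (.one k a ::ₘ R) (.one k a' ::ₘ R') k := by
  rcases haa with rfl | rfl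
  · exact h.common_of_mem (Multiset.mem_cons_self _ _) (Multiset.mem_cons_self _ _) rfl
  · exact h.common_of_five

theorem Match.common_of_mem_eq_or {k : ℤ} {a' : ZMod 8} {S R' : Multiset Block}
    (h : Match S (.one k a' ::ₘ R') k) {b : ZMod 8} (hb : .one k b ∈ S)
    (haa : a' = b ∨ a' = 5 * b) : Common S (.one k a' ::ₘ R') k := by
  obtain ⟨R, rfl⟩ := Multiset.exists_cons_of_mem hb
  exact h.common_of_eq_or haa

/-- The relation `oneCls_add_same` first makes three of the entries equal to some v. These become 3v
plus a plane of sign -, and b₃ absorbs the plane. The purpose is to change the leading entry modulo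
4, from a to -a. -/
theorem four_ones (k : ℤ) {a b₁ b₂ b₃ : ZMod 8} (ha : IsOdd a) (h₁ : b₁ = a ∨ b₁ = 5 * a)
    (h₂ : b₂ = a ∨ b₂ = 5 * a) (h₃ : IsOdd b₃) : ∃ v, (v = a ∨ v = 5 * a) ∧
    oneCls k a + oneCls k b₁ + oneCls k b₂ + oneCls k b₃ =
      oneCls k (3 * v) + oneCls k (3 * b₃) + oneCls k (3 * b₃) + oneCls k (3 * b₃) := by
  have key : ∀ v, IsOdd v → oneCls k v + oneCls k v + oneCls k v + oneCls k b₃ =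
      oneCls k (3 * v) + oneCls k (3 * b₃) + oneCls k (3 * b₃) + oneCls k (3 * b₃) := by
    intro v hv
    have h3 : ∀ b : ZMod 8, IsOdd b → IsOdd (3 * b) ∧ 3 * (3 * b) = b := by decide
    have e1 := oneCls_add_planeCls_true k hv
    have e2 := oneCls_add_planeCls_true k (h3 b₃ h₃).1
    rw [(h3 b₃ h₃).2] at e2
    calc _ = (oneCls k v + (oneCls k v + oneCls k v)) + oneCls k b₃ := by abel
      _ = oneCls k (3 * v) + (oneCls k b₃ + planeCls k true) := by rw [← e1]; abel
      _ = _ := by rw [e2]; abel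
  have ha5 := isOdd_five_mul ha
  have h55 : ∀ a : ZMod 8, 5 * (5 * a) = a := by decide
  rcases h₁ with rfl | rfl <;> rcases h₂ with rfl | rfl
  · exact ⟨_, Or.inl rfl, key _ ha⟩
  · refine ⟨_, Or.inr rfl, ?_⟩
    rw [oneCls_add_same k ha ha]
    exact key _ ha5
  · refine ⟨_, Or.inr rfl, ?_⟩
    rw [add_right_comm (oneCls k b₂), oneCls_add_same k ha ha]
    exact key _ ha5
  · refine ⟨_, Or.inl rfl, ?_⟩
    rw [add_assoc (oneCls k a), oneCls_add_same k ha5 ha5, h55, ← add_assoc]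
    exact key _ ha

/-- The contribution of a rank one block to the next phase is ±1 and depends only on its entry
modulo 4, so here all blocks of scale 2^k contribute equally. -/
theorem Match.phase_succ {k : ℤ} {S S' : Multiset Block} (h : Match S S' k) {a : ZMod 8}
    (ha : IsOdd a) (hS : ∃ u, .one k u ∈ S) (hab : ∀ b, .one k b ∈ S → b = a ∨ b = 5 * a) :
    phase (k + 1) S =
      (S.map Block.shape).count (k, true) • (a + if legendre a = -1 then 4 else 0) := by
  rw [← sum_ite_shape]
  unfold phase
  congr 1
  refine Multiset.map_congr rfl fun c hc => ?_
  obtain ⟨u, hu⟩ := hS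
  have hk := h.le_scale c hc
  cases c with
  | one j b =>
    change k ≤ j at hk
    rcases hk.eq_or_lt with rfl | hk
    · rw [if_pos (show (Block.one k b).shape = (k, true) from rfl), Block.phase_one_succ]
      have := hab b hc
      clear hab hc hu h
      unfold legendre
      revert a b
      decide
    · rw [Block.phase_eq_zero (show k + 1 ≤ j by omega), if_neg]
      intro h'
      have : j = k := congrArg Prod.fst h'
      omega
  | plane j ε =>
    change k ≤ j at hk
    rcases hk.eq_or_lt with rfl | hk
    · exact absurd hc (h.normal k u ε hu)
    · rw [Block.phase_eq_zero (show k + 1 ≤ j by omega), if_neg]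
      intro h'
      have : j = k := congrArg Prod.fst h'
      omega

/-- By `common_of_eq_or`, it suffices to make the leading entries agree modulo 4. A rank one block
at k + 1 changes the class of a, and another block of scale 2^k may already have the right class.
Otherwise all n blocks of scale 2^k have one class on the left and the opposite class on the right.
-/
theorem Match.common_of_one {k : ℤ} {a a' : ZMod 8} {R R' : Multiset Block}
    (h : Match (.one k a ::ₘ R) (.one k a' ::ₘ R') k) :
    Common (.one k a ::ₘ R) (.one k a' ::ₘ R') k := by
  have hma : Block.one k a ∈ .one k a ::ₘ R := Multiset.mem_cons_self _ _
  have hma' : Block.one k a' ∈ .one k a' ::ₘ R' := Multiset.mem_cons_self _ _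
  have ha : IsOdd a := h.isOdd_of_mem hma
  have ha' : IsOdd a' := h.symm.isOdd_of_mem hma'
  by_cases haa : a' = a ∨ a' = 5 * a
  · exact h.common_of_eq_or haa
  by_cases h1 : ∃ b, .one (k + 1) b ∈ R
  · obtain ⟨b, hb⟩ := h1
    have hbo : IsOdd b := h.isOdd_of_mem (Multiset.mem_cons_of_mem hb)
    obtain ⟨R₁, rfl⟩ := Multiset.exists_cons_of_mem hb
    have ho : IsOdd (a + 2 * b) ∧ IsOdd (b * a * (a + 2 * b)) ∧
        (a' = a + 2 * b ∨ a' = 5 * (a + 2 * b)) := by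
      clear h hma hma' hb
      revert a a' b
      decide
    have E : Equiv (.one k a ::ₘ .one (k + 1) b ::ₘ R₁)
        (.one k (a + 2 * b) ::ₘ .one (k + 1) (b * a * (a + 2 * b)) ::ₘ R₁) :=
      equiv_cons_cons (oneCls_add_succ k ha hbo) rfl rfl ho.1 ho.2.1
        (proper_cons.1 h.proper_tail).2
    exact ((h.of_equiv E).common_of_eq_or ho.2.2).of_equiv E
  by_cases h2 : ∃ b, .one k b ∈ .one k a ::ₘ R ∧ (a' = b ∨ a' = 5 * b)
  · obtain ⟨b, hb, hab⟩ := h2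
    exact h.common_of_mem_eq_or hb hab
  by_cases h3 : ∃ b, .one k b ∈ .one k a' ::ₘ R' ∧ (a = b ∨ a = 5 * b)
  · obtain ⟨b, hb, hab⟩ := h3
    exact (h.symm.common_of_mem_eq_or hb hab).symm
  have class_mod : ∀ a a' b : ZMod 8, IsOdd a → IsOdd a' → IsOdd b → ¬ (a' = a ∨ a' = 5 * a) →
      ¬ (a' = b ∨ a' = 5 * b) → b = a ∨ b = 5 * a := by decide
  have haa' : ¬ (a = a' ∨ a = 5 * a') := by
    clear h hma hma' h1 h2 h3
    revert a a'
    decide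
  have hab : ∀ b, .one k b ∈ .one k a ::ₘ R → b = a ∨ b = 5 * a := fun b hb =>
    class_mod a a' b ha ha' (h.isOdd_of_mem hb) haa fun h' => h2 ⟨b, hb, h'⟩
  have hab' : ∀ b, .one k b ∈ .one k a' ::ₘ R' → b = a' ∨ b = 5 * a' := fun b hb =>
    class_mod a' a b ha' ha (h.symm.isOdd_of_mem hb) haa' fun h' => h3 ⟨b, hb, h'⟩
  have hphase := h.phase_eq (k + 1) fun u hu => by
    rcases Multiset.mem_cons.1 hu with hu | hu
    · have := congrArg (fun c => c.shape.1) hu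
      change k + 1 = k at this
      omega
    · exact h1 ⟨u, hu⟩
  rw [h.phase_succ ha ⟨a, hma⟩ hab, h.symm.phase_succ ha' ⟨a', hma'⟩ hab', ← h.shape_eq] at hphase
  -- In the remaining case the phases at k + 1 give 2n = 0 modulo 8 for the number n of rank one
  -- blocks of scale 2^k. So there are at least four of them, and `four_ones` applies.
  obtain ⟨n, hn⟩ : ∃ n, (R.map Block.shape).count (k, true) = n + 3 := by
    rw [Multiset.map_cons, Multiset.count_cons, if_pos (show (k, true) = (Block.one k a).shape from rfl)] at hphase
    generalize (R.map Block.shape).count (k, true) = m at hphase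
    have h4 : ((m + 1 : ℕ) : ZMod 8) * 2 = 0 := by
      rw [nsmul_eq_mul, nsmul_eq_mul] at hphase
      generalize ((m + 1 : ℕ) : ZMod 8) = x at hphase
      clear h hma hma' h1 h2 h3 hab hab' class_mod haa'
      unfold legendre at hphase
      revert a a' x
      decide
    have h5 : (((m + 1) * 2 : ℕ) : ZMod 8) = 0 := by
      rw [Nat.cast_mul]; exact h4
    rw [ZMod.natCast_eq_zero_iff] at h5
    exact ⟨m - 3, by omega⟩
  obtain ⟨b₁, R₁, rfl, hn₁⟩ := exists_cons_of_count hn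
  obtain ⟨b₂, R₂, rfl, hn₂⟩ := exists_cons_of_count hn₁
  obtain ⟨b₃, R₃, rfl, -⟩ := exists_cons_of_count hn₂
  have hb₃ : IsOdd b₃ := h.isOdd_of_mem (j := k) (by simp)
  obtain ⟨v, hv, he⟩ := four_ones k ha (hab b₁ (by simp)) (hab b₂ (by simp)) hb₃
  have hv' : IsOdd (3 * v) ∧ (a' = 3 * v ∨ a' = 5 * (3 * v)) ∧ IsOdd (3 * b₃) := by
    clear h hma hma' h1 h2 h3 hab hab' class_mod haa' hphase hn hn₁ hn₂ he
    revert a a' v b₃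
    decide
  have E : Equiv (.one k a ::ₘ .one k b₁ ::ₘ .one k b₂ ::ₘ .one k b₃ ::ₘ R₃)
      (.one k (3 * v) ::ₘ .one k (3 * b₃) ::ₘ .one k (3 * b₃) ::ₘ .one k (3 * b₃) ::ₘ R₃) :=
    { cls_eq := by
        simp only [cls_cons, ← add_assoc]
        congr 1
      shape_eq := by
        simp only [Multiset.map_cons]
        rfl
      proper := by
        simp only [proper_cons]
        exact ⟨hv'.1, hv'.2.2, hv'.2.2, hv'.2.2,
          (proper_cons.1 (proper_cons.1 (proper_cons.1 h.proper_tail).2).2).2⟩ }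
  exact ((h.of_equiv E).common_of_eq_or hv'.2.1).of_equiv E

/-- The kind of a plane can be changed together with a rank one block at k + 1, and two planes of
sign - can be exchanged for two of sign +. If neither partner is present, the phase at k + 1 shows
the kind of the plane alone. -/
theorem Match.common_of_plane {k : ℤ} {ε ε' : Bool} {R R' : Multiset Block}
    (h : Match (.plane k ε ::ₘ R) (.plane k ε' ::ₘ R') k) :
    Common (.plane k ε ::ₘ R) (.plane k ε' ::ₘ R') k := by
  have hm : Block.plane k ε ∈ .plane k ε ::ₘ R := Multiset.mem_cons_self _ _
  have hm' : Block.plane k ε' ∈ .plane k ε' ::ₘ R' := Multiset.mem_cons_self _ _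
  by_cases hε : ε = ε'
  · subst hε
    exact h.common_of_mem hm hm' rfl
  by_cases h1 : ∃ b, .one (k + 1) b ∈ R
  · obtain ⟨b, hb⟩ := h1
    have hbo : IsOdd b := h.isOdd_of_mem (Multiset.mem_cons_of_mem hb)
    obtain ⟨R₁, rfl⟩ := Multiset.exists_cons_of_mem hb
    have he : planeCls k ε + oneCls (k + 1) b = planeCls k ε' + oneCls (k + 1) (5 * b) := by
      have e1 := planeCls_true_add_oneCls k hbo
      have e2 := planeCls_true_add_oneCls k (isOdd_five_mul hbo)
      rw [← mul_assoc, show (5 * 5 : ZMod 8) = 1 by decide, one_mul] at e2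
      cases ε <;> cases ε'
      · exact absurd rfl hε
      · exact e2.symm
      · exact e1
      · exact absurd rfl hε
    have E : Equiv (.plane k ε ::ₘ .one (k + 1) b ::ₘ R₁)
        (.plane k ε' ::ₘ .one (k + 1) (5 * b) ::ₘ R₁) :=
      equiv_cons_cons he rfl rfl trivial (isOdd_five_mul hbo) (proper_cons.1 h.proper_tail).2
    exact ((h.of_equiv E).common_of_mem (Multiset.mem_cons_self _ _) hm' rfl).of_equiv E
  by_cases h2 : ∃ δ, .plane k δ ∈ R
  · obtain ⟨δ, hδ⟩ := h2
    by_cases hδε : δ = ε'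
    · subst hδε
      exact h.common_of_mem (Multiset.mem_cons_of_mem hδ) hm' rfl
    · obtain ⟨R₁, rfl⟩ := Multiset.exists_cons_of_mem hδ
      have he : planeCls k ε + planeCls k δ = planeCls k ε' + planeCls k ε' := by
        have e := planeCls_true_add_true k
        revert e hε hδε
        cases ε <;> cases ε' <;> cases δ <;> simp +contextual [eq_comm]
      have E : Equiv (.plane k ε ::ₘ .plane k δ ::ₘ R₁) (.plane k ε' ::ₘ .plane k ε' ::ₘ R₁) :=
        equiv_cons_cons he rfl rfl trivial trivial (proper_cons.1 h.proper_tail).2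
      exact ((h.of_equiv E).common_of_mem (Multiset.mem_cons_self _ _) hm' rfl).of_equiv E
  exfalso
  have hle : ∀ c ∈ R, k + 1 ≤ c.shape.1 := by
    intro c hc
    have hk := h.le_scale c (Multiset.mem_cons_of_mem hc)
    cases c with
    | one j u =>
      change k ≤ j at hk
      change k + 1 ≤ j
      have hj : j ≠ k := by
        rintro rfl
        exact h.normal j u ε (Multiset.mem_cons_of_mem hc) hm
      omega
    | plane j δ =>
      change k ≤ j at hk
      change k + 1 ≤ j
      have hj : j ≠ k := by rintro rfl; exact h2 ⟨δ, hc⟩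
      omega
  have hshape : R.map Block.shape = R'.map Block.shape := by
    have := h.shape_eq
    rw [Multiset.map_cons, Multiset.map_cons] at this
    exact (Multiset.cons_inj_right _).1 this
  have hphase := h.phase_eq (k + 1) fun u hu => by
    rcases Multiset.mem_cons.1 hu with hu | hu
    · exact Block.noConfusion hu
    · exact h1 ⟨u, hu⟩
  rw [phase_cons, phase_cons, phase_eq_zero hle, phase_eq_zero (scale_le_of_shape_eq hshape hle),
    Block.phase_plane_succ, Block.phase_plane_succ] at hphase
  clear h hm hm' h1 h2 hle hshape
  revert ε ε'
  decide

theorem Match.tail {k : ℤ} {c : Block} {R R' : Multiset Block} (h : Match (c ::ₘ R) (c ::ₘ R') k)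
    (hc : c.shape.1 = k) : Match R R' k where
  proper_left := h.proper_tail
  proper_right := h.symm.proper_tail
  shape_eq := by
    have := h.shape_eq
    rw [Multiset.map_cons, Multiset.map_cons] at this
    exact (Multiset.cons_inj_right _).1 this
  normal j u ε hu hε := h.normal j u ε (Multiset.mem_cons_of_mem hu) (Multiset.mem_cons_of_mem hε)
  phase_eq j hj := by
    by_cases hj' : ∃ u, c = .one j u
    · obtain ⟨u, rfl⟩ := hj'
      obtain rfl : j = k := hc
      -- Removing a rank one block may empty the scale 2^k of rank one blocks, and then a comparison
      -- at k is newly required. All remaining blocks have scale at least 2^k, so both phases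
      -- vanish.
      rw [phase_eq_zero fun x hx => h.le_scale x (Multiset.mem_cons_of_mem hx),
        phase_eq_zero fun x hx => h.symm.le_scale x (Multiset.mem_cons_of_mem hx)]
    · have := h.phase_eq j fun u hu => (Multiset.mem_cons.1 hu).elim
        (fun h' => hj' ⟨u, h'.symm⟩) (hj u)
      rw [phase_cons, phase_cons] at this
      exact add_left_cancel this
  le_scale x hx := h.le_scale x (Multiset.mem_cons_of_mem hx)

theorem Match.common {k : ℤ} {S S' : Multiset Block} (h : Match S S' k) {c : Block} (hc : c ∈ S)
    (hck : c.shape.1 = k) : Common S S' k := by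
  obtain ⟨c', hc', hcc⟩ : ∃ c' ∈ S', c'.shape = c.shape := by
    have : c.shape ∈ S'.map Block.shape := h.shape_eq ▸ Multiset.mem_map_of_mem Block.shape hc
    exact Multiset.mem_map.1 this
  obtain ⟨R, rfl⟩ := Multiset.exists_cons_of_mem hc
  obtain ⟨R', rfl⟩ := Multiset.exists_cons_of_mem hc'
  cases c with
  | one j u =>
    obtain rfl : j = k := hck
    obtain ⟨u', rfl⟩ := Block.exists_eq_one hcc
    exact h.common_of_one
  | plane j ε =>
    obtain rfl : j = k := hck
    obtain ⟨ε', rfl⟩ := Block.exists_eq_plane hcc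
    exact h.common_of_plane

/-- Sums of blocks with the same shapes and the same phases are isometric. -/
theorem Match.cls_eq {S S' : Multiset Block} {k : ℤ} (h : Match S S' k) : cls S = cls S' := by
  classical
  induction hn : S.card generalizing S S' k with
  | zero =>
    have hS : S = 0 := Multiset.card_eq_zero.1 hn
    subst hS
    have := h.shape_eq
    rw [Multiset.map_zero, eq_comm, Multiset.map_eq_zero] at this
    rw [this]
  | succ n ih =>
    obtain ⟨c₀, hc₀⟩ := Multiset.card_pos_iff_exists_mem.1 (show 0 < S.card by omega)
    -- The lower bound k is raised to the least scale that occurs, where a common block can be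
    -- produced.
    obtain ⟨c, hc, hmin⟩ := S.toFinset.exists_min_image (fun c => c.shape.1)
      ⟨c₀, Multiset.mem_toFinset.2 hc₀⟩
    have h' : Match S S' c.shape.1 :=
      { h with le_scale := fun x hx => hmin x (Multiset.mem_toFinset.2 hx) }
    obtain ⟨T, T', x, hT, hT', hx, hx', hxk⟩ := h'.common (Multiset.mem_toFinset.1 hc) rfl
    obtain ⟨R, rfl⟩ := Multiset.exists_cons_of_mem hx
    obtain ⟨R', rfl⟩ := Multiset.exists_cons_of_mem hx'
    have hm := (((h'.of_equiv hT).symm.of_equiv hT').symm).tail hxk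
    have hcard := congrArg Multiset.card hT.shape_eq
    rw [Multiset.card_map, Multiset.card_map, Multiset.card_cons] at hcard
    rw [hT.cls_eq, hT'.cls_eq, cls_cons, cls_cons, ih hm (by omega)]

end Blocks

namespace JordanDecomposition

/-! ### Jordan decompositions: phases and blocks -/

theorem exists_common_support {L L' : Type*} [AddCommGroup L] [Module ℤ_[2] L]
    [Module.Finite ℤ_[2] L] [AddCommGroup L'] [Module ℤ_[2] L'] [Module.Finite ℤ_[2] L']
    {B : L →ₗ[ℤ_[2]] L →ₗ[ℤ_[2]] ℚ_[2]} {B' : L' →ₗ[ℤ_[2]] L' →ₗ[ℤ_[2]] ℚ_[2]}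
    (J : JordanDecomposition B) (J' : JordanDecomposition B') :
    ∃ a b : ℤ, (∀ i, i ∉ Finset.Ico a b → J.constituent i = ⊥) ∧
      ∀ i, i ∉ Finset.Ico a b → J'.constituent i = ⊥ := by
  obtain ⟨a, b, h⟩ := J.exists_support
  obtain ⟨a', b', h'⟩ := J'.exists_support
  refine ⟨min a a', max b b', fun i hi => h i ?_, fun i hi => h' i ?_⟩ <;>
    rw [Finset.mem_Ico] at * <;> omega

variable {L : Type*} [AddCommGroup L] [Module ℤ_[2] L] [Module.Free ℤ_[2] L]
  [Module.Finite ℤ_[2] L] {B : L →ₗ[ℤ_[2]] L →ₗ[ℤ_[2]] ℚ_[2]} (J : JordanDecomposition B)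

/-- The oddity of the term of scale `2 ^ i`. -/
def termOddity (i : ℤ) : ZMod 8 := latticeOddity (rescale B (J.constituent i) i)

variable {J} {a b : ℤ}

theorem legal (hB : ∀ x y, B x y = B y x) (hJ : ∀ i, i ∉ Finset.Ico a b → J.constituent i = ⊥) :
    J.symbol.Legal J.termOddity a b where
  trivial i hi := by
    obtain ⟨h1, h2⟩ := latticeSign_eq_one_of_finrank hB (J.unimodular i) hi
    exact ⟨h1, fun h => h h2⟩
  support i hi := by
    change Module.finrank ℤ_[2] (J.constituent i) = 0
    rw [hJ i hi]
    exact finrank_bot ℤ_[2] L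
  oddity_typeII i hi := latticeOddity_eq_zero_of_isEven hB (J.unimodular i) (not_not.1 hi)
  oddity_eq i := by
    classical
    change (∑ᶠ j ∈ compartment J.symbol.typeI i, J.termOddity j) = _
    simp only [finsum_eq_if]
    rw [finsum_eq_sum_of_support_subset (s := Finset.Ico a b)]
    · intro j hj
      by_contra hn
      refine hj (if_neg fun hm => (right_of_mem_compartment hm : J.symbol.typeI j) ?_)
      refine (latticeSign_eq_one_of_finrank hB (J.unimodular j) ?_).2
      rw [hJ j hn]
      exact finrank_bot ℤ_[2] L
  bad i h1 h2 h3 h4 h5 h6 := by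
    have ho : J.symbol.oddity i = J.termOddity i + J.termOddity (i + 1) := by
      change (∑ᶠ j ∈ compartment J.symbol.typeI i, J.termOddity j) = _
      rw [compartment_eq_pair h1 h2 h3 h4, finsum_mem_pair (by omega)]
    obtain ⟨o1, s1⟩ := latticeSign_eq_of_finrank_eq_one hB (J.unimodular i) h5 h1
    obtain ⟨o2, s2⟩ := latticeSign_eq_of_finrank_eq_one hB (J.unimodular (i + 1)) h6 h2
    change J.symbol.sign i = legendre (J.termOddity i) at s1
    change J.symbol.sign (i + 1) = legendre (J.termOddity (i + 1)) at s2
    change IsOdd (J.termOddity i) at o1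
    change IsOdd (J.termOddity (i + 1)) at o2
    rw [ho, s1, s2]
    generalize J.termOddity i = x at o1
    generalize J.termOddity (i + 1) = y at o2
    clear ho s1 s2
    unfold legendre
    revert x y
    decide

/-- This links the two sides: a Gauss mean intrinsic to the lattice has the phase that is read off
the symbol of any Jordan decomposition. -/
theorem formPhase (hB : ∀ x y, B x y = B y x)
    (hJ : ∀ i, i ∉ Finset.Ico a b → J.constituent i = ⊥) {k : ℤ} (hk : ¬ J.symbol.typeI k) :
    FormPhase B k (J.symbol.phase J.termOddity a b k) := by
  choose c hc using fun i => exists_rep (B.domRestrict₁₂ (J.constituent i) (J.constituent i))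
  refine (J.rep_sum c hc _ hJ).formPhase (LatClass.Phase.sum _ _ _ _ fun i _ => ?_)
  refine (hc i).phase (formPhase_of_rescale hB (J.unimodular i) ?_)
  by_cases hki : k = i
  · subst hki
    exact Or.inr (not_not.1 hk)
  · exact Or.inl hki

open Classical in
/-- The shapes of the blocks of a decomposition. -/
def shapes (S : Symbol) (a b : ℤ) : Multiset (ℤ × Bool) :=
  ∑ i ∈ Finset.Ico a b, (Multiset.replicate (if S.typeI i then S.dim i else 0) (i, true) +
    Multiset.replicate (if S.typeI i then 0 else S.dim i / 2) (i, false))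

theorem map_sum_blocks {β : Type*} (f : Block → β) (s : Finset ℤ) (us : ℤ → Multiset (ZMod 8))
    (es : ℤ → Multiset Bool) :
    (∑ i ∈ s, ((us i).map (Block.one i) + (es i).map (Block.plane i))).map f =
      ∑ i ∈ s, ((us i).map (f ∘ Block.one i) + (es i).map (f ∘ Block.plane i)) := by
  refine (map_sum (Multiset.mapAddMonoidHom f) _ _).trans (Finset.sum_congr rfl fun i _ => ?_)
  change ((us i).map (Block.one i) + (es i).map (Block.plane i)).map f = _
  rw [Multiset.map_add, Multiset.map_map, Multiset.map_map]

theorem exists_blocks (hB : ∀ x y, B x y = B y x)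
    (hJ : ∀ i, i ∉ Finset.Ico a b → J.constituent i = ⊥) :
    ∃ S : Multiset Block, Rep B (Blocks.cls S) ∧ Blocks.Proper S ∧
      S.map Block.shape = shapes J.symbol a b ∧ (∀ j u, .one j u ∈ S → J.symbol.typeI j) ∧
      (∀ j ε, .plane j ε ∈ S → ¬ J.symbol.typeI j) ∧
      (∀ j, J.symbol.typeI j → ∃ u, .one j u ∈ S) ∧ ∀ c ∈ S, a ≤ c.shape.1 := by
  choose us es h1 h2 h3 h4 h5 using fun i => exists_blockSum_of_rescale hB (J.unimodular i)
  let S : Multiset Block :=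
    ∑ i ∈ Finset.Ico a b, ((us i).map (Block.one i) + (es i).map (Block.plane i))
  have hmem : ∀ c, c ∈ S ↔ ∃ i ∈ Finset.Ico a b,
      (∃ u ∈ us i, Block.one i u = c) ∨ ∃ ε ∈ es i, Block.plane i ε = c := fun c => by
    simp only [S, Multiset.mem_sum, Multiset.mem_add, Multiset.mem_map]
  have hone : ∀ j u, .one j u ∈ S → u ∈ us j := fun j u hu => by
    obtain ⟨i, -, ⟨v, hv, h⟩ | ⟨ε, -, h⟩⟩ := (hmem _).1 hu
    · cases h; exact hv
    · cases h
  have hplane : ∀ j ε, .plane j ε ∈ S → ε ∈ es j := fun j u hu => by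
    obtain ⟨i, -, ⟨v, hv, h⟩ | ⟨ε, hε, h⟩⟩ := (hmem _).1 hu
    · cases h
    · cases h; exact hε
  refine ⟨S, ?_, ?_, ?_, ?_, ?_, ?_, ?_⟩
  · have : Blocks.cls S = ∑ i ∈ Finset.Ico a b, blockSum i (us i) (es i) := by
      unfold Blocks.cls
      rw [map_sum_blocks]
      refine (map_sum Multiset.sumAddMonoidHom _ _).trans (Finset.sum_congr rfl fun i _ => ?_)
      exact Multiset.sum_add _ _
    rw [this]
    exact J.rep_sum _ h1 _ hJ
  · intro c hc
    cases c with
    | one j u => exact h2 j u (hone j u hc)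
    | plane j ε => trivial
  · rw [map_sum_blocks]
    refine Finset.sum_congr rfl fun i _ => ?_
    have e1 : (us i).map (Block.shape ∘ Block.one i) = Multiset.replicate (us i).card (i, true) :=
      Multiset.map_const _ _
    have e2 : (es i).map (Block.shape ∘ Block.plane i) =
        Multiset.replicate (es i).card (i, false) := Multiset.map_const _ _
    have hcard : (us i).card + 2 * (es i).card = J.symbol.dim i := h3 i
    rw [e1, e2]
    by_cases hi : J.symbol.typeI i
    · rw [if_pos hi, if_pos hi, ← hcard, (h5 i hi).2, Multiset.card_zero, mul_zero, add_zero]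
    · rw [if_neg hi, if_neg hi, ← hcard, h4 i (not_not.1 hi), Multiset.card_zero]
      congr 2
      omega
  · intro j u hu hj
    have := hone j u hu
    rw [h4 j hj] at this
    exact Multiset.notMem_zero _ this
  · intro j ε hε hj
    have := hplane j ε hε
    rw [(h5 j hj).2] at this
    exact Multiset.notMem_zero _ this
  · intro j hj
    obtain ⟨u, hu⟩ := Multiset.exists_mem_of_ne_zero (h5 j hj).1
    refine ⟨u, (hmem _).2 ⟨j, ?_, Or.inl ⟨u, hu, rfl⟩⟩⟩
    exact (legal hB hJ).mem_Ico ((legal hB hJ).dim_ne_zero hj)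
  · intro c hc
    obtain ⟨i, hi, ⟨v, -, rfl⟩ | ⟨ε, -, rfl⟩⟩ := (hmem _).1 hc
    · exact (Finset.mem_Ico.1 hi).1
    · exact (Finset.mem_Ico.1 hi).1

variable {L' : Type*} [AddCommGroup L'] [Module ℤ_[2] L'] [Module.Free ℤ_[2] L']
  [Module.Finite ℤ_[2] L'] {B' : L' →ₗ[ℤ_[2]] L' →ₗ[ℤ_[2]] ℚ_[2]} {J' : JordanDecomposition B'}

theorem reflTransGen_of_isometric (hB : ∀ x y, B x y = B y x) (hB' : ∀ x y, B' x y = B' y x)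
    (hiso : Isometric B B') : Relation.ReflTransGen Symbol.SignWalk J.symbol J'.symbol := by
  obtain ⟨a, b, hJ, hJ'⟩ := exists_common_support J J'
  have htype := symbol_typeI_eq J J' hB hB' hiso
  exact Symbol.SamePhase.reflTransGen (a := a) (b := b)
    ⟨legal hB hJ, legal hB' hJ', symbol_dim_eq J J' hB hB' hiso, htype, fun k hk =>
      HasPhase.unique (formPhase hB hJ hk)
        ((formPhase hB' hJ' (htype ▸ hk)).of_isometric hiso)⟩

theorem isometric_of_reflTransGen (hB : ∀ x y, B x y = B y x) (hB' : ∀ x y, B' x y = B' y x)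
    (h : Relation.ReflTransGen Symbol.SignWalk J.symbol J'.symbol) : Isometric B B' := by
  obtain ⟨a, b, hJ, hJ'⟩ := exists_common_support J J'
  obtain ⟨o, ho⟩ := (legal hB hJ).of_reflTransGen h
  obtain ⟨S, hS, hSp, hSs, hS1, hS2, hS3, hSa⟩ := exists_blocks hB hJ
  obtain ⟨S', hS', hSp', hSs', hS1', -, -, -⟩ := exists_blocks hB' hJ'
  have hm : Blocks.Match S S' a :=
    { proper_left := hSp
      proper_right := hSp'
      shape_eq := by
        rw [hSs, hSs']
        unfold shapes
        rw [ho.dim_eq, ho.typeI_eq]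
      normal := fun j u ε hu hε => hS2 j ε hε (hS1 j u hu)
      phase_eq := fun j hj => by
        have hTj : ¬ J.symbol.typeI j := fun hT => by
          obtain ⟨u, hu⟩ := hS3 j hT
          exact hj u hu
        have hTj' : ¬ J'.symbol.typeI j := ho.typeI_eq ▸ hTj
        have e1 := HasPhase.unique (hS.formPhase (Blocks.cls_phase hSp hj)) (formPhase hB hJ hTj)
        have e2 := HasPhase.unique (hS'.formPhase (Blocks.cls_phase hSp'
          fun u hu => hTj' (hS1' j u hu))) (formPhase hB' hJ' hTj')
        -- The walks from `J` distribute the compartment oddities as `o`, and the constituents of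
        -- `J'` may distribute them differently. `Legal.phase_eq` says that the phase does not
        -- notice.
        rw [e1, e2, ho.phase_eq j hTj, ho.right.phase_eq (legal hB' hJ') hTj']
      le_scale := hSa }
  rw [← hm.cls_eq] at hS'
  exact hS.isometric hS'

end JordanDecomposition

end TwoAdic

end

theorem mainTheorem1
    {L : Type*} [AddCommGroup L] [Module ℤ_[2] L] [Module.Free ℤ_[2] L] [Module.Finite ℤ_[2] L]
    {L' : Type*} [AddCommGroup L'] [Module ℤ_[2] L'] [Module.Free ℤ_[2] L']
    [Module.Finite ℤ_[2] L']
    (B : L →ₗ[ℤ_[2]] L →ₗ[ℤ_[2]] ℚ_[2]) (B' : L' →ₗ[ℤ_[2]] L' →ₗ[ℤ_[2]] ℚ_[2])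
    (hB : ∀ x y, B x y = B y x) (hB' : ∀ x y, B' x y = B' y x)
    (hBnondeg : ∀ x, (∀ y, B x y = 0) → x = 0)
    (hBnondeg' : ∀ x, (∀ y, B' x y = 0) → x = 0)
    (J : TwoAdic.JordanDecomposition B) (J' : TwoAdic.JordanDecomposition B') :
    TwoAdic.Isometric B B' ↔
      Relation.ReflTransGen TwoAdic.Symbol.SignWalk J.symbol J'.symbol :=
  ⟨TwoAdic.JordanDecomposition.reflTransGen_of_isometric hB hB',
    TwoAdic.JordanDecomposition.isometric_of_reflTransGen hB hB'⟩
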